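/- Let $\sigma>0$ and let $\mu$ be a symmetric probability measure on $\mathbb R$ with variance $\sigma^2$ satisfying a Poincaré inequality: there is $C>0$ such that $\int |f-\int f\,d\mu|^2\,d\mu\le C\int |f'|^2\,d\mu$ for every $\mathcal C^1$ function $f:\mathbb R\to\mathbb C$ with $f,f'\in L^2(\mu)$. Let $\kappa_4=\int x^4\,d\mu-3\sigma^4$ be the fourth cumulant of $\mu$. Let $\theta_1>\cdots>\theta_J$ be real numbers with $\theta_{j_0}=0$ for some $j_0$, and let $k_j\ge 1$ ($j\ne j_0$) be integers; put $r=\sum_{j\neq j_0}k_j$. For $N\ge 1$ with $N\ge r$, let $W_N$ be a random $N\times N$ Hermitian matrix such that the $N^2$ random variables $(W_N)_{ii}$, $\sqrt2\,\Re (W_N)_{ij}$, $\sqrt2\,\Im (W_N)_{ij}$ ($i<j$) are independent with common law $\mu$, and let $A_N$ be a deterministic $N\times N$ Hermitian matrix whose non-zero eigenvalues are the $\theta_j$, $j\neq j_0$, with multiplicities $k_j$ (the eigenvalue $0$ having multiplicity $N-r$). Set $M_N=\frac1{\sqrt N}W_N+A_N$ and $$g_N(z)=\mathbb E\Big[\tfrac1N\operatorname{Tr}\,(zI_N-M_N)^{-1}\Big],\qquad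 g_\sigma(z)=\frac1{2\pi\sigma^2}\int_{-2\sigma}^{2\sigma}\frac{\sqrt{4\sigma^2-x^2}}{z-x}\,dx .$$ Then there exist a polynomial $P_{14}$ of degree $14$ with positive coefficients and a constant $K>0$, depending only on $\mu$, the $\theta_j$ and the $k_j$, such that for all such $N$, $W_N$, $A_N$ and all $z\in\mathbb C$ with $\Im z>0$, $$\Big|\sigma^2 g_N(z)^2-z\,g_N(z)+1+\frac1N E_\sigma(z)\Big|\le \frac{P_{14}(|\Im z|^{-1})}{N^2}\,(|z|+K),$$ where $$E_\sigma(z)=\sum_{j\ne j_0}k_j\,\frac{\theta_j}{z-\sigma^2 g_\sigma(z)-\theta_j}+\frac{\kappa_4}{2}\,g_\sigma(z)^4 .$$ -/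

import Mathlib

namespace DeformedWigner

open MeasureTheory ProbabilityTheory

/-- `μ` satisfies a Poincaré inequality: for some `C > 0` and every `C¹` function `f : ℝ → ℂ`
with `f, f' ∈ L²(μ)`, the variance of `f` is at most `C ∫ |f'|² dμ`. -/
def SatisfiesPoincare (μ : Measure ℝ) : Prop :=
  ∃ C : ℝ, 0 < C ∧ ∀ f : ℝ → ℂ, ContDiff ℝ 1 f → MemLp f 2 μ → MemLp (deriv f) 2 μ →
    ∫ x, ‖f x - ∫ y, f y ∂μ‖ ^ 2 ∂μ ≤ C * ∫ x, ‖deriv f x‖ ^ 2 ∂μ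

/-- The fourth cumulant of a distribution on `ℝ`: `E[(ξ - Eξ)⁴] - 3 E[(ξ - Eξ)²]²`. -/
noncomputable def fourthCumulant (μ : Measure ℝ) : ℝ :=
  centralMoment id 4 μ - 3 * centralMoment id 2 μ ^ 2

/-- The centered semicircle law of variance `σ²`. -/
noncomputable def semicircleLaw (σ : ℝ) : Measure ℝ :=
  volume.withDensity fun x => ENNReal.ofReal
    ((Set.Icc (-2 * σ) (2 * σ)).indicator
      (fun x => 1 / (2 * Real.pi * σ ^ 2) * Real.sqrt (4 * σ ^ 2 - x ^ 2)) x)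

/-- The Stieltjes transform `g_σ(z) = E[(z - s)⁻¹]`, where `s` has the semicircle law. -/
noncomputable def gSemicircle (σ : ℝ) (z : ℂ) : ℂ :=
  ∫ x, (z - (x : ℂ))⁻¹ ∂(semicircleLaw σ)

/-- The `N²` real coordinates of an `N × N` Hermitian matrix `W`, indexed by all pairs `(i, j)`:
`W i i` on the diagonal, `√2 Re (W i j)` at `(i, j)` with `i < j`, and `√2 Im (W i j)` at the
transposed position `(j, i)`. -/
noncomputable def hermitianCoord {N : ℕ} (W : Matrix (Fin N) (Fin N) ℂ) (p : Fin N × Fin N) : ℝ :=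
  if p.1 = p.2 then (W p.1 p.1).re
  else if p.1 < p.2 then Real.sqrt 2 * (W p.1 p.2).re
  else Real.sqrt 2 * (W p.2 p.1).im

/-- `W` is a Hermitian Wigner matrix with entry distribution `μ`: the `N²` random variables `W i i`,
`√2 Re (W i j)`, `√2 Im (W i j)` (`i < j`) are independent with common law `μ`. -/
structure IsHermitianWigner {Ω : Type*} [MeasurableSpace Ω] (P : Measure Ω) (μ : Measure ℝ) {N : ℕ}
    (W : Ω → Matrix (Fin N) (Fin N) ℂ) : Prop where
  isHermitian : ∀ ω, (W ω).IsHermitian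
  hasLaw : ∀ p, HasLaw (fun ω => hermitianCoord (W ω) p) μ P
  indep : iIndepFun (fun p ω => hermitianCoord (W ω) p) P

/-- `A` is an `N × N` Hermitian matrix similar to
`diag(θ₁, …, θ₁, …, 0, …, 0, …, θ_J, …, θ_J)`, where `θ_j` is repeated `k j` times for `j ≠ j₀` and
`0 = θ_{j₀}` fills the remaining places. The map `c` sends a diagonal position to the index of the
number standing there. -/
structure IsFiniteRankDeformation {J : ℕ} (θ : Fin J → ℝ) (j₀ : Fin J) (k : Fin J → ℕ) {N : ℕ}
    (A : Matrix (Fin N) (Fin N) ℂ) : Prop where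
  isHermitian : A.IsHermitian
  similar : ∃ c : Fin N → Fin J, Monotone c ∧
    (∀ j, j ≠ j₀ → (Finset.univ.filter fun i => c i = j).card = k j) ∧
    ∃ Q : (Matrix (Fin N) (Fin N) ℂ)ˣ,
      A = Q.val * Matrix.diagonal (fun i => ((θ (c i) : ℝ) : ℂ)) * Q⁻¹.val

/-- The deformed Wigner matrix `M_N = N^{-1/2} W_N + A_N`. -/
noncomputable def deformedMatrix {N : ℕ} (W A : Matrix (Fin N) (Fin N) ℂ) :
    Matrix (Fin N) (Fin N) ℂ :=
  ((1 / Real.sqrt N : ℝ) : ℂ) • W + A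

/-- The resolvent `(z I - M)⁻¹`. -/
noncomputable def resolvent {N : ℕ} (M : Matrix (Fin N) (Fin N) ℂ) (z : ℂ) :
    Matrix (Fin N) (Fin N) ℂ :=
  (z • (1 : Matrix (Fin N) (Fin N) ℂ) - M)⁻¹

/-- `g_N(z) = E[tr_N (G_N(z))]`, with `tr_N` the normalized trace and `G_N` the resolvent of
`M_N = N^{-1/2} W_N + A_N`. -/
noncomputable def gN {Ω : Type*} [MeasurableSpace Ω] (P : Measure Ω) {N : ℕ}
    (W : Ω → Matrix (Fin N) (Fin N) ℂ) (A : Matrix (Fin N) (Fin N) ℂ) (z : ℂ) : ℂ :=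
  ∫ ω, (1 / (N : ℂ)) * (resolvent (deformedMatrix (W ω) A) z).trace ∂P

/-- `E_σ(z) = ∑_{j ≠ j₀} k_j θ_j / (z - σ² g_σ(z) - θ_j) + (κ₄ / 2) g_σ(z)⁴`. -/
noncomputable def ESigma (σ κ₄ : ℝ) {J : ℕ} (θ : Fin J → ℝ) (j₀ : Fin J) (k : Fin J → ℕ)
    (z : ℂ) : ℂ :=
  (∑ j ∈ Finset.univ.erase j₀,
    (k j : ℂ) * ((θ j : ℂ) / (z - (σ : ℂ) ^ 2 * gSemicircle σ z - (θ j : ℂ))))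
  + (κ₄ : ℂ) / 2 * gSemicircle σ z ^ 4

end DeformedWigner

/-! Write `W = ∑ x_p H_p` in an orthonormal basis `H_p` of the Hermitian matrices, so that the
coordinates `x_p` are independent with law `μ`, and let `G` be the resolvent, `y = 1 / Im z`, `γ =
g_N(z)`, `g = g_σ(z)`. Taking the normalized trace and the mean of `(z - M) G = 1` gives `zγ - E
Tr(AG)/N - 1 = N^{-3/2} ∑_p E[x_p Tr(H_p G)]`. The right side is evaluated by a cumulant expansion
in each coordinate: `G` is compared with the resolvent `G₀` in which `x_p` is set to `0`, which is
independent of `x_p`. Symmetry removes the odd moments. The variance term sums to `σ² E[(Tr G /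
N)²]` because `∑ H_p B H_p = Tr(B) 1`; the fourth cumulant term sums, up to `O(N⁻²)`, to `κ₄/(2N)
E[(N⁻¹ ∑ G_ii²)²]`, because `∑_p Tr (H_p G)⁴` is `(∑ G_ii²)²/2` plus terms of order `N`. This is
`loop_fourth_order`.

Three replacements remain, each costing `O(N⁻²)`. The Poincaré inequality tensorizes (`poincare_pi`,
through Efron–Stein), so `Tr G / N` has variance `O(N⁻²)` and `E[(Tr G / N)²]` becomes `γ²`. The
other two terms already carry a factor `1/N`, so only their leading values are needed: `E Tr(AG)`
tends to the sum over the spikes and the diagonal statistic tends to `g⁴`, both with error `O(1/N)`.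

These leading values come from one cheaper equation, `loop_equation_idempotent`: the second-order
expansion of `Tr(Q(z - M)G)` for an idempotent `Q`, with error proportional to `(1 + hs Q)/N`. With
`Q = 1` it says that `γ` almost solves `σ²γ² - zγ + 1 = 0`, and stability of this equation in the
lower half plane (`norm_sub_gSemicircle_le`) gives `γ - g = O(1/N)`. With `Q` a spectral projection
of `A` it determines `E Tr(QG)`, hence `E Tr(AG)`. With `Q` a diagonal matrix unit it locates `G_ii`
near `g`, up to the matching entry of `E[AG]`, and these entries are square summable since `A` has
bounded Hilbert–Schmidt norm.

All errors are powers of `1 + y`. The largest is the diagonal statistic: a mean square error `(1 +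
y)^12`, multiplied by `2(1 + y)²` when the statistic is squared. This is the degree 14. -/

namespace DeformedWigner

open MeasureTheory ProbabilityTheory

/-! ### Moments of a symmetric law satisfying a Poincaré inequality. -/

/-- The bounded truncation `x / (1 + ε x²)` of the identity. -/
noncomputable def softTrunc (ε x : ℝ) : ℝ := x / (1 + ε * x ^ 2)

lemma softTrunc_hasDerivAt {ε : ℝ} (hε : 0 < ε) (x : ℝ) :
    HasDerivAt (softTrunc ε) ((1 - ε * x ^ 2) / (1 + ε * x ^ 2) ^ 2) x := by
  have h0 : 1 + ε * x ^ 2 ≠ 0 := by positivity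
  have h1 : HasDerivAt (fun x : ℝ => 1 + ε * x ^ 2) (ε * (2 * x)) x := by
    simpa using ((hasDerivAt_pow 2 x).const_mul ε).const_add 1
  refine ((hasDerivAt_id x).div h1 h0).congr_deriv ?_
  simp only [id]
  ring

lemma abs_softTrunc_le {ε : ℝ} (hε : 0 < ε) (x : ℝ) : |softTrunc ε x| ≤ |x| := by
  rw [softTrunc, abs_div]
  refine div_le_self (abs_nonneg _) ?_
  rw [abs_of_pos (by positivity)]
  nlinarith [mul_nonneg hε.le (sq_nonneg x)]

lemma abs_softTrunc_le_const {ε : ℝ} (hε : 0 < ε) (x : ℝ) : |softTrunc ε x| ≤ 1 + 1 / ε := by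
  rw [softTrunc, abs_div, abs_of_pos (by positivity : 0 < 1 + ε * x ^ 2),
    div_le_iff₀ (by positivity)]
  have h1 : (1 + 1 / ε) * (1 + ε * x ^ 2) = 1 + x ^ 2 + 1 / ε + ε * x ^ 2 := by field_simp; ring
  rw [h1]
  have : |x| ≤ 1 + x ^ 2 := by nlinarith [sq_abs x, sq_nonneg (|x| - 1)]
  have : 0 < 1 / ε := by positivity
  nlinarith [mul_nonneg hε.le (sq_nonneg x)]

lemma abs_deriv_softTrunc_le {ε : ℝ} (hε : 0 < ε) (x : ℝ) :
    |(1 - ε * x ^ 2) / (1 + ε * x ^ 2) ^ 2| ≤ 1 := by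
  have h := mul_nonneg hε.le (sq_nonneg x)
  rw [abs_div, abs_of_pos (by positivity : 0 < (1 + ε * x ^ 2) ^ 2), div_le_one (by positivity),
    abs_le]
  constructor <;> nlinarith

lemma integral_sq_le_of_variance_le {μ : Measure ℝ} [IsProbabilityMeasure μ] {f : ℝ → ℂ}
    (hf : MemLp f 2 μ) {V m : ℝ} (hV : ∫ x, ‖f x - ∫ y, f y ∂μ‖ ^ 2 ∂μ ≤ V)
    (hm : ‖∫ y, f y ∂μ‖ ≤ m) : ∫ x, ‖f x‖ ^ 2 ∂μ ≤ 2 * V + 2 * m ^ 2 := by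
  set c := ∫ y, f y ∂μ
  have hi : Integrable (fun x => ‖f x - c‖ ^ 2) μ :=
    (hf.sub (memLp_const c)).integrable_norm_pow (by norm_num)
  have h1 : ∫ x, ‖f x‖ ^ 2 ∂μ ≤ ∫ x, (2 * ‖f x - c‖ ^ 2 + 2 * m ^ 2) ∂μ := by
    refine integral_mono (hf.integrable_norm_pow (by norm_num)) ?_ ?_
    · exact (hi.const_mul 2).add (integrable_const _)
    · intro x
      have h : ‖f x‖ ≤ ‖f x - c‖ + m := by
        calc ‖f x‖ = ‖(f x - c) + c‖ := by simp
          _ ≤ ‖f x - c‖ + ‖c‖ := norm_add_le _ _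
          _ ≤ _ := by linarith
      have := norm_nonneg (f x)
      have h2 : ‖f x‖ ^ 2 ≤ (‖f x - c‖ + m) ^ 2 := by gcongr
      simp only
      nlinarith [sq_nonneg (‖f x - c‖ - m)]
  rw [integral_add (hi.const_mul 2) (integrable_const _), integral_const_mul] at h1
  simp at h1
  linarith

/-- The Poincaré inequality for `x ^ (n + 1)` bounds its variance by a multiple of the moment of
order `2n`. That function is not known to be in `L²`, so the inequality is applied to powers of the
bounded, 1-Lipschitz truncation, and Fatou's lemma removes the truncation. -/
lemma integrable_even_pow_succ {μ : Measure ℝ} [IsProbabilityMeasure μ] (hP : SatisfiesPoincare μ)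
    {n : ℕ} (hn : 1 ≤ n) (h : Integrable (fun x : ℝ => x ^ (2 * n)) μ) :
    Integrable (fun x : ℝ => x ^ (2 * (n + 1))) μ := by
  obtain ⟨C, hC, hP⟩ := hP
  set I := ∫ x : ℝ, x ^ (2 * n) ∂μ with hI
  -- This controls the mean, which the variance does not see; it needs `n + 1 ≤ 2n`, hence `1 ≤ n`.
  have hpow : ∀ x : ℝ, |x| ^ (n + 1) ≤ 1 + x ^ (2 * n) := by
    intro x
    have e : x ^ (2 * n) = |x| ^ (2 * n) := by rw [pow_mul, pow_mul, sq_abs]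
    rw [e]
    rcases le_total |x| 1 with h1 | h1
    · have := pow_le_one₀ (n := n + 1) (abs_nonneg x) h1
      have : 0 ≤ |x| ^ (2 * n) := by positivity
      linarith
    · have := pow_le_pow_right₀ h1 (by omega : n + 1 ≤ 2 * n)
      linarith
  -- The bound is uniform in `ε`, which is what Fatou requires.
  have key : ∀ ε : ℝ, 0 < ε → ∫ x, (softTrunc ε x) ^ (2 * (n + 1)) ∂μ
      ≤ 2 * (C * ((n + 1) ^ 2 * I)) + 2 * (1 + I) ^ 2 := by
    intro ε hε
    set f : ℝ → ℂ := fun x => (((softTrunc ε x) ^ (n + 1) : ℝ) : ℂ) with hf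
    set f' : ℝ → ℂ := fun x => ((((n + 1 : ℕ) : ℝ) * (softTrunc ε x) ^ n *
      ((1 - ε * x ^ 2) / (1 + ε * x ^ 2) ^ 2) : ℝ) : ℂ) with hf'
    have hd : ∀ x, HasDerivAt f (f' x) x := by
      intro x
      have := ((softTrunc_hasDerivAt hε x).pow (n + 1)).ofReal_comp
      simpa [hf, hf'] using this
    have hcs : Continuous (softTrunc ε) :=
      continuous_iff_continuousAt.2 fun x => (softTrunc_hasDerivAt hε x).continuousAt
    have hcf : Continuous f := by fun_prop
    have hcf' : Continuous f' := by
      refine Complex.continuous_ofReal.comp (Continuous.mul (by fun_prop) ?_)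
      exact Continuous.div (by fun_prop) (by fun_prop) (fun x => by positivity)
    have hdf : deriv f = f' := funext fun x => (hd x).deriv
    have hC1 : ContDiff ℝ 1 f := by
      rw [contDiff_one_iff_deriv, hdf]
      exact ⟨fun x => (hd x).differentiableAt, hcf'⟩
    have hb : ∀ x, ‖f x‖ ≤ (1 + 1 / ε) ^ (n + 1) := by
      intro x
      simp only [hf, Complex.norm_real, Real.norm_eq_abs, abs_pow]
      gcongr
      exact abs_softTrunc_le_const hε x
    have hb' : ∀ x, ‖f' x‖ ≤ (n + 1) * |softTrunc ε x| ^ n := by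
      intro x
      simp only [hf', Complex.norm_real, Real.norm_eq_abs, abs_mul, abs_pow]
      have := abs_deriv_softTrunc_le hε x
      have h2 : |((n + 1 : ℕ) : ℝ)| = n + 1 := by rw [abs_of_nonneg (by positivity)]; push_cast; ring
      rw [h2]
      exact mul_le_of_le_one_right (by positivity) this
    have hmf : MemLp f 2 μ := MemLp.of_bound hcf.aestronglyMeasurable _ (.of_forall hb)
    have hmf' : MemLp f' 2 μ := by
      refine MemLp.of_bound hcf'.aestronglyMeasurable ((n + 1) * (1 + 1 / ε) ^ n)
        (.of_forall fun x => (hb' x).trans ?_)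
      gcongr
      exact abs_softTrunc_le_const hε x
    have hvar := hP f hC1 hmf (hdf ▸ hmf')
    rw [hdf] at hvar
    have hder : ∫ x, ‖f' x‖ ^ 2 ∂μ ≤ (n + 1) ^ 2 * I := by
      rw [hI, ← integral_const_mul]
      refine integral_mono (hmf'.integrable_norm_pow (by norm_num)) (h.const_mul _) fun x => ?_
      calc ‖f' x‖ ^ 2 ≤ ((n + 1) * |x| ^ n) ^ 2 := by
            have := abs_softTrunc_le hε x
            have := hb' x
            gcongr
            exact this.trans (by gcongr)
        _ = (n + 1) ^ 2 * x ^ (2 * n) := by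
            rw [mul_pow, ← pow_mul, mul_comm n 2, pow_mul, sq_abs, ← pow_mul]
    have hmean : ‖∫ y, f y ∂μ‖ ≤ 1 + I := by
      refine (norm_integral_le_integral_norm _).trans ?_
      have : ∫ x, ‖f x‖ ∂μ ≤ ∫ x : ℝ, (1 + x ^ (2 * n)) ∂μ := by
        refine integral_mono (hmf.integrable (by norm_num)).norm ((integrable_const _).add h) ?_
        intro x
        refine le_trans ?_ (hpow x)
        simp only [hf, Complex.norm_real, Real.norm_eq_abs, abs_pow]
        exact pow_le_pow_left₀ (abs_nonneg _) (abs_softTrunc_le hε x) _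
      rw [integral_add (integrable_const _) h] at this
      simpa using this
    have := integral_sq_le_of_variance_le hmf (V := C * ((n + 1) ^ 2 * I))
      (hvar.trans (by gcongr)) hmean
    refine le_trans (le_of_eq ?_) this
    congr 1; ext x
    simp only [hf, Complex.norm_real, Real.norm_eq_abs, abs_pow]
    rw [pow_mul, ← sq_abs, ← pow_mul, ← pow_mul, mul_comm]
  set K := 2 * (C * ((n + 1) ^ 2 * I)) + 2 * (1 + I) ^ 2
  have hcs : ∀ ε : ℝ, 0 < ε → Continuous (softTrunc ε) := fun ε hε =>
    continuous_iff_continuousAt.2 fun x => (softTrunc_hasDerivAt hε x).continuousAt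
  refine integrable_of_tendsto
    (G := fun (m : ℕ) x => (softTrunc (1 / ((m : ℝ) + 1)) x) ^ (2 * (n + 1)))
    (.of_forall fun x => ?_) ?_ ?_
  · refine Filter.Tendsto.pow ?_ _
    have h0 : Filter.Tendsto (fun m : ℕ => 1 / ((m : ℝ) + 1)) Filter.atTop (nhds 0) :=
      tendsto_one_div_add_atTop_nhds_zero_nat
    have : Filter.Tendsto (fun m : ℕ => x / (1 + 1 / ((m : ℝ) + 1) * x ^ 2)) Filter.atTop
        (nhds (x / (1 + 0 * x ^ 2))) :=
      tendsto_const_nhds.div (tendsto_const_nhds.add (h0.mul_const _)) (by simp)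
    simpa [softTrunc] using this
  · intro m
    exact ((hcs _ (by positivity)).pow _).aestronglyMeasurable
  · have hle : ∀ m : ℕ, ∫⁻ x, ‖(softTrunc (1 / ((m : ℝ) + 1)) x) ^ (2 * (n + 1))‖ₑ ∂μ
        ≤ ENNReal.ofReal K := by
      intro m
      have hpos : (0 : ℝ) < 1 / ((m : ℝ) + 1) := by positivity
      have hi : Integrable (fun x => (softTrunc (1 / ((m : ℝ) + 1)) x) ^ (2 * (n + 1))) μ := by
        refine Integrable.of_bound ((hcs _ hpos).pow _).aestronglyMeasurable
          ((1 + 1 / (1 / ((m : ℝ) + 1))) ^ (2 * (n + 1))) (.of_forall fun x => ?_)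
        simp only [Real.norm_eq_abs, abs_pow]
        gcongr
        exact abs_softTrunc_le_const hpos x
      have hnn : ∀ x, 0 ≤ (softTrunc (1 / ((m : ℝ) + 1)) x) ^ (2 * (n + 1)) := fun x => by
        rw [pow_mul]; positivity
      have := ofReal_integral_eq_lintegral_ofReal hi (.of_forall hnn)
      simp_rw [Real.enorm_of_nonneg (hnn _)]
      rw [← this]
      exact ENNReal.ofReal_le_ofReal (key _ hpos)
    refine ne_of_lt (lt_of_le_of_lt (Filter.liminf_le_of_le (f := Filter.atTop)
      (a := ENNReal.ofReal K) (by isBoundedDefault) ?_)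
      ENNReal.ofReal_lt_top)
    intro b hb
    obtain ⟨m, hm⟩ := hb.exists
    exact hm.trans (hle m)

lemma integrable_pow_of_poincare {μ : Measure ℝ} [IsProbabilityMeasure μ]
    (hP : SatisfiesPoincare μ) (h2 : MemLp id 2 μ) (n : ℕ) :
    Integrable (fun x : ℝ => x ^ n) μ := by
  have heven : ∀ m : ℕ, Integrable (fun x : ℝ => x ^ (2 * (m + 1))) μ := by
    intro m
    induction m with
    | zero => simpa using h2.integrable_sq
    | succ m ih => exact integrable_even_pow_succ hP (by omega) ih
  refine ((integrable_const (1 : ℝ)).add (heven n)).mono' (by fun_prop) (.of_forall fun x => ?_)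
  simp only [Real.norm_eq_abs, abs_pow, Pi.add_apply]
  have e : x ^ (2 * (n + 1)) = |x| ^ (2 * (n + 1)) := by rw [pow_mul, pow_mul, sq_abs]
  rw [e]
  rcases le_total |x| 1 with h1 | h1
  · have := pow_le_one₀ (n := n) (abs_nonneg x) h1
    have : 0 ≤ |x| ^ (2 * (n + 1)) := by positivity
    linarith
  · have := pow_le_pow_right₀ h1 (by omega : n ≤ 2 * (n + 1))
    linarith

lemma integral_odd_pow_eq_zero {μ : Measure ℝ} (hs : μ.map (fun x => -x) = μ) {n : ℕ} (hn : Odd n) :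
    ∫ x : ℝ, x ^ n ∂μ = 0 := by
  have h : ∫ x : ℝ, x ^ n ∂μ = ∫ x : ℝ, (-x) ^ n ∂μ := by
    conv_lhs => rw [← hs]
    rw [integral_map (by fun_prop) (by fun_prop)]
  simp_rw [hn.neg_pow] at h
  rw [integral_neg] at h
  linarith

lemma integral_sq_eq_variance {μ : Measure ℝ} [IsProbabilityMeasure μ]
    (hs : μ.map (fun x => -x) = μ) :
    ∫ x : ℝ, x ^ 2 ∂μ = variance id μ := by
  have h1 := integral_odd_pow_eq_zero hs (n := 1) (by decide)
  rw [variance_of_integral_eq_zero aemeasurable_id (by simpa using h1)]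
  simp

lemma fourthCumulant_eq {μ : Measure ℝ} [IsProbabilityMeasure μ]
    (hs : μ.map (fun x => -x) = μ) :
    fourthCumulant μ = ∫ x : ℝ, x ^ 4 ∂μ - 3 * (∫ x : ℝ, x ^ 2 ∂μ) ^ 2 := by
  have h1 := integral_odd_pow_eq_zero hs (n := 1) (by decide)
  simp only [pow_one] at h1
  simp [fourthCumulant, centralMoment, h1]

end DeformedWigner

namespace DeformedWigner

open MeasureTheory ProbabilityTheory

/-! ### Product measures: Efron–Stein and tensorization of the Poincaré inequality. -/

section ProductMeasure

set_option linter.unusedSectionVars false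

variable {ι : Type*} [Fintype ι] [DecidableEq ι] {μ : Measure ℝ} [IsProbabilityMeasure μ]

lemma measurable_update_prod (p : ι) :
    Measurable (fun q : (ι → ℝ) × ℝ => Function.update q.1 p q.2) := by
  refine measurable_pi_lambda _ fun i => ?_
  by_cases h : i = p
  · subst h; simpa using measurable_snd
  · simp only [Function.update_of_ne h]
    exact (measurable_pi_apply i).comp measurable_fst

/-- Replacing one coordinate by an independent copy preserves the product measure. -/
lemma measurePreserving_update (μ : Measure ℝ) [IsProbabilityMeasure μ] (p : ι) :
    MeasurePreserving (fun q : (ι → ℝ) × ℝ => Function.update q.1 p q.2)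
      ((Measure.pi fun _ : ι => μ).prod μ) (Measure.pi fun _ : ι => μ) := by
  refine ⟨measurable_update_prod p, ?_⟩
  symm
  refine Measure.pi_eq fun s hs => ?_
  rw [Measure.map_apply (measurable_update_prod p) (MeasurableSet.univ_pi hs)]
  have : (fun q : (ι → ℝ) × ℝ => Function.update q.1 p q.2) ⁻¹' (Set.univ.pi s) =
      (Set.univ.pi (Function.update s p Set.univ)) ×ˢ s p := by
    ext ⟨x, t⟩
    simp only [Set.mem_preimage, Set.mem_univ_pi, Set.mem_prod]
    constructor
    · intro h
      refine ⟨fun i => ?_, by simpa using h p⟩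
      by_cases hi : i = p
      · subst hi; simp
      · simpa [Function.update_of_ne hi] using h i
    · rintro ⟨h1, h2⟩ i
      by_cases hi : i = p
      · subst hi; simpa using h2
      · simpa [Function.update_of_ne hi] using h1 i
  rw [this, Measure.prod_prod, Measure.pi_pi, ← Finset.mul_prod_erase Finset.univ _ (Finset.mem_univ p),
    ← Finset.mul_prod_erase Finset.univ (fun i => μ (s i)) (Finset.mem_univ p)]
  have : ∏ i ∈ Finset.univ.erase p, μ (Function.update s p Set.univ i)
      = ∏ i ∈ Finset.univ.erase p, μ (s i) :=
    Finset.prod_congr rfl fun i hi => by rw [Function.update_of_ne (Finset.ne_of_mem_erase hi)]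
  rw [this]
  simp [mul_comm]

lemma integrable_update {E : Type*} [NormedAddCommGroup E] {F : (ι → ℝ) → E}
    (hF : Integrable F (Measure.pi fun _ : ι => μ)) (p : ι) :
    Integrable (fun q : (ι → ℝ) × ℝ => F (Function.update q.1 p q.2))
      ((Measure.pi fun _ : ι => μ).prod μ) :=
  (measurePreserving_update μ p).integrable_comp_of_integrable hF

lemma integral_update {E : Type*} [NormedAddCommGroup E] [NormedSpace ℝ E] {F : (ι → ℝ) → E}
    (hF : Integrable F (Measure.pi fun _ : ι => μ)) (p : ι) :
    ∫ x, ∫ t, F (Function.update x p t) ∂μ ∂(Measure.pi fun _ : ι => μ)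
      = ∫ x, F x ∂(Measure.pi fun _ : ι => μ) := by
  rw [integral_integral (integrable_update hF p)]
  have h := integral_map (measurable_update_prod p).aemeasurable
    (μ := (Measure.pi fun _ : ι => μ).prod μ) (f := F)
    (by rw [(measurePreserving_update μ p).map_eq]; exact hF.aestronglyMeasurable)
  rw [(measurePreserving_update μ p).map_eq] at h
  exact h.symm

/-- Fubini in one coordinate. The cumulant expansions use it to reduce an identity on the product
space to a polynomial integral in the single variable `t`, the other coordinates being frozen. -/
lemma integral_eq_zero_of_fiber {E : Type*} [NormedAddCommGroup E] [NormedSpace ℝ E]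
    {F : (ι → ℝ) → E} (hF : Integrable F (Measure.pi fun _ : ι => μ)) (p : ι)
    (h : ∀ x, ∫ t, F (Function.update x p t) ∂μ = 0) :
    ∫ x, F x ∂(Measure.pi fun _ : ι => μ) = 0 := by
  rw [← integral_update hF p]
  simp [h]

/-- Averaging over the coordinate `p`. -/
noncomputable def coordAverage (μ : Measure ℝ) (p : ι) (F : (ι → ℝ) → ℂ) (x : ι → ℝ) : ℂ :=
  ∫ t, F (Function.update x p t) ∂μ

/-- Bounded measurable functions. -/
def BoundedMeasurable (F : (ι → ℝ) → ℂ) : Prop :=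
  Measurable F ∧ ∃ B : ℝ, ∀ x, ‖F x‖ ≤ B

lemma BoundedMeasurable.coordAverage {F : (ι → ℝ) → ℂ} (hF : BoundedMeasurable F) (p : ι) :
    BoundedMeasurable (coordAverage μ p F) := by
  obtain ⟨hm, B, hB⟩ := hF
  refine ⟨?_, B, fun x => ?_⟩
  · have : StronglyMeasurable (fun q : (ι → ℝ) × ℝ => F (Function.update q.1 p q.2)) :=
      (hm.comp (measurable_update_prod p)).stronglyMeasurable
    exact this.integral_prod_right.measurable
  · refine (norm_integral_le_of_norm_le_const (C := B) (.of_forall fun t => hB _)).trans ?_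
    simp

lemma BoundedMeasurable.sub {F K : (ι → ℝ) → ℂ} (hF : BoundedMeasurable F)
    (hK : BoundedMeasurable K) : BoundedMeasurable (fun x => F x - K x) := by
  obtain ⟨hm, B, hB⟩ := hF
  obtain ⟨hm', B', hB'⟩ := hK
  exact ⟨hm.sub hm', B + B', fun x => (norm_sub_le _ _).trans (add_le_add (hB x) (hB' x))⟩

lemma BoundedMeasurable.integrable {F : (ι → ℝ) → ℂ} (hF : BoundedMeasurable F)
    (ν : Measure (ι → ℝ)) [IsFiniteMeasure ν] : Integrable F ν := by
  obtain ⟨hm, B, hB⟩ := hF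
  exact Integrable.of_bound hm.aestronglyMeasurable B (.of_forall hB)

lemma BoundedMeasurable.integrable_norm_sq {F : (ι → ℝ) → ℂ} (hF : BoundedMeasurable F)
    (ν : Measure (ι → ℝ)) [IsFiniteMeasure ν] : Integrable (fun x => ‖F x‖ ^ 2) ν := by
  obtain ⟨hm, B, hB⟩ := hF
  refine Integrable.of_bound (by fun_prop) (B ^ 2) (.of_forall fun x => ?_)
  rw [Real.norm_of_nonneg (by positivity)]
  have := hB x
  gcongr

lemma BoundedMeasurable.memLp_fiber {F : (ι → ℝ) → ℂ} (hF : BoundedMeasurable F)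
    (p : ι) (x : ι → ℝ) : MemLp (fun t => F (Function.update x p t)) 2 μ := by
  obtain ⟨hm, B, hB⟩ := hF
  refine MemLp.of_bound (Measurable.aestronglyMeasurable ?_) B (.of_forall fun t => hB _)
  exact hm.comp (measurable_update_prod p |>.comp measurable_prodMk_left)

/-- Bias-variance decomposition. -/
lemma integral_norm_sub_const_sq {α : Type*} [MeasurableSpace α] {ν : Measure α}
    [IsProbabilityMeasure ν] {f : α → ℂ} (hf : MemLp f 2 ν) (c : ℂ) :
    ∫ t, ‖f t - c‖ ^ 2 ∂ν = ∫ t, ‖f t - ∫ s, f s ∂ν‖ ^ 2 ∂ν + ‖(∫ s, f s ∂ν) - c‖ ^ 2 := by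
  set m := ∫ s, f s ∂ν with hm
  have hi : Integrable f ν := hf.integrable (by norm_num)
  have h1 : ∀ t, ‖f t - c‖ ^ 2 = ‖f t - m‖ ^ 2 + ‖m - c‖ ^ 2
      + 2 * ((f t - m) * (starRingEnd ℂ) (m - c)).re := by
    intro t
    simp only [← Complex.normSq_eq_norm_sq, Complex.normSq_apply, Complex.mul_re, Complex.sub_re,
      Complex.sub_im, map_sub, Complex.conj_re, Complex.conj_im]
    ring
  have hi1 : Integrable (fun t => ‖f t - m‖ ^ 2) ν :=
    (hf.sub (memLp_const m)).integrable_norm_pow (by norm_num)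
  have hi2 : Integrable (fun t => (f t - m) * (starRingEnd ℂ) (m - c)) ν :=
    (hi.sub (integrable_const m)).mul_const _
  have hz : ∫ t, ((f t - m) * (starRingEnd ℂ) (m - c)).re ∂ν = 0 := by
    have := integral_re hi2
    simp only [RCLike.re_to_complex] at this
    rw [this, integral_mul_const, integral_sub hi (integrable_const m)]
    simp [hm]
  simp_rw [h1]
  have hi3 : Integrable (fun t => 2 * ((f t - m) * (starRingEnd ℂ) (m - c)).re) ν :=
    hi2.re.const_mul 2
  have hi4 : Integrable (fun t => ‖f t - m‖ ^ 2 + ‖m - c‖ ^ 2) ν := hi1.add (integrable_const _)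
  rw [integral_add hi4 hi3, integral_add hi1 (integrable_const _), integral_const_mul, hz]
  simp

lemma norm_integral_sq_le {α : Type*} [MeasurableSpace α] {ν : Measure α}
    [IsProbabilityMeasure ν] {f : α → ℂ} (hf : MemLp f 2 ν) :
    ‖∫ t, f t ∂ν‖ ^ 2 ≤ ∫ t, ‖f t‖ ^ 2 ∂ν := by
  have := integral_norm_sub_const_sq hf 0
  simp only [sub_zero] at this
  rw [this]
  have : 0 ≤ ∫ t, ‖f t - ∫ s, f s ∂ν‖ ^ 2 ∂ν := integral_nonneg fun _ => by positivity
  linarith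

lemma coordAverage_update (p : ι) (F : (ι → ℝ) → ℂ) (x : ι → ℝ) (t : ℝ) :
    coordAverage μ p F (Function.update x p t) = coordAverage μ p F x := by
  simp [coordAverage]

lemma integral_coordAverage {F : (ι → ℝ) → ℂ} (hF : BoundedMeasurable F) (p : ι) :
    ∫ x, coordAverage μ p F x ∂(Measure.pi fun _ : ι => μ)
      = ∫ x, F x ∂(Measure.pi fun _ : ι => μ) :=
  integral_update (hF.integrable _) p

/-- On each fibre over `p` the averages are constants, so the bias-variance identity splits the left
side into the variance of `F` and the squared distance of the two averages; Jensen bounds the latter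
by the mean of `‖F - K‖²`. Taking for `K` an average over further coordinates, the estimate
telescopes to Efron–Stein. -/
lemma efronStein_step {F K : (ι → ℝ) → ℂ} (hF : BoundedMeasurable F) (hK : BoundedMeasurable K)
    (p : ι) :
    ∫ x, ‖F x - coordAverage μ p K x‖ ^ 2 ∂(Measure.pi fun _ : ι => μ) ≤
      ∫ x, ‖F x - coordAverage μ p F x‖ ^ 2 ∂(Measure.pi fun _ : ι => μ)
      + ∫ x, ‖F x - K x‖ ^ 2 ∂(Measure.pi fun _ : ι => μ) := by
  set π := Measure.pi fun _ : ι => μ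
  have i1 := (hF.sub (hK.coordAverage (μ := μ) p)).integrable_norm_sq π
  have i2 := (hF.sub (hF.coordAverage (μ := μ) p)).integrable_norm_sq π
  have i3 := (hF.sub hK).integrable_norm_sq π
  rw [← integral_update i1 p, ← integral_update i2 p, ← integral_update i3 p,
    ← integral_add (integrable_update i2 p).integral_prod_left
      (integrable_update i3 p).integral_prod_left]
  refine integral_mono (integrable_update i1 p).integral_prod_left
    ((integrable_update i2 p).integral_prod_left.add (integrable_update i3 p).integral_prod_left) ?_
  intro x
  simp only [coordAverage_update]
  have hf : MemLp (fun t => F (Function.update x p t)) 2 μ := hF.memLp_fiber p x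
  have hk : MemLp (fun t => K (Function.update x p t)) 2 μ := hK.memLp_fiber p x
  rw [integral_norm_sub_const_sq hf]
  have h2 := norm_integral_sq_le (hf.sub hk)
  simp only [Pi.sub_apply] at h2
  rw [integral_sub (hf.integrable (by norm_num)) (hk.integrable (by norm_num))] at h2
  exact add_le_add le_rfl h2

/-- Averaging successively over the coordinates in a list. -/
noncomputable def listAverage (μ : Measure ℝ) (F : (ι → ℝ) → ℂ) : List ι → (ι → ℝ) → ℂ
  | [] => F
  | p :: l => coordAverage μ p (listAverage μ F l)

lemma boundedMeasurable_listAverage {F : (ι → ℝ) → ℂ} (hF : BoundedMeasurable F) (l : List ι) :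
    BoundedMeasurable (listAverage μ F l) := by
  induction l with
  | nil => exact hF
  | cons p l ih => exact ih.coordAverage p

/-- A coordinate that has been averaged out stays out, since updates at distinct coordinates
commute. After averaging over all coordinates the function is therefore constant, equal to its mean.
-/
lemma listAverage_update (F : (ι → ℝ) → ℂ) {l : List ι} {q : ι} (hq : q ∈ l) (x : ι → ℝ) (s : ℝ) :
    listAverage μ F l (Function.update x q s) = listAverage μ F l x := by
  induction l generalizing x with
  | nil => simp at hq
  | cons p l ih =>
    by_cases h : q = p
    · subst h; exact coordAverage_update _ _ _ _
    · have hql : q ∈ l := by simpa [h] using hq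
      simp only [listAverage, coordAverage]
      congr 1; ext t
      rw [Function.update_comm h, ih hql]

lemma integral_listAverage {F : (ι → ℝ) → ℂ} (hF : BoundedMeasurable F) (l : List ι) :
    ∫ x, listAverage μ F l x ∂(Measure.pi fun _ : ι => μ)
      = ∫ x, F x ∂(Measure.pi fun _ : ι => μ) := by
  induction l with
  | nil => rfl
  | cons p l ih =>
    rw [← ih]
    exact integral_coordAverage (boundedMeasurable_listAverage hF l) p

lemma eq_of_forall_update {F : (ι → ℝ) → ℂ}
    (h : ∀ q x s, F (Function.update x q s) = F x) (x y : ι → ℝ) : F x = F y := by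
  have key : ∀ S : Finset ι, F (S.piecewise x y) = F y := by
    intro S
    induction S using Finset.induction with
    | empty => simp
    | insert a S ha ih => rw [Finset.piecewise_insert, h, ih]
  simpa using key Finset.univ

lemma listAverage_eq_integral {F : (ι → ℝ) → ℂ} (hF : BoundedMeasurable F) {l : List ι}
    (hl : ∀ q, q ∈ l) (x : ι → ℝ) :
    listAverage μ F l x = ∫ x, F x ∂(Measure.pi fun _ : ι => μ) := by
  rw [← integral_listAverage hF l]
  have : ∀ y, listAverage μ F l y = listAverage μ F l x := fun y =>
    eq_of_forall_update (fun q x s => listAverage_update F (hl q) x s) y x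
  simp [this]

/-- The Efron–Stein inequality. -/
lemma efronStein {F : (ι → ℝ) → ℂ} (hF : BoundedMeasurable F) :
    ∫ x, ‖F x - ∫ y, F y ∂(Measure.pi fun _ : ι => μ)‖ ^ 2 ∂(Measure.pi fun _ : ι => μ) ≤
      ∑ p, ∫ x, ‖F x - coordAverage μ p F x‖ ^ 2 ∂(Measure.pi fun _ : ι => μ) := by
  have key : ∀ l : List ι,
      ∫ x, ‖F x - listAverage μ F l x‖ ^ 2 ∂(Measure.pi fun _ : ι => μ) ≤
        (l.map fun p => ∫ x, ‖F x - coordAverage μ p F x‖ ^ 2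
          ∂(Measure.pi fun _ : ι => μ)).sum := by
    intro l
    induction l with
    | nil => simp [listAverage]
    | cons p l ih =>
      refine (efronStein_step hF (boundedMeasurable_listAverage hF l) p).trans ?_
      simpa using ih
  have h := key Finset.univ.toList
  simp_rw [listAverage_eq_integral hF (fun q => Finset.mem_toList.2 (Finset.mem_univ q))] at h
  refine h.trans (le_of_eq ?_)
  rw [Finset.sum_map_toList]

/-- The Poincaré inequality tensorizes. -/
lemma poincare_pi {C : ℝ}
    (hP : ∀ f : ℝ → ℂ, ContDiff ℝ 1 f → MemLp f 2 μ → MemLp (deriv f) 2 μ →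
      ∫ x, ‖f x - ∫ y, f y ∂μ‖ ^ 2 ∂μ ≤ C * ∫ x, ‖deriv f x‖ ^ 2 ∂μ)
    {F : (ι → ℝ) → ℂ} {D : ι → (ι → ℝ) → ℂ} (hF : BoundedMeasurable F)
    (hDc : ∀ p, Continuous (D p)) (hDb : ∀ p, BoundedMeasurable (D p))
    (hD : ∀ p x t, HasDerivAt (fun t => F (Function.update x p t)) (D p (Function.update x p t)) t) :
    ∫ x, ‖F x - ∫ y, F y ∂(Measure.pi fun _ : ι => μ)‖ ^ 2 ∂(Measure.pi fun _ : ι => μ) ≤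
      C * ∑ p, ∫ x, ‖D p x‖ ^ 2 ∂(Measure.pi fun _ : ι => μ) := by
  refine (efronStein hF).trans ?_
  rw [Finset.mul_sum]
  refine Finset.sum_le_sum fun p _ => ?_
  have i2 := (hF.sub (hF.coordAverage (μ := μ) p)).integrable_norm_sq (Measure.pi fun _ : ι => μ)
  have i3 := (hDb p).integrable_norm_sq (Measure.pi fun _ : ι => μ)
  rw [← integral_update i2 p, ← integral_update i3 p, ← integral_const_mul]
  refine integral_mono (integrable_update i2 p).integral_prod_left
    ((integrable_update i3 p).integral_prod_left.const_mul C) fun x => ?_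
  simp only [coordAverage_update]
  have hdf : deriv (fun t => F (Function.update x p t)) = fun t => D p (Function.update x p t) :=
    funext fun t => (hD p x t).deriv
  have := hP (fun t => F (Function.update x p t)) ?_ (hF.memLp_fiber p x) ?_
  · rw [hdf] at this
    exact this
  · rw [contDiff_one_iff_deriv, hdf]
    refine ⟨fun t => (hD p x t).differentiableAt, (hDc p).comp ?_⟩
    exact continuous_const.update p continuous_id
  · rw [hdf]
    exact (hDb p).memLp_fiber p x

end ProductMeasure

end DeformedWigner

namespace DeformedWigner

open MeasureTheory ProbabilityTheory
open scoped Matrix.Norms.L2Operator Matrix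

/-! ### Hilbert–Schmidt and operator norms. -/

section Matrices

variable {n : Type*} [Fintype n]

/-- The squared Hilbert–Schmidt norm. -/
noncomputable def hs (B : Matrix n n ℂ) : ℝ := ∑ i, ∑ j, ‖B i j‖ ^ 2

lemma hs_nonneg (B : Matrix n n ℂ) : 0 ≤ hs B :=
  Finset.sum_nonneg fun _ _ => Finset.sum_nonneg fun _ _ => by positivity

lemma hs_conjTranspose (B : Matrix n n ℂ) : hs Bᴴ = hs B := by
  unfold hs
  rw [Finset.sum_comm]
  simp [Matrix.conjTranspose_apply]

lemma trace_conjTranspose_mul_self_eq_hs (B : Matrix n n ℂ) : (Bᴴ * B).trace = (hs B : ℂ) := by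
  unfold hs
  rw [Finset.sum_comm]
  simp [Matrix.trace, Matrix.mul_apply, Matrix.conjTranspose_apply, Complex.conj_mul']

lemma trace_mul_conjTranspose_self_eq_hs (B : Matrix n n ℂ) : (B * Bᴴ).trace = (hs B : ℂ) := by
  rw [Matrix.trace_mul_comm, trace_conjTranspose_mul_self_eq_hs]

lemma norm_trace_mul_le (A B : Matrix n n ℂ) : ‖(A * B).trace‖ ≤ (hs A + hs B) / 2 := by
  have h1 : (hs A + hs B) / 2 = ∑ i, ∑ j, (‖A i j‖ ^ 2 + ‖B j i‖ ^ 2) / 2 := by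
    have : hs B = ∑ i, ∑ j, ‖B j i‖ ^ 2 := by unfold hs; rw [Finset.sum_comm]
    rw [this]
    unfold hs
    simp_rw [← Finset.sum_div, Finset.sum_add_distrib]
  rw [h1, Matrix.trace]
  refine (norm_sum_le _ _).trans (Finset.sum_le_sum fun i _ => ?_)
  rw [Matrix.diag_apply, Matrix.mul_apply]
  refine (norm_sum_le _ _).trans (Finset.sum_le_sum fun j _ => ?_)
  rw [norm_mul]
  nlinarith [sq_nonneg (‖A i j‖ - ‖B j i‖)]

variable [DecidableEq n]

lemma sum_norm_mul_col_sq_le (A B : Matrix n n ℂ) (j : n) :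
    ∑ i, ‖(A * B) i j‖ ^ 2 ≤ ‖A‖ ^ 2 * ∑ i, ‖B i j‖ ^ 2 := by
  have h := Matrix.l2_opNorm_mulVec A (WithLp.toLp 2 fun i => B i j)
  have h2 := pow_le_pow_left₀ (norm_nonneg _) h 2
  rw [mul_pow, EuclideanSpace.norm_sq_eq, EuclideanSpace.norm_sq_eq] at h2
  simpa [Matrix.mulVec, dotProduct, Matrix.mul_apply] using h2

lemma hs_mul_le_left (A B : Matrix n n ℂ) : hs (A * B) ≤ ‖A‖ ^ 2 * hs B := by
  unfold hs
  rw [Finset.sum_comm, Finset.sum_comm (f := fun i j => ‖B i j‖ ^ 2), Finset.mul_sum]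
  exact Finset.sum_le_sum fun j _ => sum_norm_mul_col_sq_le A B j

lemma hs_mul_le_right (A B : Matrix n n ℂ) : hs (A * B) ≤ hs A * ‖B‖ ^ 2 := by
  rw [← hs_conjTranspose, Matrix.conjTranspose_mul, ← hs_conjTranspose A, mul_comm,
    ← Matrix.l2_opNorm_conjTranspose B]
  exact hs_mul_le_left _ _

lemma norm_entry_le (B : Matrix n n ℂ) (i j : n) : ‖B i j‖ ≤ ‖B‖ := by
  have h := sum_norm_mul_col_sq_le B 1 j
  rw [mul_one] at h
  have h1 : ∑ i, ‖(1 : Matrix n n ℂ) i j‖ ^ 2 = 1 := by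
    rw [Finset.sum_eq_single j] <;> simp +contextual [Matrix.one_apply_ne]
  rw [h1, mul_one] at h
  have h2 : ‖B i j‖ ^ 2 ≤ ∑ i, ‖B i j‖ ^ 2 :=
    Finset.single_le_sum (f := fun i => ‖B i j‖ ^ 2) (fun _ _ => by positivity) (Finset.mem_univ i)
  exact (pow_le_pow_iff_left₀ (norm_nonneg _) (norm_nonneg _) two_ne_zero).1 (h2.trans h)

lemma hs_one : hs (1 : Matrix n n ℂ) = Fintype.card n := by
  have h : ∀ i j : n, ‖(1 : Matrix n n ℂ) i j‖ ^ 2 = if i = j then 1 else 0 := by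
    intro i j
    by_cases h : i = j <;> simp [Matrix.one_apply, h]
  simp [hs, h]

lemma norm_sq_le_hs (B : Matrix n n ℂ) : ‖B‖ ^ 2 ≤ hs B := by
  have h : ‖B‖ ≤ Real.sqrt (hs B) := by
    rw [Matrix.l2_opNorm_def]
    refine ContinuousLinearMap.opNorm_le_bound _ (Real.sqrt_nonneg _) fun x => ?_
    refine (pow_le_pow_iff_left₀ (norm_nonneg _) (by positivity) two_ne_zero).1 ?_
    rw [mul_pow, Real.sq_sqrt (hs_nonneg B), EuclideanSpace.norm_sq_eq, EuclideanSpace.norm_sq_eq,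
      hs, Finset.sum_mul]
    refine Finset.sum_le_sum fun i _ => ?_
    have h1 : ‖∑ j, B i j * x j‖ ≤ ∑ j, ‖B i j‖ * ‖x j‖ :=
      (norm_sum_le _ _).trans (Finset.sum_le_sum fun j _ => (norm_mul _ _).le)
    have h2 := Finset.sum_mul_sq_le_sq_mul_sq Finset.univ (fun j => ‖B i j‖) (fun j => ‖x j‖)
    refine le_trans ?_ h2
    refine pow_le_pow_left₀ (norm_nonneg _) ?_ 2
    simpa [Matrix.mulVec, dotProduct] using h1
  calc ‖B‖ ^ 2 ≤ Real.sqrt (hs B) ^ 2 := by gcongr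
    _ = hs B := Real.sq_sqrt (hs_nonneg B)

end Matrices

/-! ### Bounds for the resolvent of a Hermitian matrix. -/

section Resolvent

variable {N : ℕ} {M : Matrix (Fin N) (Fin N) ℂ} {z : ℂ}

/-- Since `⟨v, Mv⟩` is real, `⟨v, (z - M)v⟩` has imaginary part `Im z ‖v‖²`; conclude by
Cauchy–Schwarz. Both the invertibility of `z - M` and the bound `1 / Im z` on its inverse follow. -/
lemma im_mul_norm_le (hM : M.IsHermitian) (v : EuclideanSpace ℂ (Fin N)) :
    z.im * ‖v‖ ≤ ‖(EuclideanSpace.equiv (Fin N) ℂ).symm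
      ((z • (1 : Matrix (Fin N) (Fin N) ℂ) - M) *ᵥ v)‖ := by
  rcases eq_or_ne v 0 with rfl | hv
  · simp
  set w := (EuclideanSpace.equiv (Fin N) ℂ).symm
      ((z • (1 : Matrix (Fin N) (Fin N) ℂ) - M) *ᵥ v) with hw
  have h1 : inner ℂ v w = z * (‖v‖ ^ 2 : ℝ) - star (v : Fin N → ℂ) ⬝ᵥ (M *ᵥ v) := by
    have e1 : inner ℂ v w = star (v : Fin N → ℂ) ⬝ᵥ
        ((z • (1 : Matrix (Fin N) (Fin N) ℂ) - M) *ᵥ v) := by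
      rw [EuclideanSpace.inner_eq_star_dotProduct, dotProduct_comm]
      rfl
    have e2 : star (v : Fin N → ℂ) ⬝ᵥ (v : Fin N → ℂ) = ((‖v‖ ^ 2 : ℝ) : ℂ) := by
      rw [EuclideanSpace.norm_sq_eq]
      simp [dotProduct, Complex.conj_mul']
    rw [e1, Matrix.sub_mulVec, dotProduct_sub, Matrix.smul_mulVec, Matrix.one_mulVec,
      dotProduct_smul, e2, smul_eq_mul]
  have h2 : (inner ℂ v w).im = z.im * ‖v‖ ^ 2 := by
    rw [h1, Complex.sub_im, Complex.mul_im, Complex.ofReal_im, Complex.ofReal_re]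
    have := hM.im_star_dotProduct_mulVec_self (v : Fin N → ℂ)
    simp only [RCLike.im_to_complex] at this
    rw [this]; ring
  have h3 : z.im * ‖v‖ ^ 2 ≤ ‖v‖ * ‖w‖ := by
    rw [← h2]
    exact (Complex.im_le_norm _).trans (norm_inner_le_norm v w)
  have hv' : 0 < ‖v‖ := norm_pos_iff.2 hv
  have : ‖v‖ * (z.im * ‖v‖) ≤ ‖v‖ * ‖w‖ := by nlinarith
  exact le_of_mul_le_mul_left this hv'

lemma isUnit_det_resolvent (hM : M.IsHermitian) (hz : 0 < z.im) :
    IsUnit (z • (1 : Matrix (Fin N) (Fin N) ℂ) - M).det := by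
  rw [← Matrix.isUnit_iff_isUnit_det, ← Matrix.mulVec_injective_iff_isUnit]
  intro a b hab
  have h := im_mul_norm_le (z := z) hM (WithLp.toLp 2 (a - b))
  have e : (z • (1 : Matrix (Fin N) (Fin N) ℂ) - M) *ᵥ (a - b) = 0 := by
    rw [Matrix.mulVec_sub, sub_eq_zero]; exact hab
  change _ ≤ ‖(EuclideanSpace.equiv (Fin N) ℂ).symm
    ((z • (1 : Matrix (Fin N) (Fin N) ℂ) - M) *ᵥ (a - b))‖ at h
  rw [e, map_zero, norm_zero] at h
  have h0 : ‖WithLp.toLp 2 (a - b)‖ = 0 :=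
    le_antisymm (by nlinarith [norm_nonneg (WithLp.toLp 2 (a - b))]) (norm_nonneg _)
  have h1 := norm_eq_zero.1 h0
  have h2 : a - b = 0 := congrArg WithLp.ofLp h1
  exact sub_eq_zero.1 h2

lemma mul_resolvent (hM : M.IsHermitian) (hz : 0 < z.im) :
    (z • (1 : Matrix (Fin N) (Fin N) ℂ) - M) * resolvent M z = 1 :=
  Matrix.mul_nonsing_inv _ (isUnit_det_resolvent hM hz)

lemma resolvent_mul (hM : M.IsHermitian) (hz : 0 < z.im) :
    resolvent M z * (z • (1 : Matrix (Fin N) (Fin N) ℂ) - M) = 1 :=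
  Matrix.nonsing_inv_mul _ (isUnit_det_resolvent hM hz)

lemma norm_resolvent_le (hM : M.IsHermitian) (hz : 0 < z.im) : ‖resolvent M z‖ ≤ z.im⁻¹ := by
  rw [Matrix.l2_opNorm_def]
  refine ContinuousLinearMap.opNorm_le_bound _ (by positivity) fun v => ?_
  set u : EuclideanSpace ℂ (Fin N) := (EuclideanSpace.equiv (Fin N) ℂ).symm (resolvent M z *ᵥ v)
  have h := im_mul_norm_le (z := z) hM u
  have e : ((z • (1 : Matrix (Fin N) (Fin N) ℂ) - M) *ᵥ u) = v := by
    change (z • (1 : Matrix (Fin N) (Fin N) ℂ) - M) *ᵥ (resolvent M z *ᵥ v) = v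
    rw [Matrix.mulVec_mulVec, mul_resolvent hM hz, Matrix.one_mulVec]
  rw [e] at h
  have h' : z.im * ‖u‖ ≤ ‖v‖ := h
  change ‖u‖ ≤ _
  rw [inv_mul_eq_div, le_div_iff₀ hz]
  linarith

/-- Trace of `R - Rᴴ = Rᴴ (Tᴴ - T) R`, where `Tᴴ - T` is the scalar `-2i Im z`. It places the
Stieltjes transform in the closed lower half plane. -/
lemma im_trace_resolvent (hM : M.IsHermitian) (hz : 0 < z.im) :
    (resolvent M z).trace.im = - z.im * hs (resolvent M z) := by
  set R := resolvent M z
  set T := z • (1 : Matrix (Fin N) (Fin N) ℂ) - M with hT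
  have h1 : T * R = 1 := mul_resolvent hM hz
  have h2 : Rᴴ * Tᴴ = 1 := by rw [← Matrix.conjTranspose_mul, h1, Matrix.conjTranspose_one]
  have h3 : R - Rᴴ = Rᴴ * (Tᴴ - T) * R := by
    rw [mul_sub, sub_mul, h2, one_mul, mul_assoc, h1, mul_one]
  have h4 : Tᴴ - T = (-(2 * z.im * Complex.I)) • (1 : Matrix (Fin N) (Fin N) ℂ) := by
    rw [hT, Matrix.conjTranspose_sub, Matrix.conjTranspose_smul, Matrix.conjTranspose_one, hM.eq,
      sub_sub_sub_cancel_right, ← sub_smul]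
    congr 1
    apply Complex.ext <;> simp
    ring
  have h5 := congrArg Matrix.trace h3
  rw [h4, Matrix.mul_smul, mul_one, Matrix.smul_mul, Matrix.trace_smul, Matrix.trace_sub,
    Matrix.trace_conjTranspose, trace_conjTranspose_mul_self_eq_hs] at h5
  have h6 := congrArg Complex.im h5
  simp at h6
  linarith

end Resolvent

end DeformedWigner

namespace DeformedWigner

open MeasureTheory ProbabilityTheory
open scoped Matrix.Norms.L2Operator Matrix

/-! ### An orthonormal basis of the Hermitian matrices. -/

section Basis

variable {N : ℕ}

/-- The orthonormal basis of the real space of Hermitian matrices dual to `hermitianCoord`. -/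
noncomputable def hermBasis (p : Fin N × Fin N) : Matrix (Fin N) (Fin N) ℂ :=
  if p.1 = p.2 then Matrix.single p.1 p.1 1
  else if p.1 < p.2 then ((Real.sqrt 2 : ℂ)⁻¹) • (Matrix.single p.1 p.2 1 + Matrix.single p.2 p.1 1)
  else ((Real.sqrt 2 : ℂ)⁻¹ * Complex.I) • (Matrix.single p.2 p.1 1 - Matrix.single p.1 p.2 1)

lemma sqrt_two_inv_mul_self : (Real.sqrt 2 : ℂ)⁻¹ * (Real.sqrt 2 : ℂ)⁻¹ = 1 / 2 := by
  rw [← mul_inv, ← Complex.ofReal_mul, Real.mul_self_sqrt (by norm_num)]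
  norm_num

lemma hermBasis_diag (i : Fin N) : hermBasis (i, i) = Matrix.single i i 1 := by simp [hermBasis]

lemma hermBasis_lt {i j : Fin N} (h : i < j) :
    hermBasis (i, j) = ((Real.sqrt 2 : ℂ)⁻¹) • (Matrix.single i j 1 + Matrix.single j i 1) := by
  simp [hermBasis, h, h.ne]

lemma hermBasis_gt {i j : Fin N} (h : i < j) :
    hermBasis (j, i) = ((Real.sqrt 2 : ℂ)⁻¹ * Complex.I) •
      (Matrix.single i j 1 - Matrix.single j i 1) := by
  simp [hermBasis, h.not_gt, h.ne']

lemma hermBasis_isHermitian (p : Fin N × Fin N) : (hermBasis p).IsHermitian := by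
  obtain ⟨i, j⟩ := p
  unfold Matrix.IsHermitian
  rcases lt_trichotomy i j with h | rfl | h
  · rw [hermBasis_lt h]
    simp [Matrix.conjTranspose_single, add_comm, Complex.conj_ofReal]
  · rw [hermBasis_diag]
    simp [Matrix.conjTranspose_single]
  · rw [hermBasis_gt h]
    simp only [Matrix.conjTranspose_smul, Matrix.conjTranspose_sub, Matrix.conjTranspose_single,
      star_one, star_mul', star_inv₀, Complex.star_def, Complex.conj_ofReal, Complex.conj_I]
    rw [← neg_sub, smul_neg, ← neg_smul]
    congr 1
    ring

lemma hermBasis_apply_eq_zero {p : Fin N × Fin N} {a b : Fin N} (h1 : p ≠ (a, b))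
    (h2 : p ≠ (b, a)) : hermBasis p a b = 0 := by
  obtain ⟨i, j⟩ := p
  have h1' : ¬ (i = a ∧ j = b) := fun h => h1 (by rw [h.1, h.2])
  have h2' : ¬ (j = a ∧ i = b) := fun h => h2 (by rw [h.1, h.2])
  rcases lt_trichotomy i j with h | rfl | h
  · simp [hermBasis_lt h, h1', h2']
  · simp [hermBasis_diag, h1']
  · simp [hermBasis_gt h, h1', h2']

lemma sum_mul_hermBasis_of_ne {a b : Fin N} (hab : a ≠ b) (f : Fin N × Fin N → ℂ) :
    ∑ p, f p * hermBasis p a b = f (a, b) * hermBasis (a, b) a b + f (b, a) * hermBasis (b, a) a b := by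
  have hne : ((a, b) : Fin N × Fin N) ≠ (b, a) := fun h => hab (congrArg Prod.fst h)
  rw [← Finset.sum_pair hne (f := fun p => f p * hermBasis p a b)]
  symm
  refine Finset.sum_subset (Finset.subset_univ _) fun p _ hp => ?_
  simp only [Finset.mem_insert, Finset.mem_singleton, not_or] at hp
  rw [hermBasis_apply_eq_zero hp.1 hp.2, mul_zero]

lemma sum_mul_hermBasis_diag (a : Fin N) (f : Fin N × Fin N → ℂ) :
    ∑ p, f p * hermBasis p a a = f (a, a) := by
  rw [Finset.sum_eq_single (a, a)]
  · simp [hermBasis_diag]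
  · intro p _ hp
    rw [hermBasis_apply_eq_zero hp hp, mul_zero]
  · simp

lemma sum_mul_hermBasis_lt {a b : Fin N} (hab : a < b) (f : Fin N × Fin N → ℂ) :
    ∑ p, f p * hermBasis p a b = (Real.sqrt 2 : ℂ)⁻¹ * (f (a, b) + Complex.I * f (b, a)) := by
  rw [sum_mul_hermBasis_of_ne hab.ne, hermBasis_lt hab, hermBasis_gt hab]
  simp [hab.ne, hab.ne']
  ring

lemma sum_mul_hermBasis_gt {a b : Fin N} (hab : a < b) (f : Fin N × Fin N → ℂ) :
    ∑ p, f p * hermBasis p b a = (Real.sqrt 2 : ℂ)⁻¹ * (f (a, b) - Complex.I * f (b, a)) := by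
  rw [sum_mul_hermBasis_of_ne hab.ne', hermBasis_lt hab, hermBasis_gt hab]
  simp [hab.ne, hab.ne']
  ring

lemma trace_single_mul_eq (i j : Fin N) (B : Matrix (Fin N) (Fin N) ℂ) :
    (Matrix.single i j (1 : ℂ) * B).trace = B j i := by
  simp [Matrix.trace_single_mul]

/-- Fourier expansion in the Hermitian basis. -/
lemma sum_trace_hermBasis_smul (B : Matrix (Fin N) (Fin N) ℂ) :
    ∑ p, (hermBasis p * B).trace • hermBasis p = B := by
  have h2 := sqrt_two_inv_mul_self
  have hI := Complex.I_mul_I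
  ext a b
  rw [Matrix.sum_apply]
  simp only [Matrix.smul_apply, smul_eq_mul]
  rcases lt_trichotomy a b with h | rfl | h
  · rw [sum_mul_hermBasis_lt h, hermBasis_lt h, hermBasis_gt h]
    simp only [Matrix.smul_mul, Matrix.add_mul, Matrix.sub_mul, Matrix.trace_smul, Matrix.trace_add,
      Matrix.trace_sub, trace_single_mul_eq, smul_eq_mul]
    linear_combination (B b a + B a b + Complex.I ^ 2 * (B b a - B a b)) * h2
      + (1 / 2) * (B b a - B a b) * hI
  · rw [sum_mul_hermBasis_diag, hermBasis_diag, trace_single_mul_eq]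
  · rw [sum_mul_hermBasis_gt h, hermBasis_lt h, hermBasis_gt h]
    simp only [Matrix.smul_mul, Matrix.add_mul, Matrix.sub_mul, Matrix.trace_smul, Matrix.trace_add,
      Matrix.trace_sub, trace_single_mul_eq, smul_eq_mul]
    linear_combination (B a b + B b a - Complex.I ^ 2 * (B a b - B b a)) * h2
      - (1 / 2) * (B a b - B b a) * hI

/-- Completeness of the basis, read off from the Fourier expansion of a matrix unit. -/
lemma sum_hermBasis_mul_apply (a b c d : Fin N) :
    ∑ p, hermBasis p a b * hermBasis p c d = if a = d ∧ b = c then 1 else 0 := by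
  have h := congrFun (congrFun (sum_trace_hermBasis_smul (Matrix.single b a (1 : ℂ))) c) d
  rw [Matrix.sum_apply] at h
  simp only [Matrix.smul_apply, smul_eq_mul, Matrix.trace_mul_comm _ (Matrix.single b a (1 : ℂ)),
    trace_single_mul_eq] at h
  rw [h, Matrix.single_apply]
  simp only [and_comm]

/-- Contraction with the completeness relation. This identity turns the variance term of the
expansion into the product of traces behind the quadratic equation for `g_σ`. -/
lemma sum_hermBasis_mul_mul (B : Matrix (Fin N) (Fin N) ℂ) :
    ∑ p, hermBasis p * B * hermBasis p = B.trace • (1 : Matrix (Fin N) (Fin N) ℂ) := by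
  ext a d
  rw [Matrix.sum_apply]
  simp only [Matrix.mul_apply, Finset.sum_mul]
  rw [Finset.sum_comm]
  have : ∀ c b, ∑ p, hermBasis p a b * B b c * hermBasis p c d
      = B b c * if a = d ∧ b = c then 1 else 0 := by
    intro c b
    rw [← sum_hermBasis_mul_apply, Finset.mul_sum]
    exact Finset.sum_congr rfl fun p _ => by ring
  simp_rw [Finset.sum_comm (s := Finset.univ (α := Fin N × Fin N)), this]
  by_cases had : a = d
  · subst had
    simp [Matrix.trace]
  · simp [had]

lemma sum_hermBasis_mul_self :
    ∑ p, hermBasis p * hermBasis p = (N : ℂ) • (1 : Matrix (Fin N) (Fin N) ℂ) := by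
  have := sum_hermBasis_mul_mul (1 : Matrix (Fin N) (Fin N) ℂ)
  simpa using this

/-- Parseval's identity. -/
lemma sum_norm_trace_hermBasis_sq (B : Matrix (Fin N) (Fin N) ℂ) :
    ∑ p, ‖(hermBasis p * B).trace‖ ^ 2 = hs B := by
  have h : ((∑ p, ‖(hermBasis p * B).trace‖ ^ 2 : ℝ) : ℂ) = (hs B : ℂ) := by
    have h1 : ∀ p, ((‖(hermBasis p * B).trace‖ ^ 2 : ℝ) : ℂ)
        = ((hermBasis p * B).trace • hermBasis p * Bᴴ).trace := by
      intro p
      have : star ((hermBasis p * B).trace) = (hermBasis p * Bᴴ).trace := by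
        rw [← Matrix.trace_conjTranspose, Matrix.conjTranspose_mul, (hermBasis_isHermitian p).eq,
          Matrix.trace_mul_comm]
      rw [Matrix.smul_mul, Matrix.trace_smul, ← this, smul_eq_mul, Complex.star_def,
        Complex.mul_conj']
      norm_cast
    rw [← trace_mul_conjTranspose_self_eq_hs, Complex.ofReal_sum]
    simp_rw [h1]
    rw [← Matrix.trace_sum, ← Finset.sum_mul, sum_trace_hermBasis_smul]
  exact_mod_cast h

lemma hs_hermBasis (p : Fin N × Fin N) : hs (hermBasis p) = 1 := by
  have h : (hs (hermBasis p) : ℂ) = 1 := by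
    rw [← trace_conjTranspose_mul_self_eq_hs, (hermBasis_isHermitian p).eq]
    obtain ⟨i, j⟩ := p
    have h2 := sqrt_two_inv_mul_self
    rcases lt_trichotomy i j with h | rfl | h
    · rw [hermBasis_lt h]
      rw [Matrix.smul_mul, Matrix.trace_smul, Matrix.add_mul, Matrix.trace_add,
        trace_single_mul_eq, trace_single_mul_eq]
      simp only [Matrix.smul_apply, Matrix.add_apply, Matrix.single_apply, h.ne, h.ne', smul_eq_mul,
        and_self, if_true, if_false]
      linear_combination 2 * h2
    · rw [hermBasis_diag]
      simp
    · rw [hermBasis_gt h]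
      rw [Matrix.smul_mul, Matrix.trace_smul, Matrix.sub_mul, Matrix.trace_sub,
        trace_single_mul_eq, trace_single_mul_eq]
      simp only [Matrix.smul_apply, Matrix.sub_apply, Matrix.single_apply, h.ne, h.ne', smul_eq_mul,
        and_self, if_true, if_false]
      linear_combination (-2 * Complex.I ^ 2) * h2 - Complex.I_mul_I
  exact_mod_cast h

lemma norm_hermBasis_le (p : Fin N × Fin N) : ‖hermBasis p‖ ≤ 1 := by
  have := norm_sq_le_hs (hermBasis p)
  rw [hs_hermBasis] at this
  nlinarith [norm_nonneg (hermBasis p)]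

/-- A basis element has at most two non-zero entries, so only two entries of `B` occur and no
dimensional factor appears. -/
lemma norm_trace_hermBasis_mul_le (p : Fin N × Fin N) (B : Matrix (Fin N) (Fin N) ℂ) :
    ‖(hermBasis p * B).trace‖ ≤ 2 * ‖B‖ := by
  have hs2 : ‖(Real.sqrt 2 : ℂ)⁻¹‖ ≤ 1 := by
    rw [norm_inv, Complex.norm_real, Real.norm_of_nonneg (Real.sqrt_nonneg _)]
    exact inv_le_one_of_one_le₀ (Real.one_le_sqrt.2 (by norm_num))
  obtain ⟨i, j⟩ := p
  have hij := norm_entry_le B i j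
  have hji := norm_entry_le B j i
  have hB := norm_nonneg B
  rcases lt_trichotomy i j with h | rfl | h
  · rw [hermBasis_lt h]
    simp only [Matrix.smul_mul, Matrix.add_mul, Matrix.trace_smul, Matrix.trace_add,
      trace_single_mul_eq, smul_eq_mul, norm_mul]
    have := norm_add_le (B j i) (B i j)
    nlinarith [norm_nonneg (B j i + B i j)]
  · rw [hermBasis_diag, trace_single_mul_eq]
    linarith
  · rw [hermBasis_gt h]
    simp only [Matrix.smul_mul, Matrix.sub_mul, Matrix.trace_smul, Matrix.trace_sub,
      trace_single_mul_eq, smul_eq_mul, norm_mul, Complex.norm_I, mul_one]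
    have := norm_sub_le (B i j) (B j i)
    nlinarith [norm_nonneg (B i j - B j i)]

lemma sum_hs_mul_hermBasis (B : Matrix (Fin N) (Fin N) ℂ) :
    ∑ p, hs (B * hermBasis p) = N * hs B := by
  have h : ((∑ p, hs (B * hermBasis p) : ℝ) : ℂ) = ((N * hs B : ℝ) : ℂ) := by
    push_cast
    simp_rw [← trace_mul_conjTranspose_self_eq_hs, Matrix.conjTranspose_mul,
      (hermBasis_isHermitian _).eq]
    have : ∀ p, B * hermBasis p * (hermBasis p * Bᴴ) = B * (hermBasis p * hermBasis p) * Bᴴ :=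
      fun p => by simp only [mul_assoc]
    simp_rw [this]
    rw [← Matrix.trace_sum, ← Finset.sum_mul, ← Finset.mul_sum, sum_hermBasis_mul_self]
    simp [Matrix.trace_smul]
  exact_mod_cast h

lemma sum_hs_hermBasis_mul (B : Matrix (Fin N) (Fin N) ℂ) :
    ∑ p, hs (hermBasis p * B) = N * hs B := by
  rw [← hs_conjTranspose B, ← sum_hs_mul_hermBasis]
  refine Finset.sum_congr rfl fun p _ => ?_
  rw [← hs_conjTranspose, Matrix.conjTranspose_mul, (hermBasis_isHermitian p).eq]

/-- The Hermitian matrix with given coordinates. -/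
noncomputable def hermOfCoord (x : Fin N × Fin N → ℝ) : Matrix (Fin N) (Fin N) ℂ :=
  ∑ p, (x p : ℂ) • hermBasis p

lemma hermOfCoord_isHermitian (x : Fin N × Fin N → ℝ) : (hermOfCoord x).IsHermitian := by
  unfold Matrix.IsHermitian hermOfCoord
  rw [Matrix.conjTranspose_sum]
  refine Finset.sum_congr rfl fun p _ => ?_
  rw [Matrix.conjTranspose_smul, (hermBasis_isHermitian p).eq]
  simp [Complex.conj_ofReal]

lemma hermOfCoord_hermitianCoord {W : Matrix (Fin N) (Fin N) ℂ} (hW : W.IsHermitian) :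
    hermOfCoord (hermitianCoord W) = W := by
  have h2 := sqrt_two_inv_mul_self
  have hs0 : (Real.sqrt 2 : ℂ) ≠ 0 := by
    simp
  ext a b
  unfold hermOfCoord
  rw [Matrix.sum_apply]
  simp only [Matrix.smul_apply, smul_eq_mul]
  rcases lt_trichotomy a b with h | rfl | h
  · rw [sum_mul_hermBasis_lt h]
    simp only [hermitianCoord, h.ne, h.ne', h, h.not_gt, if_true, if_false]
    push_cast
    field_simp
    rw [mul_comm]
    exact Complex.re_add_im _
  · rw [sum_mul_hermBasis_diag]
    simp only [hermitianCoord, if_true]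
    have := hW.apply a a
    exact Complex.conj_eq_iff_re.1 this
  · rw [sum_mul_hermBasis_gt h]
    simp only [hermitianCoord, h.ne, h.ne', h, h.not_gt, if_true, if_false]
    have := hW.apply a b
    rw [← this]
    push_cast
    field_simp
    apply Complex.ext <;> simp

end Basis

end DeformedWigner

namespace DeformedWigner

open MeasureTheory ProbabilityTheory
open scoped Matrix.Norms.L2Operator Matrix

/-! ### The resolvent as a function of the coordinates; concentration of linear statistics. -/

section CoordResolvent

variable {N : ℕ} {A : Matrix (Fin N) (Fin N) ℂ} {z : ℂ}

/-- The resolvent of the deformed matrix as a function of the coordinates of the Wigner part. -/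
noncomputable def coordResolvent (A : Matrix (Fin N) (Fin N) ℂ) (z : ℂ) (x : Fin N × Fin N → ℝ) :
    Matrix (Fin N) (Fin N) ℂ :=
  resolvent (deformedMatrix (hermOfCoord x) A) z

lemma deformedMatrix_isHermitian {W : Matrix (Fin N) (Fin N) ℂ} (hW : W.IsHermitian)
    (hA : A.IsHermitian) : (deformedMatrix W A).IsHermitian := by
  unfold Matrix.IsHermitian deformedMatrix
  rw [Matrix.conjTranspose_add, Matrix.conjTranspose_smul, hW.eq, hA.eq, Complex.star_def,
    Complex.conj_ofReal]

lemma norm_coordResolvent_le (hA : A.IsHermitian) (hz : 0 < z.im) (x : Fin N × Fin N → ℝ) :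
    ‖coordResolvent A z x‖ ≤ z.im⁻¹ :=
  norm_resolvent_le (deformedMatrix_isHermitian (hermOfCoord_isHermitian x) hA) hz

/-- Cramer's rule: adjugate over a determinant that never vanishes. -/
lemma continuous_coordResolvent (hA : A.IsHermitian) (hz : 0 < z.im) :
    Continuous (coordResolvent A z) := by
  have hW : Continuous (fun x : Fin N × Fin N → ℝ =>
      z • (1 : Matrix (Fin N) (Fin N) ℂ) - deformedMatrix (hermOfCoord x) A) := by
    unfold deformedMatrix hermOfCoord
    fun_prop
  have h : coordResolvent A z = fun x =>
      ((z • (1 : Matrix (Fin N) (Fin N) ℂ) - deformedMatrix (hermOfCoord x) A).det)⁻¹ •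
        (z • (1 : Matrix (Fin N) (Fin N) ℂ) - deformedMatrix (hermOfCoord x) A).adjugate := by
    funext x
    rw [coordResolvent, resolvent, Matrix.inv_def, Ring.inverse_eq_inv']
  rw [h]
  refine Continuous.smul (hW.matrix_det.inv₀ fun x => ?_) hW.matrix_adjugate
  exact (isUnit_det_resolvent
    (deformedMatrix_isHermitian (hermOfCoord_isHermitian x) hA) hz).ne_zero

lemma hermOfCoord_update (x : Fin N × Fin N → ℝ) (p : Fin N × Fin N) (t t' : ℝ) :
    hermOfCoord (Function.update x p t) - hermOfCoord (Function.update x p t')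
      = ((t - t' : ℝ) : ℂ) • hermBasis p := by
  unfold hermOfCoord
  rw [← Finset.sum_sub_distrib, Finset.sum_eq_single p]
  · rw [← sub_smul]; simp
  · intro q _ hq
    simp [Function.update_of_ne hq]
  · simp

/-- The first resolvent identity along a coordinate line. -/
lemma coordResolvent_update_sub (hA : A.IsHermitian) (hz : 0 < z.im) (x : Fin N × Fin N → ℝ)
    (p : Fin N × Fin N) (t t' : ℝ) :
    coordResolvent A z (Function.update x p t) - coordResolvent A z (Function.update x p t')
      = ((1 / Real.sqrt N * (t - t') : ℝ) : ℂ) •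
        (coordResolvent A z (Function.update x p t) * hermBasis p *
          coordResolvent A z (Function.update x p t')) := by
  set R := coordResolvent A z (Function.update x p t) with hR
  set R' := coordResolvent A z (Function.update x p t') with hR'
  have h1 := resolvent_mul (deformedMatrix_isHermitian
    (hermOfCoord_isHermitian (Function.update x p t)) hA) hz
  have h2 := mul_resolvent (deformedMatrix_isHermitian
    (hermOfCoord_isHermitian (Function.update x p t')) hA) hz
  rw [← coordResolvent] at h1 h2
  rw [← hR] at h1
  rw [← hR'] at h2
  set T := z • (1 : Matrix (Fin N) (Fin N) ℂ) - deformedMatrix (hermOfCoord (Function.update x p t)) A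
    with hT
  set T' := z • (1 : Matrix (Fin N) (Fin N) ℂ) -
    deformedMatrix (hermOfCoord (Function.update x p t')) A with hT'
  have h3 : T' - T = ((1 / Real.sqrt N * (t - t') : ℝ) : ℂ) • hermBasis p := by
    rw [hT, hT', sub_sub_sub_cancel_left, deformedMatrix, deformedMatrix, add_sub_add_right_eq_sub,
      ← smul_sub, hermOfCoord_update, smul_smul]
    push_cast
    rfl
  calc R - R' = R * (T' - T) * R' := by
        rw [mul_sub, sub_mul, h1, one_mul, mul_assoc, h2, mul_one]
    _ = _ := by rw [h3, Matrix.mul_smul, Matrix.smul_mul]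

lemma continuous_trace_mul_coordResolvent (hA : A.IsHermitian) (hz : 0 < z.im)
    (B : Matrix (Fin N) (Fin N) ℂ) :
    Continuous (fun x => (B * coordResolvent A z x).trace) := by
  have := continuous_coordResolvent hA hz
  exact (continuous_const.mul this).matrix_trace

lemma hs_le_of_norm_le {B : Matrix (Fin N) (Fin N) ℂ} {c : ℝ} (h : ‖B‖ ≤ c) :
    hs B ≤ c ^ 2 * N := by
  have h1 := hs_mul_le_left B 1
  rw [mul_one, hs_one, Fintype.card_fin] at h1
  refine h1.trans ?_
  have := norm_nonneg B
  gcongr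

lemma norm_trace_mul_le_of_norm_le (B : Matrix (Fin N) (Fin N) ℂ) {C : Matrix (Fin N) (Fin N) ℂ}
    {c : ℝ} (h : ‖C‖ ≤ c) : ‖(B * C).trace‖ ≤ (hs B + c ^ 2 * N) / 2 :=
  (norm_trace_mul_le B C).trans (by have := hs_le_of_norm_le h; linarith)

lemma boundedMeasurable_trace_mul_coordResolvent (hA : A.IsHermitian) (hz : 0 < z.im)
    (B : Matrix (Fin N) (Fin N) ℂ) :
    BoundedMeasurable (fun x => (B * coordResolvent A z x).trace) :=
  ⟨(continuous_trace_mul_coordResolvent hA hz B).measurable, _, fun x =>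
    norm_trace_mul_le_of_norm_le B (norm_coordResolvent_le hA hz x)⟩

/-- The resolvent identity gives the difference quotients in closed form, so continuity of the
resolvent alone yields the derivative. -/
lemma hasDerivAt_trace_mul_coordResolvent (hA : A.IsHermitian) (hz : 0 < z.im)
    (B : Matrix (Fin N) (Fin N) ℂ) (p : Fin N × Fin N) (x : Fin N × Fin N → ℝ) (t : ℝ) :
    HasDerivAt (fun t => (B * coordResolvent A z (Function.update x p t)).trace)
      (((1 / Real.sqrt N : ℝ) : ℂ) * (hermBasis p * (coordResolvent A z (Function.update x p t) * B *
        coordResolvent A z (Function.update x p t))).trace) t := by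
  set G := fun t => coordResolvent A z (Function.update x p t) with hG
  have hGc : Continuous G :=
    (continuous_coordResolvent hA hz).comp (continuous_const.update p continuous_id)
  rw [hasDerivAt_iff_tendsto_slope]
  have hs : ∀ u, u ≠ t → slope (fun t => (B * G t).trace) t u
      = ((1 / Real.sqrt N : ℝ) : ℂ) * (hermBasis p * (G t * B * G u)).trace := by
    intro u hu
    have hut : ((u - t : ℝ) : ℂ) ≠ 0 := by exact_mod_cast sub_ne_zero.2 hu
    rw [slope_def_module, ← Matrix.trace_sub, ← mul_sub, coordResolvent_update_sub hA hz x p u t,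
      Matrix.mul_smul, Matrix.trace_smul, Complex.real_smul, smul_eq_mul]
    have e : (B * (G u * hermBasis p * G t)).trace = (hermBasis p * (G t * B * G u)).trace := by
      rw [← mul_assoc, ← mul_assoc, Matrix.trace_mul_comm (B * G u * hermBasis p), ← mul_assoc,
        ← mul_assoc, Matrix.trace_mul_comm (G t * B * G u)]
    rw [e]
    push_cast at hut ⊢
    field_simp
  have hlim : Filter.Tendsto
      (fun u => ((1 / Real.sqrt N : ℝ) : ℂ) * (hermBasis p * (G t * B * G u)).trace)
      (nhdsWithin t {t}ᶜ)
      (nhds (((1 / Real.sqrt N : ℝ) : ℂ) * (hermBasis p * (G t * B * G t)).trace)) := by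
    have : Continuous (fun u => ((1 / Real.sqrt N : ℝ) : ℂ) *
        (hermBasis p * (G t * B * G u)).trace) :=
      continuous_const.mul (continuous_const.mul (continuous_const.mul hGc)).matrix_trace
    exact (this.tendsto t).mono_left nhdsWithin_le_nhds
  refine hlim.congr' ?_
  filter_upwards [self_mem_nhdsWithin] with u hu
  exact (hs u hu).symm

lemma one_div_sqrt_sq (N : ℕ) : (1 / Real.sqrt N) ^ 2 = 1 / N := by
  rw [div_pow, Real.sq_sqrt (Nat.cast_nonneg N), one_pow]

lemma hs_conj_coordResolvent_le (hA : A.IsHermitian) (hz : 0 < z.im)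
    (B : Matrix (Fin N) (Fin N) ℂ) (x : Fin N × Fin N → ℝ) :
    hs (coordResolvent A z x * B * coordResolvent A z x) ≤ z.im⁻¹ ^ 4 * hs B := by
  have h := norm_coordResolvent_le hA hz x
  have h0 := norm_nonneg (coordResolvent A z x)
  have hB := hs_nonneg B
  calc hs (coordResolvent A z x * B * coordResolvent A z x)
      ≤ hs (coordResolvent A z x * B) * ‖coordResolvent A z x‖ ^ 2 := hs_mul_le_right _ _
    _ ≤ (‖coordResolvent A z x‖ ^ 2 * hs B) * ‖coordResolvent A z x‖ ^ 2 := by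
        gcongr; exact hs_mul_le_left _ _
    _ ≤ (z.im⁻¹ ^ 2 * hs B) * z.im⁻¹ ^ 2 := by gcongr
    _ = _ := by ring

/-- The variance of a linear statistic of the resolvent. -/
lemma variance_trace_mul_coordResolvent_le {μ : Measure ℝ} [IsProbabilityMeasure μ] {C : ℝ}
    (hC : 0 ≤ C)
    (hP : ∀ f : ℝ → ℂ, ContDiff ℝ 1 f → MemLp f 2 μ → MemLp (deriv f) 2 μ →
      ∫ x, ‖f x - ∫ y, f y ∂μ‖ ^ 2 ∂μ ≤ C * ∫ x, ‖deriv f x‖ ^ 2 ∂μ)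
    (hA : A.IsHermitian) (hz : 0 < z.im) (B : Matrix (Fin N) (Fin N) ℂ) :
    ∫ x, ‖(B * coordResolvent A z x).trace -
        ∫ y, (B * coordResolvent A z y).trace ∂(Measure.pi fun _ => μ)‖ ^ 2 ∂(Measure.pi fun _ => μ)
      ≤ C * (z.im⁻¹ ^ 4 * hs B / N) := by
  have hGc := continuous_coordResolvent hA hz
  set D : Fin N × Fin N → (Fin N × Fin N → ℝ) → ℂ := fun p x =>
    ((1 / Real.sqrt N : ℝ) : ℂ) *
      (hermBasis p * (coordResolvent A z x * B * coordResolvent A z x)).trace with hD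
  have hDc : ∀ p, Continuous (D p) := fun p =>
    continuous_const.mul (continuous_const.mul ((hGc.mul continuous_const).mul hGc)).matrix_trace
  -- Parseval: the squared gradient is exactly a Hilbert–Schmidt norm, so the sum over the `N²`
  -- coordinates costs nothing.
  have hsq : ∀ x, ∑ p, ‖D p x‖ ^ 2 =
      1 / N * hs (coordResolvent A z x * B * coordResolvent A z x) := by
    intro x
    simp only [hD, norm_mul, mul_pow, Complex.norm_real, Real.norm_eq_abs, sq_abs]
    rw [← Finset.mul_sum, sum_norm_trace_hermBasis_sq, one_div_sqrt_sq]
  have hle : ∀ x, ∑ p, ‖D p x‖ ^ 2 ≤ z.im⁻¹ ^ 4 * hs B / N := by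
    intro x
    rw [hsq, one_div_mul_eq_div]
    have := hs_conj_coordResolvent_le hA hz B x
    gcongr
  have hDb : ∀ p, BoundedMeasurable (D p) := by
    intro p
    refine ⟨(hDc p).measurable, Real.sqrt (z.im⁻¹ ^ 4 * hs B / N), fun x => ?_⟩
    refine Real.le_sqrt_of_sq_le (le_trans ?_ (hle x))
    exact Finset.single_le_sum (f := fun p => ‖D p x‖ ^ 2) (fun _ _ => by positivity)
      (Finset.mem_univ p)
  refine (poincare_pi hP (boundedMeasurable_trace_mul_coordResolvent hA hz B) hDc hDb
    (fun p x t => hasDerivAt_trace_mul_coordResolvent hA hz B p x t)).trans ?_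
  gcongr
  rw [← integral_finsetSum _ fun p _ => (hDb p).integrable_norm_sq _]
  have : ∫ x, ∑ p, ‖D p x‖ ^ 2 ∂(Measure.pi fun _ => μ) ≤
      ∫ _, z.im⁻¹ ^ 4 * hs B / N ∂(Measure.pi fun _ : Fin N × Fin N => μ) :=
    integral_mono (integrable_finsetSum _ fun p _ => (hDb p).integrable_norm_sq _)
      (integrable_const _) hle
  simpa using this

lemma integrable_coord_pow {μ : Measure ℝ} [IsProbabilityMeasure μ]
    (hμ : ∀ k : ℕ, Integrable (fun x : ℝ => x ^ k) μ) (p : Fin N × Fin N) (k : ℕ) :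
    Integrable (fun x : Fin N × Fin N → ℝ => x p ^ k) (Measure.pi fun _ => μ) :=
  integrable_comp_eval (μ := fun _ : Fin N × Fin N => μ) (i := p) (hμ k)

lemma integrable_coord_pow_mul {μ : Measure ℝ} [IsProbabilityMeasure μ]
    (hμ : ∀ k : ℕ, Integrable (fun x : ℝ => x ^ k) μ) (p : Fin N × Fin N) (k : ℕ)
    {F : (Fin N × Fin N → ℝ) → ℂ} (hF : BoundedMeasurable F) :
    Integrable (fun x => (x p : ℂ) ^ k * F x) (Measure.pi fun _ => μ) := by
  obtain ⟨hm, B, hB⟩ := hF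
  have := (integrable_coord_pow hμ p k).ofReal (𝕜 := ℂ)
  refine Integrable.mul_bdd (c := B) ?_ hm.aestronglyMeasurable (.of_forall hB)
  simpa using this

end CoordResolvent

end DeformedWigner

namespace DeformedWigner

open MeasureTheory ProbabilityTheory
open scoped Matrix.Norms.L2Operator Matrix

/-! ### Algebra of the resolvent expansion, and one-variable moments. -/

section GeometricExpansion

variable {τ : ℕ → ℕ → ℂ} {u : ℂ}

/-- Here and below `τ i j` stands for `Tr(Q X^i Z^j)` with `Z = X + uXZ`, formally `Z = X / (1 -
uX)`. The two numbers in each name are the power of `Z` that is expanded and the power of `u`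
carried by the remainder. Terms with `j = 0` involve `X` only. -/
lemma geom_expand_one_three (h : ∀ i j, τ i (j + 1) = τ (i + 1) j + u * τ (i + 1) (j + 1)) :
    τ 0 1 = τ 1 0 + u * τ 2 0 + u ^ 2 * τ 3 0 + u ^ 3 * τ 3 1 := by
  linear_combination h 0 0 + u * h 1 0 + u ^ 2 * h 2 0

lemma geom_expand_one_five (h : ∀ i j, τ i (j + 1) = τ (i + 1) j + u * τ (i + 1) (j + 1)) :
    τ 0 1 = τ 1 0 + u * τ 2 0 + u ^ 2 * τ 3 0 + u ^ 3 * τ 4 0 + u ^ 4 * τ 5 0 + u ^ 5 * τ 5 1 := by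
  linear_combination h 0 0 + u * h 1 0 + u ^ 2 * h 2 0 + u ^ 3 * h 3 0 + u ^ 4 * h 4 0

lemma geom_expand_two_two (h : ∀ i j, τ i (j + 1) = τ (i + 1) j + u * τ (i + 1) (j + 1)) :
    τ 0 2 = τ 2 0 + 2 * u * τ 3 0 + u ^ 2 * (τ 2 2 + 2 * τ 3 1) := by
  linear_combination h 0 1 + h 1 0 + u * h 1 1 + 2 * u * h 2 0

lemma geom_expand_two_four (h : ∀ i j, τ i (j + 1) = τ (i + 1) j + u * τ (i + 1) (j + 1)) :
    τ 0 2 = τ 2 0 + 2 * u * τ 3 0 + 3 * u ^ 2 * τ 4 0 + 4 * u ^ 3 * τ 5 0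
      + u ^ 4 * (τ 4 2 + 4 * τ 5 1) := by
  linear_combination h 0 1 + h 1 0 + u * h 1 1 + 2 * u * h 2 0
    + u ^ 2 * (h 2 1 + h 3 0 + u * h 3 1 + 2 * u * h 4 0) + 2 * u ^ 2 * (h 3 0 + u * h 4 0)

lemma geom_expand_four_two (h : ∀ i j, τ i (j + 1) = τ (i + 1) j + u * τ (i + 1) (j + 1)) :
    τ 0 4 = τ 4 0 + 4 * u * τ 5 0
      + u ^ 2 * (τ 2 4 + 2 * τ 3 3 + 3 * τ 4 2 + 4 * τ 5 1) := by
  linear_combination h 0 3 + h 1 2 + h 2 1 + h 3 0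
    + u * (h 1 3 + 2 * h 2 2 + 3 * h 3 1 + 4 * h 4 0)

end GeometricExpansion

section Moments

variable {μ : Measure ℝ} [IsProbabilityMeasure μ]

/-- Odd moments vanish by symmetry; the main parts of both expansions have degree at most five in
the distinguished coordinate. -/
lemma integral_quintic (hs : μ.map (fun x => -x) = μ)
    (hμ : ∀ k : ℕ, Integrable (fun x : ℝ => x ^ k) μ) (c₀ c₁ c₂ c₃ c₄ c₅ : ℂ) :
    ∫ t : ℝ, (c₀ + c₁ * t + c₂ * t ^ 2 + c₃ * t ^ 3 + c₄ * t ^ 4 + c₅ * t ^ 5) ∂μ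
      = c₀ + c₂ * ((∫ t : ℝ, t ^ 2 ∂μ : ℝ) : ℂ) + c₄ * ((∫ t : ℝ, t ^ 4 ∂μ : ℝ) : ℂ) := by
  have hi : ∀ (c : ℂ) (k : ℕ), Integrable (fun t : ℝ => c * (t : ℂ) ^ k) μ := by
    intro c k
    have := ((hμ k).ofReal (𝕜 := ℂ)).const_mul c
    simpa using this
  have hi1 : Integrable (fun t : ℝ => c₁ * (t : ℂ)) μ := by simpa using hi c₁ 1
  have hm : ∀ k : ℕ, ∫ t : ℝ, (t : ℂ) ^ k ∂μ = ((∫ t : ℝ, t ^ k ∂μ : ℝ) : ℂ) := by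
    intro k
    rw [← integral_complex_ofReal]
    simp
  have h1 : ∫ t : ℝ, (t : ℂ) ∂μ = 0 := by
    have := hm 1
    rw [integral_odd_pow_eq_zero hs (by decide)] at this
    simpa using this
  have s1 := (integrable_const (μ := μ) c₀).add hi1
  have s2 := s1.add (hi c₂ 2)
  have s3 := s2.add (hi c₃ 3)
  have s4 := s3.add (hi c₄ 4)
  have e := integral_add s4 (hi c₅ 5)
  have e4 := integral_add s3 (hi c₄ 4)
  have e3 := integral_add s2 (hi c₃ 3)
  have e2 := integral_add s1 (hi c₂ 2)
  have e1 := integral_add (integrable_const (μ := μ) c₀) hi1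
  simp only [Pi.add_apply] at e e4 e3 e2 e1
  rw [e, e4, e3, e2, e1]
  simp only [integral_const_mul, hm, h1, integral_odd_pow_eq_zero hs (show Odd 3 by decide),
    integral_odd_pow_eq_zero hs (show Odd 5 by decide)]
  simp

end Moments

/-! ### Fourth-order cumulant expansion in one coordinate. -/

section CumulantExpansion

variable {N : ℕ} {A : Matrix (Fin N) (Fin N) ℂ} {z : ℂ}

/-- The mixed moments `Tr(Q (H G₀)^i (H G)^j)` of the resolvent and of the resolvent with the
coordinate `p` set to zero. -/
noncomputable def mixedTrace (A : Matrix (Fin N) (Fin N) ℂ) (z : ℂ) (p : Fin N × Fin N)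
    (Q : Matrix (Fin N) (Fin N) ℂ) (i j : ℕ) (x : Fin N × Fin N → ℝ) : ℂ :=
  (Q * ((hermBasis p * coordResolvent A z (Function.update x p 0)) ^ i *
    (hermBasis p * coordResolvent A z x) ^ j)).trace

/-- The resolvent identity between `x_p` and `0`, multiplied by `H`, reads `Z = X + uXZ` with `X =
HG₀`, `Z = HG`, `u = x_p / √N`: the recursion assumed by the geometric expansions. -/
lemma mixedTrace_succ (hA : A.IsHermitian) (hz : 0 < z.im) (p : Fin N × Fin N)
    (Q : Matrix (Fin N) (Fin N) ℂ) (x : Fin N × Fin N → ℝ) (i j : ℕ) :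
    mixedTrace A z p Q i (j + 1) x = mixedTrace A z p Q (i + 1) j x
      + ((1 / Real.sqrt N * x p : ℝ) : ℂ) * mixedTrace A z p Q (i + 1) (j + 1) x := by
  have h := coordResolvent_update_sub hA hz x p 0 (x p)
  rw [Function.update_eq_self] at h
  set X := hermBasis p * coordResolvent A z (Function.update x p 0) with hX
  set Z := hermBasis p * coordResolvent A z x with hZ
  have hZX : Z = X + ((1 / Real.sqrt N * x p : ℝ) : ℂ) • (X * Z) := by
    have h' := congrArg (fun B => hermBasis p * B) h
    simp only [mul_sub, Matrix.mul_smul, ← mul_assoc] at h'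
    rw [← hX, mul_assoc X, ← hZ, sub_eq_iff_eq_add] at h'
    have hc : ((1 / Real.sqrt N * 0 - 1 / Real.sqrt N * x p : ℝ) : ℂ)
        = -((1 / Real.sqrt N * x p : ℝ) : ℂ) := by push_cast; ring
    rw [hc, neg_smul, neg_add_eq_sub] at h'
    exact (sub_eq_iff_eq_add.1 h'.symm)
  have key : X ^ i * Z ^ (j + 1) = X ^ (i + 1) * Z ^ j
      + ((1 / Real.sqrt N * x p : ℝ) : ℂ) • (X ^ (i + 1) * Z ^ (j + 1)) := by
    calc X ^ i * Z ^ (j + 1) = X ^ i * (Z * Z ^ j) := by rw [pow_succ' Z]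
      _ = X ^ i * ((X + ((1 / Real.sqrt N * x p : ℝ) : ℂ) • (X * Z)) * Z ^ j) := by rw [← hZX]
      _ = _ := by
        rw [add_mul, mul_add, Matrix.smul_mul, Matrix.mul_smul, pow_succ X, pow_succ' Z]
        simp only [mul_assoc]
  simp only [mixedTrace, ← hX, ← hZ]
  rw [key, mul_add, Matrix.trace_add, Matrix.mul_smul, Matrix.trace_smul, smul_eq_mul]

lemma continuous_mixedTrace (hA : A.IsHermitian) (hz : 0 < z.im) (p : Fin N × Fin N)
    (Q : Matrix (Fin N) (Fin N) ℂ) (i j : ℕ) : Continuous (mixedTrace A z p Q i j) := by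
  have h1 := continuous_coordResolvent hA hz
  have h2 : Continuous fun x : Fin N × Fin N → ℝ =>
      coordResolvent A z (Function.update x p 0) :=
    h1.comp (continuous_id.update p continuous_const)
  exact (continuous_const.mul (((continuous_const.mul h2).pow i).mul
    ((continuous_const.mul h1).pow j))).matrix_trace

lemma norm_hermBasis_mul_coordResolvent_le (hA : A.IsHermitian) (hz : 0 < z.im)
    (p : Fin N × Fin N) (x : Fin N × Fin N → ℝ) :
    ‖hermBasis p * coordResolvent A z x‖ ≤ z.im⁻¹ := by
  refine (norm_mul_le _ _).trans ?_
  have h1 := norm_hermBasis_le p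
  have h2 := norm_coordResolvent_le hA hz x
  calc _ ≤ 1 * z.im⁻¹ := by gcongr
    _ = _ := one_mul _

lemma norm_pow_le_pow_of_le (hN : 1 ≤ N) {B : Matrix (Fin N) (Fin N) ℂ} {c : ℝ} (h : ‖B‖ ≤ c)
    (k : ℕ) : ‖B ^ k‖ ≤ c ^ k := by
  have : Nonempty (Fin N) := ⟨⟨0, hN⟩⟩
  exact (norm_pow_le B k).trans (pow_le_pow_left₀ (norm_nonneg _) h k)

lemma boundedMeasurable_mixedTrace (hN : 1 ≤ N) (hA : A.IsHermitian) (hz : 0 < z.im)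
    (p : Fin N × Fin N) (Q : Matrix (Fin N) (Fin N) ℂ) (i j : ℕ) :
    BoundedMeasurable (mixedTrace A z p Q i j) := by
  refine ⟨(continuous_mixedTrace hA hz p Q i j).measurable, _, fun x =>
    norm_trace_mul_le_of_norm_le Q (c := z.im⁻¹ ^ i * z.im⁻¹ ^ j) ?_⟩
  have h1 := norm_pow_le_pow_of_le hN (norm_hermBasis_mul_coordResolvent_le hA hz p
    (Function.update x p 0)) i
  have h2 := norm_pow_le_pow_of_le hN (norm_hermBasis_mul_coordResolvent_le hA hz p x) j
  refine (norm_mul_le _ _).trans ?_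
  gcongr

/-- With `Q = 1` and at least one factor `HG₀`, the trace starts with `H`, which selects at most two
entries; hence there is no factor `N`. -/
lemma norm_mixedTrace_one_le (hN : 1 ≤ N) (hA : A.IsHermitian) (hz : 0 < z.im)
    (p : Fin N × Fin N) (i j : ℕ) (x : Fin N × Fin N → ℝ) :
    ‖mixedTrace A z p 1 (i + 1) j x‖ ≤ 2 * z.im⁻¹ ^ (i + 1 + j) := by
  have h0 := norm_coordResolvent_le hA hz (Function.update x p 0)
  have h1 := norm_pow_le_pow_of_le hN (norm_hermBasis_mul_coordResolvent_le hA hz p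
    (Function.update x p 0)) i
  have h2 := norm_pow_le_pow_of_le hN (norm_hermBasis_mul_coordResolvent_le hA hz p x) j
  rw [mixedTrace, one_mul, pow_succ', mul_assoc, mul_assoc]
  refine (norm_trace_hermBasis_mul_le p _).trans ?_
  have : z.im⁻¹ ^ (i + 1 + j) = z.im⁻¹ * (z.im⁻¹ ^ i * z.im⁻¹ ^ j) := by ring
  rw [this]
  gcongr
  refine (norm_mul_le _ _).trans ?_
  gcongr
  refine (norm_mul_le _ _).trans ?_
  gcongr

/-- Traces built from `G₀` alone do not see the coordinate `p`, so they act as constants in the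
fibre integral. -/
lemma mixedTrace_update (p : Fin N × Fin N) (Q : Matrix (Fin N) (Fin N) ℂ) (i : ℕ)
    (x : Fin N × Fin N → ℝ) (t : ℝ) :
    mixedTrace A z p Q i 0 (Function.update x p t) = mixedTrace A z p Q i 0 x := by
  simp [mixedTrace]

variable {μ : Measure ℝ} [IsProbabilityMeasure μ]

/-- Cumulant expansion to fourth order in one coordinate. -/
lemma fourth_order_expansion (hs : μ.map (fun x => -x) = μ)
    (hμ : ∀ k : ℕ, Integrable (fun x : ℝ => x ^ k) μ) {m₂ m₄ m₆ κ : ℝ}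
    (h₂ : ∫ t : ℝ, t ^ 2 ∂μ = m₂) (h₄ : ∫ t : ℝ, t ^ 4 ∂μ = m₄) (h₆ : ∫ t : ℝ, t ^ 6 ∂μ = m₆)
    (hκ : κ = m₄ - 3 * m₂ ^ 2)
    (hN : 1 ≤ N) (hA : A.IsHermitian) (hz : 0 < z.im) (p : Fin N × Fin N) :
    ‖(∫ x, (x p : ℂ) * mixedTrace A z p 1 0 1 x ∂(Measure.pi fun _ => μ))
      - ((1 / Real.sqrt N : ℝ) : ℂ) * m₂ * (∫ x, mixedTrace A z p 1 0 2 x ∂(Measure.pi fun _ => μ))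
      - ((1 / Real.sqrt N : ℝ) : ℂ) ^ 3 * κ *
        (∫ x, mixedTrace A z p 1 0 4 x ∂(Measure.pi fun _ => μ))‖
      ≤ (1 / Real.sqrt N) ^ 5 * (2 * z.im⁻¹ ^ 6) * (m₆ + 5 * m₂ * m₄ + 10 * |κ| * m₂) := by
  set π := Measure.pi fun _ : Fin N × Fin N => μ
  set s : ℝ := 1 / Real.sqrt N with hsdef
  have hs0 : 0 ≤ s := by positivity
  set T := mixedTrace A z p 1 with hT
  have hm2 : 0 ≤ m₂ := by rw [← h₂]; exact integral_nonneg fun t => by positivity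
  have hbm : ∀ i j, BoundedMeasurable (T i j) := boundedMeasurable_mixedTrace hN hA hz p 1
  have iT : ∀ k i j, Integrable (fun x => (x p : ℂ) ^ k * T i j x) π := fun k i j =>
    integrable_coord_pow_mul hμ p k (hbm i j)
  have iT1 : ∀ i j, Integrable (fun x => (x p : ℂ) * T i j x) π := fun i j => by
    simpa using iT 1 i j
  have iT0 : ∀ i j, Integrable (fun x => T i j x) π := fun i j => by simpa using iT 0 i j
  set F : (Fin N × Fin N → ℝ) → ℂ := fun x =>
    (x p : ℂ) * T 0 1 x - (s : ℂ) * m₂ * T 0 2 x - (s : ℂ) ^ 3 * κ * T 0 4 x with hF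
  -- The exact remainder: every term of the three geometric expansions that still contains `G`. No
  -- factor `1/6` accompanies `κ`, because the third derivative of `Tr(HG)` produces the matching
  -- `3!`.
  set R : (Fin N × Fin N → ℝ) → ℂ := fun x =>
    (s : ℂ) ^ 5 * ((x p : ℂ) ^ 6 * T 5 1 x - m₂ * ((x p : ℂ) ^ 4 * T 4 2 x + 4 * ((x p : ℂ) ^ 4 * T 5 1 x))
      - κ * ((x p : ℂ) ^ 2 * T 2 4 x + 2 * ((x p : ℂ) ^ 2 * T 3 3 x) + 3 * ((x p : ℂ) ^ 2 * T 4 2 x)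
        + 4 * ((x p : ℂ) ^ 2 * T 5 1 x))) with hR
  have iF : Integrable F π := ((iT1 0 1).sub ((iT0 0 2).const_mul _)).sub ((iT0 0 4).const_mul _)
  have iR : Integrable R π := by
    refine Integrable.const_mul (((iT 6 5 1).sub (((iT 4 4 2).add ((iT 4 5 1).const_mul 4)).const_mul
      (m₂ : ℂ))).sub (Integrable.const_mul ((((iT 2 2 4).add ((iT 2 3 3).const_mul 2)).add
      ((iT 2 4 2).const_mul 3)).add ((iT 2 5 1).const_mul 4)) (κ : ℂ))) ((s : ℂ) ^ 5)
  have hpol : ∀ x, F x - R x =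
      (-(s : ℂ) * m₂ * T 2 0 x - (s : ℂ) ^ 3 * κ * T 4 0 x)
      + (T 1 0 x - 2 * (s : ℂ) ^ 2 * m₂ * T 3 0 x - 4 * (s : ℂ) ^ 4 * κ * T 5 0 x) * (x p : ℂ)
      + ((s : ℂ) * T 2 0 x - 3 * (s : ℂ) ^ 3 * m₂ * T 4 0 x) * (x p : ℂ) ^ 2
      + ((s : ℂ) ^ 2 * T 3 0 x - 4 * (s : ℂ) ^ 4 * m₂ * T 5 0 x) * (x p : ℂ) ^ 3
      + ((s : ℂ) ^ 3 * T 4 0 x) * (x p : ℂ) ^ 4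
      + ((s : ℂ) ^ 4 * T 5 0 x) * (x p : ℂ) ^ 5 := by
    intro x
    have h : ∀ i j, T i (j + 1) x = T (i + 1) j x + ((s : ℂ) * x p) * T (i + 1) (j + 1) x := by
      intro i j
      have := mixedTrace_succ hA hz p 1 x i j
      rw [← hsdef] at this
      push_cast at this
      exact this
    have e1 := geom_expand_one_five (τ := fun i j => T i j x) h
    have e2 := geom_expand_two_four (τ := fun i j => T i j x) h
    have e4 := geom_expand_four_two (τ := fun i j => T i j x) h
    simp only [hF, hR]
    linear_combination (x p : ℂ) * e1 - (s : ℂ) * m₂ * e2 - (s : ℂ) ^ 3 * κ * e4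
  have hzero : ∫ x, (F x - R x) ∂π = 0 := by
    refine integral_eq_zero_of_fiber (iF.sub iR) p fun x => ?_
    simp only [hpol, hT, mixedTrace_update, Function.update_self]
    -- The terms in `T 2 0` cancel, and those in `T 4 0` have coefficient `s³ (m₄ - 3 m₂² - κ)`;
    -- this is where the fourth cumulant is singled out.
    rw [integral_quintic hs hμ, h₂, h₄, hκ]
    push_cast
    ring
  rw [integral_sub iF iR, sub_eq_zero] at hzero
  have hFint : ∫ x, F x ∂π = (∫ x, (x p : ℂ) * T 0 1 x ∂π)
      - (s : ℂ) * m₂ * (∫ x, T 0 2 x ∂π) - (s : ℂ) ^ 3 * κ * (∫ x, T 0 4 x ∂π) := by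
    simp only [hF]
    have i12 : Integrable (fun x => (x p : ℂ) * T 0 1 x - (s : ℂ) * m₂ * T 0 2 x) π :=
      (iT1 0 1).sub ((iT0 0 2).const_mul _)
    rw [integral_sub i12 ((iT0 0 4).const_mul _),
      integral_sub (iT1 0 1) ((iT0 0 2).const_mul _), integral_const_mul, integral_const_mul]
  rw [← hFint, hzero]
  set b := 2 * z.im⁻¹ ^ 6 with hb
  -- All mixed traces in `R` have total order six, so one bound `b` serves; `5 = 1 + 4` and `10 = 1
  -- + 2 + 3 + 4` count them.
  have hR_le : ∀ x, ‖R x‖ ≤ s ^ 5 * b * (x p ^ 6 + 5 * m₂ * x p ^ 4 + 10 * |κ| * x p ^ 2) := by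
    intro x
    have b51 : ‖T 5 1 x‖ ≤ b := norm_mixedTrace_one_le hN hA hz p 4 1 x
    have b42 : ‖T 4 2 x‖ ≤ b := norm_mixedTrace_one_le hN hA hz p 3 2 x
    have b33 : ‖T 3 3 x‖ ≤ b := norm_mixedTrace_one_le hN hA hz p 2 3 x
    have b24 : ‖T 2 4 x‖ ≤ b := norm_mixedTrace_one_le hN hA hz p 1 4 x
    have hmul : ∀ (k : ℕ) (w : ℂ), Even k → ‖w‖ ≤ b → ‖(x p : ℂ) ^ k * w‖ ≤ x p ^ k * b := by
      intro k w hk hw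
      rw [norm_mul, norm_pow, Complex.norm_real, Real.norm_eq_abs, hk.pow_abs]
      have := hk.pow_nonneg (x p)
      gcongr
    have hnum : ∀ (c : ℕ) (w : ℂ), ‖(c : ℂ) * w‖ = c * ‖w‖ := fun c w => by
      rw [norm_mul, Complex.norm_natCast]
    have t1 := hmul 6 _ (by decide) b51
    have t2 := hmul 4 _ (by decide) b42
    have t3 := hmul 4 _ (by decide) b51
    have t4 := hmul 2 _ (by decide) b24
    have t5 := hmul 2 _ (by decide) b33
    have t6 := hmul 2 _ (by decide) b42
    have t7 := hmul 2 _ (by decide) b51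
    simp only [hR]
    rw [norm_mul, norm_pow, Complex.norm_real, Real.norm_of_nonneg hs0, mul_assoc]
    gcongr
    refine (norm_sub_le _ _).trans ?_
    have n1 : ‖(x p : ℂ) ^ 6 * T 5 1 x - m₂ * ((x p : ℂ) ^ 4 * T 4 2 x
        + 4 * ((x p : ℂ) ^ 4 * T 5 1 x))‖ ≤ x p ^ 6 * b + m₂ * (x p ^ 4 * b + 4 * (x p ^ 4 * b)) := by
      refine (norm_sub_le _ _).trans (add_le_add t1 ?_)
      rw [norm_mul, Complex.norm_real, Real.norm_of_nonneg hm2]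
      gcongr
      refine (norm_add_le _ _).trans (add_le_add t2 ?_)
      have := hnum 4 ((x p : ℂ) ^ 4 * T 5 1 x)
      push_cast at this
      rw [this]
      linarith
    have n2 : ‖(κ : ℂ) * ((x p : ℂ) ^ 2 * T 2 4 x + 2 * ((x p : ℂ) ^ 2 * T 3 3 x)
        + 3 * ((x p : ℂ) ^ 2 * T 4 2 x) + 4 * ((x p : ℂ) ^ 2 * T 5 1 x))‖
        ≤ |κ| * (x p ^ 2 * b + 2 * (x p ^ 2 * b) + 3 * (x p ^ 2 * b) + 4 * (x p ^ 2 * b)) := by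
      rw [norm_mul, Complex.norm_real, Real.norm_eq_abs]
      gcongr
      have u2 := hnum 2 ((x p : ℂ) ^ 2 * T 3 3 x)
      have u3 := hnum 3 ((x p : ℂ) ^ 2 * T 4 2 x)
      have u4 := hnum 4 ((x p : ℂ) ^ 2 * T 5 1 x)
      push_cast at u2 u3 u4
      refine (norm_add_le _ _).trans (add_le_add ((norm_add_le _ _).trans (add_le_add
        ((norm_add_le _ _).trans (add_le_add t4 ?_)) ?_)) ?_)
      · rw [u2]; linarith
      · rw [u3]; linarith
      · rw [u4]; linarith
    refine (add_le_add n1 n2).trans (le_of_eq ?_)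
    ring
  have hc : ∀ k : ℕ, ∫ x : Fin N × Fin N → ℝ, x p ^ k ∂π = ∫ t : ℝ, t ^ k ∂μ := fun k =>
    integral_comp_eval (μ := fun _ : Fin N × Fin N => μ) (i := p) (f := fun t : ℝ => t ^ k)
      (by fun_prop)
  have i6 := integrable_coord_pow hμ p 6
  have i4 := (integrable_coord_pow hμ p 4).const_mul (5 * m₂)
  have i2 := (integrable_coord_pow hμ p 2).const_mul (10 * |κ|)
  have i64 : Integrable (fun x : Fin N × Fin N → ℝ => x p ^ 6 + 5 * m₂ * x p ^ 4) π := i6.add i4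
  have i642 : Integrable (fun x : Fin N × Fin N → ℝ =>
    x p ^ 6 + 5 * m₂ * x p ^ 4 + 10 * |κ| * x p ^ 2) π := i64.add i2
  refine (norm_integral_le_integral_norm _).trans ((integral_mono iR.norm
    (i642.const_mul _) hR_le).trans (le_of_eq ?_))
  rw [integral_const_mul, integral_add i64 i2, integral_add i6 i4, integral_const_mul,
    integral_const_mul, hc, hc, hc, h₂, h₄, h₆]

end CumulantExpansion

end DeformedWigner

namespace DeformedWigner

open MeasureTheory ProbabilityTheory
open scoped Matrix.Norms.L2Operator Matrix

/-! ### Second-order expansion tested against an idempotent. -/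

section SecondOrder

variable {N : ℕ} {A : Matrix (Fin N) (Fin N) ℂ} {z : ℂ}

lemma norm_trace_mul_sq_le (A B : Matrix (Fin N) (Fin N) ℂ) :
    ‖(A * B).trace‖ ^ 2 ≤ hs A * hs B := by
  have h1 : ‖(A * B).trace‖ ≤ ∑ q : Fin N × Fin N, ‖A q.1 q.2‖ * ‖B q.2 q.1‖ := by
    rw [Fintype.sum_prod_type, Matrix.trace]
    refine (norm_sum_le _ _).trans (Finset.sum_le_sum fun i _ => ?_)
    rw [Matrix.diag_apply, Matrix.mul_apply]
    exact (norm_sum_le _ _).trans (Finset.sum_le_sum fun j _ => (norm_mul _ _).le)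
  have h2 := Finset.sum_mul_sq_le_sq_mul_sq Finset.univ
    (fun q : Fin N × Fin N => ‖A q.1 q.2‖) (fun q => ‖B q.2 q.1‖)
  have hB : hs B = ∑ q : Fin N × Fin N, ‖B q.2 q.1‖ ^ 2 := by
    rw [Fintype.sum_prod_type, hs, Finset.sum_comm]
  have hA : hs A = ∑ q : Fin N × Fin N, ‖A q.1 q.2‖ ^ 2 := by
    rw [Fintype.sum_prod_type, hs]
  rw [hA, hB]
  exact (pow_le_pow_left₀ (norm_nonneg _) h1 2).trans h2

/-- A weighted bound for `Tr(Q H B H G Q)`. -/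
lemma mul_norm_trace_le {U V B : Matrix (Fin N) (Fin N) ℂ} {c q : ℝ} (hc : ‖B‖ ≤ c) :
    q * ‖(U * B * V).trace‖ ≤ c * ((q ^ 2 * hs U + hs V) / 2) := by
  have hc0 : 0 ≤ c := (norm_nonneg _).trans hc
  have hU := hs_nonneg U
  have hV := hs_nonneg V
  have h1 : ‖(U * B * V).trace‖ ^ 2 ≤ c ^ 2 * (hs U * hs V) := by
    refine (norm_trace_mul_sq_le _ _).trans ?_
    have : hs (U * B) ≤ hs U * c ^ 2 := (hs_mul_le_right U B).trans (by gcongr)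
    calc hs (U * B) * hs V ≤ (hs U * c ^ 2) * hs V := by gcongr
      _ = _ := by ring
  refine abs_le_of_sq_le_sq' ?_ (by positivity) |>.2
  calc (q * ‖(U * B * V).trace‖) ^ 2 = q ^ 2 * ‖(U * B * V).trace‖ ^ 2 := by ring
    _ ≤ q ^ 2 * (c ^ 2 * (hs U * hs V)) := by gcongr
    _ ≤ (c * ((q ^ 2 * hs U + hs V) / 2)) ^ 2 := by
      have : 0 ≤ c ^ 2 * (q ^ 2 * hs U - hs V) ^ 2 := by positivity
      nlinarith

/-- Idempotency and cyclicity place `Q` at both ends, giving `Tr(QH · B · HGQ)` with `B` bounded.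
Summed over `p`, the two Hilbert–Schmidt norms are of size `N hs Q`, so the error scales with the
rank of a projection instead of the dimension. The weight `q`, later a polynomial in `x_p`, is
attached to the deterministic factor `hs (QH)`, so that its square integrates separately. -/
lemma mul_norm_mixedTrace_le (hA : A.IsHermitian) (hz : 0 < z.im)
    (p : Fin N × Fin N) {Q : Matrix (Fin N) (Fin N) ℂ} (hQ : Q * Q = Q)
    (x : Fin N × Fin N → ℝ) (q : ℝ) :
    q * ‖mixedTrace A z p Q 3 1 x‖ ≤ z.im⁻¹ ^ 3 *
      ((q ^ 2 * hs (Q * hermBasis p) + hs (hermBasis p * coordResolvent A z x * Q)) / 2) ∧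
    q * ‖mixedTrace A z p Q 2 2 x‖ ≤ z.im⁻¹ ^ 3 *
      ((q ^ 2 * hs (Q * hermBasis p) + hs (hermBasis p * coordResolvent A z x * Q)) / 2) := by
  set H := hermBasis p
  set G₀ := coordResolvent A z (Function.update x p 0)
  set G := coordResolvent A z x
  have hG₀ : ‖G₀‖ ≤ z.im⁻¹ := norm_coordResolvent_le hA hz _
  have hG : ‖G‖ ≤ z.im⁻¹ := norm_coordResolvent_le hA hz _
  have hHG₀ : ‖H * G₀‖ ≤ z.im⁻¹ := norm_hermBasis_mul_coordResolvent_le hA hz _ _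
  have hHG : ‖H * G‖ ≤ z.im⁻¹ := norm_hermBasis_mul_coordResolvent_le hA hz _ _
  have hcyc : ∀ B : Matrix (Fin N) (Fin N) ℂ,
      (Q * (H * B * (H * G))).trace = (Q * H * B * (H * G * Q)).trace := by
    intro B
    calc (Q * (H * B * (H * G))).trace = (Q * (Q * (H * B * (H * G)))).trace := by
          rw [← mul_assoc Q Q, hQ]
      _ = ((Q * (H * B * (H * G))) * Q).trace := Matrix.trace_mul_comm _ _
      _ = _ := by simp only [mul_assoc]
  have e1 : mixedTrace A z p Q 3 1 x
      = (Q * H * (G₀ * (H * G₀) * (H * G₀)) * (H * G * Q)).trace := by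
    rw [← hcyc, mixedTrace]
    congr 2
    simp only [pow_succ, pow_zero, one_mul, mul_assoc]
    rfl
  have e2 : mixedTrace A z p Q 2 2 x
      = (Q * H * (G₀ * (H * G₀) * (H * G)) * (H * G * Q)).trace := by
    rw [← hcyc, mixedTrace]
    congr 2
    simp only [pow_succ, pow_zero, one_mul, mul_assoc]
    rfl
  have h3 : z.im⁻¹ ^ 3 = z.im⁻¹ * z.im⁻¹ * z.im⁻¹ := by ring
  constructor
  · rw [e1]
    refine mul_norm_trace_le ?_
    rw [h3]
    refine (norm_mul_le _ _).trans ?_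
    gcongr
    refine (norm_mul_le _ _).trans ?_
    gcongr
  · rw [e2]
    refine mul_norm_trace_le ?_
    rw [h3]
    refine (norm_mul_le _ _).trans ?_
    gcongr
    refine (norm_mul_le _ _).trans ?_
    gcongr

variable {μ : Measure ℝ} [IsProbabilityMeasure μ]

lemma continuous_hs : Continuous (hs : Matrix (Fin N) (Fin N) ℂ → ℝ) := by
  unfold hs
  fun_prop

lemma integrable_hs_hermBasis_mul (hA : A.IsHermitian) (hz : 0 < z.im) (p : Fin N × Fin N)
    (Q : Matrix (Fin N) (Fin N) ℂ) :
    Integrable (fun x => hs (hermBasis p * coordResolvent A z x * Q)) (Measure.pi fun _ => μ) := by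
  have hc : Continuous fun x => hs (hermBasis p * coordResolvent A z x * Q) :=
    continuous_hs.comp ((continuous_const.mul (continuous_coordResolvent hA hz)).mul continuous_const)
  refine Integrable.of_bound hc.aestronglyMeasurable (z.im⁻¹ ^ 2 * hs Q) (.of_forall fun x => ?_)
  rw [Real.norm_of_nonneg (hs_nonneg _)]
  refine (hs_mul_le_left _ _).trans ?_
  have := norm_hermBasis_mul_coordResolvent_le hA hz p x
  have := hs_nonneg Q
  gcongr

/-- Cumulant expansion to second order in one coordinate. -/
lemma second_order_expansion (hs' : μ.map (fun x => -x) = μ)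
    (hμ : ∀ k : ℕ, Integrable (fun x : ℝ => x ^ k) μ) {m₂ m : ℝ}
    (h₂ : ∫ t : ℝ, t ^ 2 ∂μ = m₂) (hm : ∫ t : ℝ, (t ^ 4 + 3 * m₂ * t ^ 2) ^ 2 ∂μ = m)
    (hN : 1 ≤ N) (hA : A.IsHermitian) (hz : 0 < z.im) (p : Fin N × Fin N)
    {Q : Matrix (Fin N) (Fin N) ℂ} (hQ : Q * Q = Q) :
    ‖(∫ x, (x p : ℂ) * mixedTrace A z p Q 0 1 x ∂(Measure.pi fun _ => μ))
      - ((1 / Real.sqrt N : ℝ) : ℂ) * m₂ *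
        (∫ x, mixedTrace A z p Q 0 2 x ∂(Measure.pi fun _ => μ))‖
      ≤ (1 / Real.sqrt N) ^ 3 * (z.im⁻¹ ^ 3 * ((m * hs (Q * hermBasis p) +
        ∫ x, hs (hermBasis p * coordResolvent A z x * Q) ∂(Measure.pi fun _ => μ)) / 2)) := by
  set π := Measure.pi fun _ : Fin N × Fin N => μ
  set s : ℝ := 1 / Real.sqrt N with hsdef
  have hs0 : 0 ≤ s := by positivity
  set T := mixedTrace A z p Q with hT
  have hm2 : 0 ≤ m₂ := by rw [← h₂]; exact integral_nonneg fun t => by positivity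
  have hbm : ∀ i j, BoundedMeasurable (T i j) := boundedMeasurable_mixedTrace hN hA hz p Q
  have iT : ∀ k i j, Integrable (fun x => (x p : ℂ) ^ k * T i j x) π := fun k i j =>
    integrable_coord_pow_mul hμ p k (hbm i j)
  have iT1 : ∀ i j, Integrable (fun x => (x p : ℂ) * T i j x) π := fun i j => by
    simpa using iT 1 i j
  have iT0 : ∀ i j, Integrable (fun x => T i j x) π := fun i j => by simpa using iT 0 i j
  set F : (Fin N × Fin N → ℝ) → ℂ := fun x =>
    (x p : ℂ) * T 0 1 x - (s : ℂ) * m₂ * T 0 2 x with hF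
  set R : (Fin N × Fin N → ℝ) → ℂ := fun x =>
    (s : ℂ) ^ 3 * ((x p : ℂ) ^ 4 * T 3 1 x - m₂ * ((x p : ℂ) ^ 2 * T 2 2 x
      + 2 * ((x p : ℂ) ^ 2 * T 3 1 x))) with hR
  have iF : Integrable F π := (iT1 0 1).sub ((iT0 0 2).const_mul _)
  have iR : Integrable R π := by
    refine Integrable.const_mul ((iT 4 3 1).sub (((iT 2 2 2).add ((iT 2 3 1).const_mul 2)).const_mul
      (m₂ : ℂ))) ((s : ℂ) ^ 3)
  have hpol : ∀ x, F x - R x =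
      (-(s : ℂ) * m₂ * T 2 0 x) + (T 1 0 x - 2 * (s : ℂ) ^ 2 * m₂ * T 3 0 x) * (x p : ℂ)
      + ((s : ℂ) * T 2 0 x) * (x p : ℂ) ^ 2 + ((s : ℂ) ^ 2 * T 3 0 x) * (x p : ℂ) ^ 3
      + 0 * (x p : ℂ) ^ 4 + 0 * (x p : ℂ) ^ 5 := by
    intro x
    have h : ∀ i j, T i (j + 1) x = T (i + 1) j x + ((s : ℂ) * x p) * T (i + 1) (j + 1) x := by
      intro i j
      have := mixedTrace_succ hA hz p Q x i j
      rw [← hsdef] at this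
      push_cast at this
      exact this
    have e1 := geom_expand_one_three (τ := fun i j => T i j x) h
    have e2 := geom_expand_two_two (τ := fun i j => T i j x) h
    simp only [hF, hR]
    linear_combination (x p : ℂ) * e1 - (s : ℂ) * m₂ * e2
  have hzero : ∫ x, (F x - R x) ∂π = 0 := by
    refine integral_eq_zero_of_fiber (iF.sub iR) p fun x => ?_
    simp only [hpol, hT, mixedTrace_update, Function.update_self]
    rw [integral_quintic hs' hμ, h₂]
    ring
  rw [integral_sub iF iR, sub_eq_zero] at hzero
  have hFint : ∫ x, F x ∂π = (∫ x, (x p : ℂ) * T 0 1 x ∂π)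
      - (s : ℂ) * m₂ * (∫ x, T 0 2 x ∂π) := by
    simp only [hF]
    rw [integral_sub (iT1 0 1) ((iT0 0 2).const_mul _), integral_const_mul]
  rw [← hFint, hzero]
  have hR_le : ∀ x, ‖R x‖ ≤ s ^ 3 * (z.im⁻¹ ^ 3 * (((x p ^ 4 + 3 * m₂ * x p ^ 2) ^ 2 *
      hs (Q * hermBasis p) + hs (hermBasis p * coordResolvent A z x * Q)) / 2)) := by
    intro x
    have hnum : ∀ (c : ℕ) (w : ℂ), ‖(c : ℂ) * w‖ = c * ‖w‖ := fun c w => by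
      rw [norm_mul, Complex.norm_natCast]
    have hx : ∀ (k : ℕ) (w : ℂ), Even k → ‖(x p : ℂ) ^ k * w‖ = x p ^ k * ‖w‖ := by
      intro k w hk
      rw [norm_mul, norm_pow, Complex.norm_real, Real.norm_eq_abs, hk.pow_abs]
    -- One factor `x⁴` and `1 + 2` factors `m₂ x²` occur in `R`; bounding both traces by their
    -- maximum `M` leaves the single product `q * M`.
    set q := x p ^ 4 + 3 * m₂ * x p ^ 2 with hq
    set M := max ‖T 3 1 x‖ ‖T 2 2 x‖
    have hb := mul_norm_mixedTrace_le hA hz p hQ x q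
    have hM : q * M ≤ z.im⁻¹ ^ 3 *
        ((q ^ 2 * hs (Q * hermBasis p) + hs (hermBasis p * coordResolvent A z x * Q)) / 2) := by
      rcases max_choice ‖T 3 1 x‖ ‖T 2 2 x‖ with h | h
      · simp only [M, h]; exact hb.1
      · simp only [M, h]; exact hb.2
    simp only [hR]
    rw [norm_mul, norm_pow, Complex.norm_real, Real.norm_of_nonneg hs0]
    gcongr
    refine le_trans ?_ hM
    have u2 := hnum 2 ((x p : ℂ) ^ 2 * T 3 1 x)
    push_cast at u2
    have v1 : ‖T 3 1 x‖ ≤ M := le_max_left _ _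
    have v2 : ‖T 2 2 x‖ ≤ M := le_max_right _ _
    refine (norm_sub_le _ _).trans ?_
    rw [hx 4 _ (by decide), norm_mul (m₂ : ℂ), Complex.norm_real, Real.norm_of_nonneg hm2]
    have n2 := norm_add_le ((x p : ℂ) ^ 2 * T 2 2 x) (2 * ((x p : ℂ) ^ 2 * T 3 1 x))
    rw [u2, hx 2 _ (by decide), hx 2 _ (by decide)] at n2
    calc x p ^ 4 * ‖T 3 1 x‖ + m₂ * ‖(x p : ℂ) ^ 2 * T 2 2 x + 2 * ((x p : ℂ) ^ 2 * T 3 1 x)‖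
        ≤ x p ^ 4 * M + m₂ * (x p ^ 2 * M + 2 * (x p ^ 2 * M)) := by
          gcongr
          refine n2.trans ?_
          gcongr
      _ = q * M := by rw [hq]; ring
  have iq : Integrable (fun t : ℝ => (t ^ 4 + 3 * m₂ * t ^ 2) ^ 2) μ := by
    have : (fun t : ℝ => (t ^ 4 + 3 * m₂ * t ^ 2) ^ 2)
        = fun t => t ^ 8 + 6 * m₂ * t ^ 6 + 9 * m₂ ^ 2 * t ^ 4 := by funext t; ring
    rw [this]
    exact ((hμ 8).add ((hμ 6).const_mul _)).add ((hμ 4).const_mul _)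
  have iqp : Integrable (fun x : Fin N × Fin N → ℝ => (x p ^ 4 + 3 * m₂ * x p ^ 2) ^ 2) π :=
    integrable_comp_eval (μ := fun _ : Fin N × Fin N => μ) (i := p) iq
  have hqp : ∫ x : Fin N × Fin N → ℝ, (x p ^ 4 + 3 * m₂ * x p ^ 2) ^ 2 ∂π = m := by
    rw [← hm]
    exact integral_comp_eval (μ := fun _ : Fin N × Fin N => μ) (i := p)
      (f := fun t : ℝ => (t ^ 4 + 3 * m₂ * t ^ 2) ^ 2) (by fun_prop)
  have iH := integrable_hs_hermBasis_mul (μ := μ) hA hz p Q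
  have isum : Integrable (fun x : Fin N × Fin N → ℝ => (x p ^ 4 + 3 * m₂ * x p ^ 2) ^ 2 *
      hs (Q * hermBasis p) + hs (hermBasis p * coordResolvent A z x * Q)) π :=
    (iqp.mul_const _).add iH
  refine (norm_integral_le_integral_norm _).trans ((integral_mono iR.norm
    (((isum.div_const 2).const_mul _).const_mul _) hR_le).trans (le_of_eq ?_))
  rw [integral_const_mul, integral_const_mul, integral_div, integral_add (iqp.mul_const _) iH,
    integral_mul_const, hqp]

end SecondOrder

end DeformedWigner

namespace DeformedWigner

open MeasureTheory ProbabilityTheory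
open scoped Matrix.Norms.L2Operator Matrix

/-! ### The sum of the quartic traces over the basis. -/

section QuarticTrace

variable {N : ℕ}

/-- Newton's identity `t⁴ - 4t²d + 2d²` for the fourth power sum of two eigenvalues: `HG` has rank
at most two, `t` is its trace and `d` is the determinant of its block on the indices `i`, `j`. The
formula also holds for `i = j`, where `d = 0`. -/
lemma trace_pow_four_two_dim (i j : Fin N) (α β : ℂ) (G : Matrix (Fin N) (Fin N) ℂ) :
    (((α • Matrix.single i j (1 : ℂ) + β • Matrix.single j i (1 : ℂ)) * G) ^ 4).trace
      = (α * G j i + β * G i j) ^ 4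
        - 4 * (α * G j i + β * G i j) ^ 2 * (α * β * (G i j * G j i - G i i * G j j))
        + 2 * (α * β * (G i j * G j i - G i i * G j j)) ^ 2 := by
  set H := α • Matrix.single i j (1 : ℂ) + β • Matrix.single j i (1 : ℂ) with hH
  have h1 : ∀ B : Matrix (Fin N) (Fin N) ℂ, (H * B).trace = α * B j i + β * B i j := by
    intro B
    rw [hH, add_mul, Matrix.smul_mul, Matrix.smul_mul, Matrix.trace_add, Matrix.trace_smul,
      Matrix.trace_smul, trace_single_mul_eq, trace_single_mul_eq, smul_eq_mul, smul_eq_mul]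
  have h2 : ∀ (B : Matrix (Fin N) (Fin N) ℂ) (k l : Fin N),
      (G * (H * B)) k l = α * (G k i * B j l) + β * (G k j * B i l) := by
    intro B k l
    rw [hH, add_mul, mul_add, Matrix.add_apply, Matrix.smul_mul, Matrix.smul_mul, Matrix.mul_smul,
      Matrix.mul_smul, Matrix.smul_apply, Matrix.smul_apply, smul_eq_mul, smul_eq_mul]
    have : ∀ i j : Fin N, (G * (Matrix.single i j (1 : ℂ) * B)) k l = G k i * B j l := by
      intro i j
      rw [Matrix.mul_apply, Finset.sum_eq_single i]
      · simp
      · intro b _ hb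
        simp [Matrix.single_mul_apply_of_ne _ _ _ _ _ hb]
      · simp
    rw [this, this]
  have h3 : (H * G) ^ 4 = H * (G * (H * (G * (H * (G * (H * G)))))) := by
    simp only [pow_succ, pow_zero, one_mul, mul_assoc]
  rw [h3, h1]
  simp only [h2]
  ring

/-- The real and imaginary directions are taken together: mixed terms such as `G_ij³ G_ji` cancel,
and only `G_ii² G_jj²` is free of off-diagonal entries. -/
lemma trace_pow_four_pair {i j : Fin N} (h : i < j) (G : Matrix (Fin N) (Fin N) ℂ) :
    ((hermBasis (i, j) * G) ^ 4).trace + ((hermBasis (j, i) * G) ^ 4).trace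
      = G i i ^ 2 * G j j ^ 2 + 1 / 2 * G i j ^ 4 + 1 / 2 * G j i ^ 4
        + 2 * (G i i * G j j * G i j * G j i) := by
  have e1 : hermBasis (i, j) = ((Real.sqrt 2 : ℂ)⁻¹) • Matrix.single i j (1 : ℂ)
      + ((Real.sqrt 2 : ℂ)⁻¹) • Matrix.single j i (1 : ℂ) := by
    rw [hermBasis_lt h, smul_add]
  have e2 : hermBasis (j, i) = ((Real.sqrt 2 : ℂ)⁻¹ * Complex.I) • Matrix.single i j (1 : ℂ)
      + (-((Real.sqrt 2 : ℂ)⁻¹ * Complex.I)) • Matrix.single j i (1 : ℂ) := by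
    rw [hermBasis_gt h, smul_sub, neg_smul, sub_eq_add_neg]
  rw [e1, e2, trace_pow_four_two_dim, trace_pow_four_two_dim]
  have h2 : (Real.sqrt 2 : ℂ)⁻¹ ^ 2 = 1 / 2 := by rw [sq, sqrt_two_inv_mul_self]
  have h4 : (Real.sqrt 2 : ℂ)⁻¹ ^ 4 = 1 / 4 := by
    rw [show 4 = 2 * 2 from rfl, pow_mul, h2]; norm_num
  have hI2 := Complex.I_sq
  have hI4 := Complex.I_pow_four
  generalize (Real.sqrt 2 : ℂ)⁻¹ = r at *
  ring_nf
  simp only [h4, hI4]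
  ring

lemma sum_trace_pow_four (G : Matrix (Fin N) (Fin N) ℂ) :
    ∑ p, ((hermBasis p * G) ^ 4).trace
      = 1 / 2 * (∑ i, G i i ^ 2) ^ 2
        + ∑ i, ∑ j, (1 / 2 * G i j ^ 4 + G i i * G j j * G i j * G j i) - ∑ i, G i i ^ 4 := by
  set f : Fin N → Fin N → ℂ := fun i j => ((hermBasis (i, j) * G) ^ 4).trace with hf
  -- At `i = j` the general expression equals `2 G_ii⁴` while the true value is `G_ii⁴`; the last
  -- term corrects this.
  set F : Fin N → Fin N → ℂ := fun i j => 1 / 2 * (G i i ^ 2 * G j j ^ 2) +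
    (1 / 2 * G i j ^ 4 + G i i * G j j * G i j * G j i) - if i = j then G i i ^ 4 else 0 with hF
  have hsym : ∀ i j, f i j + f j i = F i j + F j i := by
    intro i j
    rcases lt_trichotomy i j with h | rfl | h
    · have := trace_pow_four_pair h G
      simp only [hf, hF, h.ne, h.ne', if_false]
      linear_combination this
    · have : f i i = F i i := by
        have := trace_pow_four_two_dim i i 1 0 G
        simp only [one_smul, zero_smul, add_zero] at this
        simp only [hf, hF, hermBasis_diag, if_true, this]
        ring
      rw [this]
    · have := trace_pow_four_pair h G
      simp only [hf, hF, h.ne, h.ne', if_false]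
      linear_combination this
  have h2 : ∑ i, ∑ j, f i j = ∑ i, ∑ j, F i j := by
    have a1 : 2 * ∑ i, ∑ j, f i j = ∑ i, ∑ j, (f i j + f j i) := by
      simp only [Finset.sum_add_distrib]
      rw [Finset.sum_comm (f := fun i j => f j i)]
      ring
    have a2 : 2 * ∑ i, ∑ j, F i j = ∑ i, ∑ j, (F i j + F j i) := by
      simp only [Finset.sum_add_distrib]
      rw [Finset.sum_comm (f := fun i j => F j i)]
      ring
    have : (2 : ℂ) * ∑ i, ∑ j, f i j = 2 * ∑ i, ∑ j, F i j := by
      rw [a1, a2]; simp only [hsym]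
    exact mul_left_cancel₀ two_ne_zero this
  rw [Fintype.sum_prod_type]
  refine h2.trans ?_
  simp only [hF, Finset.sum_sub_distrib, Finset.sum_add_distrib]
  simp only [Finset.sum_ite_eq, Finset.mem_univ, if_true, ← Finset.mul_sum]
  rw [sq (∑ i, G i i ^ 2), ← Finset.sum_mul]

/-- Every other term of the double sum contains at least two factors among `G_ij`, `G_ji`, so it is
summed by the Hilbert–Schmidt norm: order `N`, against `N²` for the main term. -/
lemma norm_sum_trace_pow_four_sub_le {G : Matrix (Fin N) (Fin N) ℂ} {c : ℝ} (h : ‖G‖ ≤ c) :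
    ‖∑ p, ((hermBasis p * G) ^ 4).trace - 1 / 2 * (∑ i, G i i ^ 2) ^ 2‖ ≤ 3 * c ^ 4 * N := by
  have hc : 0 ≤ c := (norm_nonneg _).trans h
  have hG : ∀ i j, ‖G i j‖ ≤ c := fun i j => (norm_entry_le G i j).trans h
  have hsG := hs_le_of_norm_le h
  rw [sum_trace_pow_four, add_sub_assoc, add_sub_cancel_left]
  have h1 : ‖∑ i, ∑ j, (1 / 2 * G i j ^ 4 + G i i * G j j * G i j * G j i)‖
      ≤ 2 * (c ^ 2 * hs G) := by
    have e : 2 * (c ^ 2 * hs G) = ∑ i, ∑ j, c ^ 2 * (‖G i j‖ ^ 2 + ‖G j i‖ ^ 2) := by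
      simp only [← Finset.mul_sum, Finset.sum_add_distrib]
      rw [Finset.sum_comm (f := fun i j => ‖G j i‖ ^ 2)]
      simp only [hs]; ring
    rw [e]
    refine (norm_sum_le _ _).trans (Finset.sum_le_sum fun i _ =>
      (norm_sum_le _ _).trans (Finset.sum_le_sum fun j _ => ?_))
    have n1 : ‖1 / 2 * G i j ^ 4‖ ≤ 1 / 2 * (c ^ 2 * ‖G i j‖ ^ 2) := by
      rw [norm_mul, norm_pow, show (4 : ℕ) = 2 + 2 from rfl, pow_add]
      have := hG i j
      norm_num
      gcongr
    have n2 : ‖G i i * G j j * G i j * G j i‖ ≤ c ^ 2 * ((‖G i j‖ ^ 2 + ‖G j i‖ ^ 2) / 2) := by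
      rw [norm_mul, norm_mul, norm_mul, mul_assoc, sq c]
      have := hG i i
      have := hG j j
      have : ‖G i j‖ * ‖G j i‖ ≤ (‖G i j‖ ^ 2 + ‖G j i‖ ^ 2) / 2 := by
        nlinarith [sq_nonneg (‖G i j‖ - ‖G j i‖)]
      gcongr
    refine (norm_add_le _ _).trans ((add_le_add n1 n2).trans ?_)
    have : 0 ≤ c ^ 2 * ‖G j i‖ ^ 2 := by positivity
    linarith
  have h2 : ‖∑ i, G i i ^ 4‖ ≤ c ^ 4 * N := by
    refine (norm_sum_le _ _).trans ?_
    calc ∑ i, ‖G i i ^ 4‖ ≤ ∑ _i : Fin N, c ^ 4 := by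
          refine Finset.sum_le_sum fun i _ => ?_
          rw [norm_pow]
          exact pow_le_pow_left₀ (norm_nonneg _) (hG i i) 4
      _ = c ^ 4 * N := by simp [mul_comm]
  refine (norm_sub_le _ _).trans ((add_le_add h1 h2).trans ?_)
  have : c ^ 2 * hs G ≤ c ^ 2 * (c ^ 2 * N) := by gcongr
  nlinarith

end QuarticTrace

end DeformedWigner

namespace DeformedWigner

open MeasureTheory ProbabilityTheory
open scoped Matrix.Norms.L2Operator Matrix

/-! ### Approximate loop equations for the mean resolvent. -/

section LoopEquation

set_option linter.unusedSectionVars false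

variable {N : ℕ} {A : Matrix (Fin N) (Fin N) ℂ} {z : ℂ} {μ : Measure ℝ} [IsProbabilityMeasure μ]

/-- The expectation of `Tr(B G)`. -/
noncomputable def meanTrace (μ : Measure ℝ) (A : Matrix (Fin N) (Fin N) ℂ) (z : ℂ)
    (B : Matrix (Fin N) (Fin N) ℂ) : ℂ :=
  ∫ x, (B * coordResolvent A z x).trace ∂(Measure.pi fun _ => μ)

lemma integrable_trace_mul (hA : A.IsHermitian) (hz : 0 < z.im) (B : Matrix (Fin N) (Fin N) ℂ) :
    Integrable (fun x => (B * coordResolvent A z x).trace) (Measure.pi fun _ => μ) :=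
  (boundedMeasurable_trace_mul_coordResolvent hA hz B).integrable _

/-- Multiply `(z - M)G = 1` by `Q`, take the trace, and expand the Wigner part in the basis. -/
lemma loop_identity (hA : A.IsHermitian) (hz : 0 < z.im) (Q : Matrix (Fin N) (Fin N) ℂ)
    (x : Fin N × Fin N → ℝ) :
    z * (Q * coordResolvent A z x).trace - (Q * A * coordResolvent A z x).trace - Q.trace
      = ((1 / Real.sqrt N : ℝ) : ℂ) * ∑ p, (x p : ℂ) * mixedTrace A z p Q 0 1 x := by
  have h := mul_resolvent (deformedMatrix_isHermitian (hermOfCoord_isHermitian x) hA) hz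
  rw [← coordResolvent] at h
  set G := coordResolvent A z x with hG
  have h1 : (Q * ((z • (1 : Matrix (Fin N) (Fin N) ℂ) - deformedMatrix (hermOfCoord x) A) * G)).trace
      = Q.trace := by rw [h, mul_one]
  have h2 : (Q * (hermOfCoord x * G)).trace = ∑ p, (x p : ℂ) * mixedTrace A z p Q 0 1 x := by
    rw [hermOfCoord, Finset.sum_mul, Finset.mul_sum, Matrix.trace_sum]
    refine Finset.sum_congr rfl fun p _ => ?_
    rw [Matrix.smul_mul, Matrix.mul_smul, Matrix.trace_smul, smul_eq_mul]
    simp [mixedTrace, hG]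
  rw [← h2, ← h1, deformedMatrix, sub_mul, add_mul, mul_sub, mul_add, Matrix.smul_mul, one_mul,
    Matrix.smul_mul, Matrix.mul_smul, Matrix.mul_smul, Matrix.trace_sub, Matrix.trace_add,
    Matrix.trace_smul, Matrix.trace_smul, mul_assoc Q A, smul_eq_mul, smul_eq_mul]
  ring

lemma mean_loop_identity (hμ : ∀ k : ℕ, Integrable (fun x : ℝ => x ^ k) μ)
    (hN : 1 ≤ N) (hA : A.IsHermitian) (hz : 0 < z.im) (Q : Matrix (Fin N) (Fin N) ℂ) :
    z * meanTrace μ A z Q - meanTrace μ A z (Q * A) - Q.trace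
      = ((1 / Real.sqrt N : ℝ) : ℂ) *
        ∑ p, ∫ x, (x p : ℂ) * mixedTrace A z p Q 0 1 x ∂(Measure.pi fun _ => μ) := by
  have i1 := integrable_trace_mul (μ := μ) hA hz Q
  have i2 := integrable_trace_mul (μ := μ) hA hz (Q * A)
  have i3 : ∀ p : Fin N × Fin N, Integrable (fun x => (x p : ℂ) * mixedTrace A z p Q 0 1 x)
      (Measure.pi fun _ => μ) := fun p => by
    simpa using integrable_coord_pow_mul hμ p 1 (boundedMeasurable_mixedTrace hN hA hz p Q 0 1)
  have i12 : Integrable (fun x => z * (Q * coordResolvent A z x).trace -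
      (Q * A * coordResolvent A z x).trace) (Measure.pi fun _ => μ) := (i1.const_mul z).sub i2
  have e := congrArg (fun f => ∫ x, f x ∂(Measure.pi fun _ : Fin N × Fin N => μ))
    (funext (loop_identity hA hz Q))
  simp only at e
  rw [integral_sub i12 (integrable_const _), integral_sub (i1.const_mul z) i2, integral_const_mul,
    integral_const_mul, integral_finsetSum _ fun p _ => i3 p] at e
  simpa [meanTrace] using e

/-- The contraction `∑ H G H = Tr(G) 1`. -/
lemma sum_mixedTrace_two (Q : Matrix (Fin N) (Fin N) ℂ) (x : Fin N × Fin N → ℝ) :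
    ∑ p, mixedTrace A z p Q 0 2 x = (coordResolvent A z x).trace * (Q * coordResolvent A z x).trace := by
  set G := coordResolvent A z x with hG
  have : ∀ p, mixedTrace A z p Q 0 2 x = (Q * ((hermBasis p * G * hermBasis p) * G)).trace := by
    intro p
    simp [mixedTrace, sq, mul_assoc, hG]
  simp only [this]
  rw [← Matrix.trace_sum, ← Finset.mul_sum, ← Finset.sum_mul, sum_hermBasis_mul_mul,
    Matrix.smul_mul, one_mul, Matrix.mul_smul, Matrix.trace_smul, smul_eq_mul]

lemma ofReal_one_div_sqrt_sq (N : ℕ) : ((1 / Real.sqrt N : ℝ) : ℂ) ^ 2 = 1 / N := by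
  rw [← Complex.ofReal_pow, one_div_sqrt_sq]
  push_cast
  rfl

/-- The approximate loop equation tested against an idempotent, before decoupling. -/
lemma loop_second_order (hs' : μ.map (fun x => -x) = μ)
    (hμ : ∀ k : ℕ, Integrable (fun x : ℝ => x ^ k) μ) {m₂ m : ℝ}
    (h₂ : ∫ t : ℝ, t ^ 2 ∂μ = m₂) (hm : ∫ t : ℝ, (t ^ 4 + 3 * m₂ * t ^ 2) ^ 2 ∂μ = m)
    (hN : 1 ≤ N) (hA : A.IsHermitian) (hz : 0 < z.im)
    {Q : Matrix (Fin N) (Fin N) ℂ} (hQ : Q * Q = Q) :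
    ‖z * meanTrace μ A z Q - meanTrace μ A z (Q * A) - Q.trace
      - 1 / N * m₂ * ∫ x, (coordResolvent A z x).trace * (Q * coordResolvent A z x).trace
          ∂(Measure.pi fun _ => μ)‖
      ≤ z.im⁻¹ ^ 3 * ((m + z.im⁻¹ ^ 2) / 2) * hs Q / N := by
  set π := Measure.pi fun _ : Fin N × Fin N => μ
  set s : ℝ := 1 / Real.sqrt N with hsdef
  have hs0 : 0 ≤ s := by positivity
  have hs2 : s ^ 2 = 1 / N := one_div_sqrt_sq N
  have hs2c : (s : ℂ) ^ 2 = 1 / N := ofReal_one_div_sqrt_sq N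
  have hNpos : (0 : ℝ) < N := by exact_mod_cast hN
  have i2 : ∀ p, Integrable (mixedTrace A z p Q 0 2) π := fun p =>
    (boundedMeasurable_mixedTrace hN hA hz p Q 0 2).integrable _
  have e2 : ∫ x, (coordResolvent A z x).trace * (Q * coordResolvent A z x).trace ∂π
      = ∑ p, ∫ x, mixedTrace A z p Q 0 2 x ∂π := by
    rw [← integral_finsetSum _ fun p _ => i2 p]
    simp only [sum_mixedTrace_two]
  rw [mean_loop_identity hμ hN hA hz Q, e2, ← hsdef, ← hs2c]
  have e3 : (s : ℂ) * ∑ p, ∫ x, (x p : ℂ) * mixedTrace A z p Q 0 1 x ∂π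
      - (s : ℂ) ^ 2 * m₂ * ∑ p, ∫ x, mixedTrace A z p Q 0 2 x ∂π
      = (s : ℂ) * ∑ p, ((∫ x, (x p : ℂ) * mixedTrace A z p Q 0 1 x ∂π)
        - (s : ℂ) * m₂ * ∫ x, mixedTrace A z p Q 0 2 x ∂π) := by
    rw [Finset.sum_sub_distrib, ← Finset.mul_sum]
    ring
  rw [e3, norm_mul, Complex.norm_real, Real.norm_of_nonneg hs0]
  have hsum : ‖∑ p, ((∫ x, (x p : ℂ) * mixedTrace A z p Q 0 1 x ∂π)
        - (s : ℂ) * m₂ * ∫ x, mixedTrace A z p Q 0 2 x ∂π)‖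
      ≤ ∑ p, s ^ 3 * (z.im⁻¹ ^ 3 * ((m * hs (Q * hermBasis p) +
        ∫ x, hs (hermBasis p * coordResolvent A z x * Q) ∂π) / 2)) :=
    (norm_sum_le _ _).trans (Finset.sum_le_sum fun p _ =>
      second_order_expansion hs' hμ h₂ hm hN hA hz p hQ)
  -- The sum of `H_p²` is `N` times the identity, so the total is `N hs(GQ)`; with the prefactor `s⁴
  -- = N⁻²` the error is of order `hs(Q)/N`.
  have hsum_int : ∑ p, ∫ x, hs (hermBasis p * coordResolvent A z x * Q) ∂π
      ≤ N * (z.im⁻¹ ^ 2 * hs Q) := by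
    rw [← integral_finsetSum _ fun p _ => integrable_hs_hermBasis_mul hA hz p Q]
    have : ∫ x, ∑ p, hs (hermBasis p * coordResolvent A z x * Q) ∂π
        ≤ ∫ _, N * (z.im⁻¹ ^ 2 * hs Q) ∂π := by
      refine integral_mono (integrable_finsetSum _ fun p _ => integrable_hs_hermBasis_mul hA hz p Q)
        (integrable_const _) fun x => ?_
      simp only [mul_assoc]
      rw [sum_hs_hermBasis_mul]
      have h1 := hs_mul_le_left (coordResolvent A z x) Q
      have h2 := norm_coordResolvent_le hA hz x
      have h3 := hs_nonneg Q
      gcongr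
      exact h1.trans (by gcongr)
    simpa using this
  have hsum2 : ∑ p, s ^ 3 * (z.im⁻¹ ^ 3 * ((m * hs (Q * hermBasis p) +
        ∫ x, hs (hermBasis p * coordResolvent A z x * Q) ∂π) / 2))
      ≤ s ^ 3 * (z.im⁻¹ ^ 3 * ((m * (N * hs Q) + N * (z.im⁻¹ ^ 2 * hs Q)) / 2)) := by
    rw [← Finset.mul_sum, ← Finset.mul_sum, ← Finset.sum_div, Finset.sum_add_distrib,
      ← Finset.mul_sum, sum_hs_mul_hermBasis]
    gcongr
  calc s * _ ≤ s * (s ^ 3 * (z.im⁻¹ ^ 3 * ((m * (N * hs Q) + N * (z.im⁻¹ ^ 2 * hs Q)) / 2))) := by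
        gcongr; exact hsum.trans hsum2
    _ = (s ^ 2) ^ 2 * (z.im⁻¹ ^ 3 * ((m * (N * hs Q) + N * (z.im⁻¹ ^ 2 * hs Q)) / 2)) := by ring
    _ = _ := by rw [hs2]; field_simp

/-- Center both factors. The arithmetic mean of the variances is enough here, and avoids square
roots. -/
lemma norm_covariance_le {α : Type*} [MeasurableSpace α] {ν : Measure α} [IsProbabilityMeasure ν]
    {f g : α → ℂ} (hf : MemLp f 2 ν) (hg : MemLp g 2 ν) :
    ‖∫ x, f x * g x ∂ν - (∫ x, f x ∂ν) * ∫ x, g x ∂ν‖ ≤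
      (∫ x, ‖f x - ∫ y, f y ∂ν‖ ^ 2 ∂ν + ∫ x, ‖g x - ∫ y, g y ∂ν‖ ^ 2 ∂ν) / 2 := by
  set a := ∫ x, f x ∂ν with ha
  set b := ∫ x, g x ∂ν with hb
  have hfi := hf.integrable (by norm_num)
  have hgi := hg.integrable (by norm_num)
  have hfg : Integrable (fun x => f x * g x) ν := hf.integrable_mul hg
  have e : ∫ x, f x * g x ∂ν - a * b = ∫ x, (f x - a) * (g x - b) ∂ν := by
    have : (fun x => (f x - a) * (g x - b)) = fun x => f x * g x - f x * b - a * g x + a * b := by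
      funext x; ring
    have j1 : Integrable (fun x => f x * g x - f x * b) ν := hfg.sub (hfi.mul_const b)
    have j2 : Integrable (fun x => f x * g x - f x * b - a * g x) ν := j1.sub (hgi.const_mul a)
    rw [this, integral_add j2 (integrable_const _), integral_sub j1 (hgi.const_mul a),
      integral_sub hfg (hfi.mul_const b), integral_mul_const, integral_const_mul, ← ha, ← hb]
    simp
  have k1 : Integrable (fun x => ‖f x - a‖ ^ 2) ν :=
    (hf.sub (memLp_const a)).integrable_norm_pow (by norm_num)
  have k2 : Integrable (fun x => ‖g x - b‖ ^ 2) ν :=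
    (hg.sub (memLp_const b)).integrable_norm_pow (by norm_num)
  rw [e, ← integral_add k1 k2, ← integral_div]
  refine norm_integral_le_of_norm_le ((k1.add k2).div_const 2) (.of_forall fun x => ?_)
  rw [norm_mul]
  nlinarith [sq_nonneg (‖f x - a‖ - ‖g x - b‖)]

lemma BoundedMeasurable.memLp {ι : Type*} {F : (ι → ℝ) → ℂ} (hF : BoundedMeasurable F)
    (ν : Measure (ι → ℝ)) [IsFiniteMeasure ν] : MemLp F 2 ν := by
  obtain ⟨hm, B, hB⟩ := hF
  exact MemLp.of_bound hm.aestronglyMeasurable B (.of_forall hB)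

lemma hs_normalized_one (hN : 1 ≤ N) :
    hs ((1 / (N : ℂ)) • (1 : Matrix (Fin N) (Fin N) ℂ)) = 1 / N := by
  have hNpos : (0 : ℝ) < N := by exact_mod_cast hN
  have : ∀ (c : ℂ) (B : Matrix (Fin N) (Fin N) ℂ), hs (c • B) = ‖c‖ ^ 2 * hs B := by
    intro c B
    simp [hs, mul_pow, Finset.mul_sum]
  rw [this, hs_one, Fintype.card_fin, norm_div, norm_one, Complex.norm_natCast]
  field_simp

lemma trace_normalized_one_mul (G : Matrix (Fin N) (Fin N) ℂ) :
    (((1 / (N : ℂ)) • (1 : Matrix (Fin N) (Fin N) ℂ)) * G).trace = 1 / N * G.trace := by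
  rw [Matrix.smul_mul, one_mul, Matrix.trace_smul, smul_eq_mul]

/-- The mean Stieltjes transform in coordinates. -/
noncomputable def meanStieltjes (μ : Measure ℝ) (A : Matrix (Fin N) (Fin N) ℂ) (z : ℂ) : ℂ :=
  ∫ x, 1 / (N : ℂ) * (coordResolvent A z x).trace ∂(Measure.pi fun _ => μ)

lemma meanTrace_one (hN : 1 ≤ N) : meanTrace μ A z 1 = N * meanStieltjes μ A z := by
  have : (N : ℂ) ≠ 0 := by exact_mod_cast (by omega : N ≠ 0)
  simp only [meanTrace, meanStieltjes, one_mul]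
  rw [integral_const_mul]
  field_simp

variable {C : ℝ}

/-- The general variance bound with test matrix `1/N`, whose squared Hilbert–Schmidt norm is itself
`1/N`; this yields the rate `N⁻²`. -/
lemma variance_normalizedTrace_le (hC : 0 ≤ C)
    (hP : ∀ f : ℝ → ℂ, ContDiff ℝ 1 f → MemLp f 2 μ → MemLp (deriv f) 2 μ →
      ∫ x, ‖f x - ∫ y, f y ∂μ‖ ^ 2 ∂μ ≤ C * ∫ x, ‖deriv f x‖ ^ 2 ∂μ)
    (hN : 1 ≤ N) (hA : A.IsHermitian) (hz : 0 < z.im) :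
    ∫ x, ‖1 / (N : ℂ) * (coordResolvent A z x).trace - meanStieltjes μ A z‖ ^ 2
      ∂(Measure.pi fun _ => μ) ≤ C * z.im⁻¹ ^ 4 / N ^ 2 := by
  have h := variance_trace_mul_coordResolvent_le hC hP hA hz
    ((1 / (N : ℂ)) • (1 : Matrix (Fin N) (Fin N) ℂ))
  rw [hs_normalized_one hN] at h
  simp only [trace_normalized_one_mul] at h
  rw [← meanStieltjes] at h
  refine h.trans (le_of_eq ?_)
  have hNpos : (0 : ℝ) < N := by exact_mod_cast hN
  field_simp

lemma boundedMeasurable_normalizedTrace (hA : A.IsHermitian) (hz : 0 < z.im) :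
    BoundedMeasurable (fun x => 1 / (N : ℂ) * (coordResolvent A z x).trace) := by
  simpa only [trace_normalized_one_mul] using boundedMeasurable_trace_mul_coordResolvent hA hz
    ((1 / (N : ℂ)) • (1 : Matrix (Fin N) (Fin N) ℂ))

/-- The approximate loop equation tested against an idempotent. -/
lemma loop_equation_idempotent (hC : 0 ≤ C)
    (hP : ∀ f : ℝ → ℂ, ContDiff ℝ 1 f → MemLp f 2 μ → MemLp (deriv f) 2 μ →
      ∫ x, ‖f x - ∫ y, f y ∂μ‖ ^ 2 ∂μ ≤ C * ∫ x, ‖deriv f x‖ ^ 2 ∂μ)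
    (hs' : μ.map (fun x => -x) = μ)
    (hμ : ∀ k : ℕ, Integrable (fun x : ℝ => x ^ k) μ) {m₂ m : ℝ}
    (h₂ : ∫ t : ℝ, t ^ 2 ∂μ = m₂) (hm : ∫ t : ℝ, (t ^ 4 + 3 * m₂ * t ^ 2) ^ 2 ∂μ = m)
    (hN : 1 ≤ N) (hA : A.IsHermitian) (hz : 0 < z.im)
    {Q : Matrix (Fin N) (Fin N) ℂ} (hQ : Q * Q = Q) :
    ‖(z - m₂ * meanStieltjes μ A z) * meanTrace μ A z Q - meanTrace μ A z (Q * A) - Q.trace‖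
      ≤ (m + 1 + m₂ * C) * (1 + hs Q) * (1 + z.im⁻¹) ^ 5 / N := by
  set π := Measure.pi fun _ : Fin N × Fin N => μ with hπ
  set y := z.im⁻¹ with hy
  have hy0 : 0 < y := inv_pos.2 hz
  have hm2 : 0 ≤ m₂ := by rw [← h₂]; exact integral_nonneg fun t => by positivity
  have hm0 : 0 ≤ m := by rw [← hm]; exact integral_nonneg fun t => by positivity
  have hNpos : (1 : ℝ) ≤ N := by exact_mod_cast hN
  have hq := hs_nonneg Q
  have h1 := loop_second_order hs' hμ h₂ hm hN hA hz hQ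
  have h2 := norm_covariance_le ((boundedMeasurable_normalizedTrace hA hz).memLp π)
    ((boundedMeasurable_trace_mul_coordResolvent hA hz Q).memLp π)
  have h3 := variance_normalizedTrace_le hC hP hN hA hz
  have h4 := variance_trace_mul_coordResolvent_le hC hP hA hz Q
  rw [← meanStieltjes, ← meanTrace] at h2
  rw [← meanTrace] at h4
  rw [← hπ] at h1 h3 h4
  set K := ∫ x, 1 / (N : ℂ) * (coordResolvent A z x).trace * (Q * coordResolvent A z x).trace ∂π
    with hK
  have hK' : 1 / (N : ℂ) * m₂ * ∫ x, (coordResolvent A z x).trace * (Q * coordResolvent A z x).trace ∂π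
      = m₂ * K := by
    rw [hK, ← integral_const_mul, ← integral_const_mul]
    congr 1; funext x; ring
  rw [hK'] at h1
  -- Decoupling the two traces: the variances are of order `N⁻²` and `hs(Q)/N`.
  have h5 : ‖K - meanStieltjes μ A z * meanTrace μ A z Q‖ ≤ C * (1 + hs Q) * y ^ 4 / N := by
    refine h2.trans ?_
    have b1 : C * y ^ 4 / (N : ℝ) ^ 2 ≤ C * y ^ 4 / N := by
      gcongr
      nlinarith
    have b2 : C * (1 + hs Q) * y ^ 4 / N = C * y ^ 4 / N + C * (y ^ 4 * hs Q / N) := by ring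
    have b3 : 0 ≤ C * y ^ 4 / N := by positivity
    have b4 : 0 ≤ C * (y ^ 4 * hs Q / N) := by positivity
    rw [b2]
    linarith
  have e : (z - m₂ * meanStieltjes μ A z) * meanTrace μ A z Q - meanTrace μ A z (Q * A) - Q.trace
      = (z * meanTrace μ A z Q - meanTrace μ A z (Q * A) - Q.trace - m₂ * K)
        + m₂ * (K - meanStieltjes μ A z * meanTrace μ A z Q) := by ring
  rw [e]
  refine (norm_add_le _ _).trans ?_
  rw [norm_mul, Complex.norm_real, Real.norm_of_nonneg hm2]
  have p1 : y ^ 3 ≤ (1 + y) ^ 5 := by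
    calc y ^ 3 ≤ (1 + y) ^ 3 := by gcongr; linarith
      _ ≤ (1 + y) ^ 5 := pow_le_pow_right₀ (by linarith) (by norm_num)
  have p2 : y ^ 5 ≤ (1 + y) ^ 5 := by gcongr; linarith
  have p3 : y ^ 4 ≤ (1 + y) ^ 5 := by
    calc y ^ 4 ≤ (1 + y) ^ 4 := by gcongr; linarith
      _ ≤ (1 + y) ^ 5 := pow_le_pow_right₀ (by linarith) (by norm_num)
  have c1 : y ^ 3 * ((m + y ^ 2) / 2) * hs Q / N ≤ (m + 1) * (1 + hs Q) * (1 + y) ^ 5 / N := by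
    gcongr ?_ / _
    have : y ^ 3 * ((m + y ^ 2) / 2) ≤ (m + 1) * (1 + y) ^ 5 := by
      nlinarith [mul_le_mul_of_nonneg_left p1 hm0, pow_pos hy0 3, pow_pos hy0 5,
        pow_pos (by linarith : 0 < 1 + y) 5, mul_nonneg hm0 (pow_pos hy0 3).le]
    calc y ^ 3 * ((m + y ^ 2) / 2) * hs Q ≤ (m + 1) * (1 + y) ^ 5 * (1 + hs Q) := by
          gcongr; linarith
      _ = _ := by ring
  have c2 : m₂ * ‖K - meanStieltjes μ A z * meanTrace μ A z Q‖
      ≤ m₂ * (C * (1 + hs Q) * (1 + y) ^ 5 / N) := by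
    gcongr
    exact h5.trans (by gcongr)
  refine (add_le_add (h1.trans c1) c2).trans (le_of_eq ?_)
  ring

/-- The normalized sum of the squared diagonal entries. -/
noncomputable def diagSquareMean (G : Matrix (Fin N) (Fin N) ℂ) : ℂ :=
  1 / (N : ℂ) * ∑ i, G i i ^ 2

lemma norm_diagSquareMean_le (hN : 1 ≤ N) {G : Matrix (Fin N) (Fin N) ℂ} {c : ℝ} (h : ‖G‖ ≤ c) :
    ‖diagSquareMean G‖ ≤ c ^ 2 := by
  have hNpos : (0 : ℝ) < N := by exact_mod_cast hN
  have hsum : ‖∑ i, G i i ^ 2‖ ≤ N * c ^ 2 := by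
    refine (norm_sum_le _ _).trans ?_
    calc ∑ i, ‖G i i ^ 2‖ ≤ ∑ _i : Fin N, c ^ 2 := by
          refine Finset.sum_le_sum fun i _ => ?_
          rw [norm_pow]
          exact pow_le_pow_left₀ (norm_nonneg _) ((norm_entry_le G i i).trans h) 2
      _ = N * c ^ 2 := by simp
  rw [diagSquareMean, norm_mul, norm_div, norm_one, Complex.norm_natCast, one_div,
    inv_mul_le_iff₀ hNpos]
  exact hsum

lemma boundedMeasurable_diagSquareMean (hN : 1 ≤ N) (hA : A.IsHermitian) (hz : 0 < z.im) :
    BoundedMeasurable (fun x => diagSquareMean (coordResolvent A z x)) := by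
  have bcont : ∀ i, Continuous fun x => coordResolvent A z x i i := fun i =>
    (continuous_coordResolvent hA hz).matrix_elem i i
  have : Continuous fun x => diagSquareMean (coordResolvent A z x) := by
    unfold diagSquareMean
    fun_prop
  exact ⟨this.measurable, _, fun x => norm_diagSquareMean_le hN (norm_coordResolvent_le hA hz x)⟩

lemma integrable_diagSquareMean_sq (hN : 1 ≤ N) (hA : A.IsHermitian) (hz : 0 < z.im) :
    Integrable (fun x => diagSquareMean (coordResolvent A z x) ^ 2) (Measure.pi fun _ => μ) := by
  have := boundedMeasurable_diagSquareMean hN hA hz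
  simp only [sq]
  exact (this.memLp _).integrable_mul (this.memLp _)

/-- The trace of the loop equation, expanded to fourth order. -/
lemma loop_fourth_order (hs' : μ.map (fun x => -x) = μ)
    (hμ : ∀ k : ℕ, Integrable (fun x : ℝ => x ^ k) μ) {m₂ m₄ m₆ κ : ℝ}
    (h₂ : ∫ t : ℝ, t ^ 2 ∂μ = m₂) (h₄ : ∫ t : ℝ, t ^ 4 ∂μ = m₄) (h₆ : ∫ t : ℝ, t ^ 6 ∂μ = m₆)
    (hκ : κ = m₄ - 3 * m₂ ^ 2)
    (hN : 1 ≤ N) (hA : A.IsHermitian) (hz : 0 < z.im) :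
    ‖z * meanStieltjes μ A z - 1 / N * meanTrace μ A z A - 1
      - m₂ * ∫ x, (1 / (N : ℂ) * (coordResolvent A z x).trace) ^ 2 ∂(Measure.pi fun _ => μ)
      - κ / (2 * N) * ∫ x, diagSquareMean (coordResolvent A z x) ^ 2 ∂(Measure.pi fun _ => μ)‖
      ≤ (2 * (m₆ + 5 * m₂ * m₄ + 10 * |κ| * m₂) * z.im⁻¹ ^ 6 + 3 * |κ| * z.im⁻¹ ^ 4) / N ^ 2 := by
  set π := Measure.pi fun _ : Fin N × Fin N => μ with hπ
  set s : ℝ := 1 / Real.sqrt N with hsdef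
  have hs0 : 0 ≤ s := by positivity
  have hs2 : s ^ 2 = 1 / N := one_div_sqrt_sq N
  have hs2c : (s : ℂ) ^ 2 = 1 / N := ofReal_one_div_sqrt_sq N
  have hs4c : (s : ℂ) ^ 4 = 1 / N ^ 2 := by
    rw [show 4 = 2 * 2 from rfl, pow_mul, hs2c, div_pow, one_pow]
  have hNpos : (0 : ℝ) < N := by exact_mod_cast hN
  have hNc : (N : ℂ) ≠ 0 := by exact_mod_cast (by omega : N ≠ 0)
  set y := z.im⁻¹ with hy
  have hy0 : 0 < y := inv_pos.2 hz
  set c := m₆ + 5 * m₂ * m₄ + 10 * |κ| * m₂ with hc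
  have bT : ∀ p j, BoundedMeasurable (mixedTrace A z p 1 0 j) := fun p j =>
    boundedMeasurable_mixedTrace hN hA hz p 1 0 j
  have hl := mean_loop_identity hμ hN hA hz (1 : Matrix (Fin N) (Fin N) ℂ)
  rw [one_mul, meanTrace_one hN, Matrix.trace_one, Fintype.card_fin, ← hπ, ← hsdef] at hl
  set S1 := ∑ p, ∫ x, (x p : ℂ) * mixedTrace A z p 1 0 1 x ∂π with hS1
  set S2 := ∑ p, ∫ x, mixedTrace A z p 1 0 2 x ∂π with hS2
  set S4 := ∑ p, ∫ x, mixedTrace A z p 1 0 4 x ∂π with hS4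
  -- There are `N²` coordinates with remainder `s⁵` each; the outer factor `s/N` brings the total to
  -- `N⁻²`.
  have hbound : ‖S1 - s * m₂ * S2 - s ^ 3 * κ * S4‖ ≤ N ^ 2 * (s ^ 5 * (2 * y ^ 6) * c) := by
    have e : S1 - s * m₂ * S2 - s ^ 3 * κ * S4
        = ∑ p, ((∫ x, (x p : ℂ) * mixedTrace A z p 1 0 1 x ∂π)
          - s * m₂ * (∫ x, mixedTrace A z p 1 0 2 x ∂π)
          - s ^ 3 * κ * (∫ x, mixedTrace A z p 1 0 4 x ∂π)) := by
      rw [Finset.sum_sub_distrib, Finset.sum_sub_distrib, ← Finset.mul_sum, ← Finset.mul_sum]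
    rw [e]
    refine (norm_sum_le _ _).trans ((Finset.sum_le_sum fun p _ =>
      fourth_order_expansion hs' hμ h₂ h₄ h₆ hκ hN hA hz p).trans (le_of_eq ?_))
    rw [Finset.sum_const, Finset.card_univ, Fintype.card_prod, Fintype.card_fin, nsmul_eq_mul]
    push_cast
    ring
  have hS2' : m₂ * ∫ x, (1 / (N : ℂ) * (coordResolvent A z x).trace) ^ 2 ∂π
      = 1 / N * s * (s * m₂ * S2) := by
    have : S2 = ∫ x, (coordResolvent A z x).trace * (1 * coordResolvent A z x).trace ∂π := by
      rw [hS2, ← integral_finsetSum _ fun p _ => (bT p 2).integrable _]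
      simp only [sum_mixedTrace_two]
    have e : 1 / (N : ℂ) * s * (s * m₂ * S2) = m₂ * (1 / N * (s : ℂ) ^ 2 * S2) := by ring
    rw [e, this, hs2c]
    congr 1
    rw [← integral_const_mul]
    congr 1; funext x
    rw [one_mul]; ring
  have iD := integrable_diagSquareMean_sq (μ := μ) hN hA hz
  rw [← hπ] at iD
  set D2 := ∫ x, diagSquareMean (coordResolvent A z x) ^ 2 ∂π with hD2
  -- `S4` enters with prefactor `κ/N³`, so an error of order `N` is affordable.
  have hS4' : ‖S4 - N ^ 2 / 2 * D2‖ ≤ 3 * y ^ 4 * N := by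
    rw [hS4, hD2, ← integral_finsetSum _ fun p _ => (bT p 4).integrable _, ← integral_const_mul,
      ← integral_sub (integrable_finsetSum _ fun p _ => (bT p 4).integrable _) (iD.const_mul _)]
    refine (norm_integral_le_of_norm_le_const (C := 3 * y ^ 4 * N) (.of_forall fun x => ?_)).trans
      (by simp)
    have h := norm_sum_trace_pow_four_sub_le (norm_coordResolvent_le hA hz x)
    have e1 : ∀ p, mixedTrace A z p 1 0 4 x = ((hermBasis p * coordResolvent A z x) ^ 4).trace := by
      intro p; simp [mixedTrace]
    have e2 : (N : ℂ) ^ 2 / 2 * diagSquareMean (coordResolvent A z x) ^ 2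
        = 1 / 2 * (∑ i, coordResolvent A z x i i ^ 2) ^ 2 := by
      unfold diagSquareMean
      field_simp
    simp only [e1, e2]
    exact h
  have key : z * meanStieltjes μ A z - 1 / N * meanTrace μ A z A - 1
      - m₂ * ∫ x, (1 / (N : ℂ) * (coordResolvent A z x).trace) ^ 2 ∂π - κ / (2 * N) * D2
      = 1 / N * s * (S1 - s * m₂ * S2 - s ^ 3 * κ * S4)
        + κ / N ^ 3 * (S4 - N ^ 2 / 2 * D2) := by
    have hl' : z * meanStieltjes μ A z - 1 / N * meanTrace μ A z A - 1 = 1 / N * (s * S1) := by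
      rw [← hl]; field_simp
    have h4 : (1 / N * s * ((s : ℂ) ^ 3 * κ * S4)) = κ / N ^ 3 * S4 := by
      have : (1 / N * s * ((s : ℂ) ^ 3 * κ * S4)) = 1 / N * (s : ℂ) ^ 4 * (κ * S4) := by ring
      rw [this, hs4c]; field_simp
    have h5 : (κ : ℂ) / N ^ 3 * (N ^ 2 / 2 * D2) = κ / (2 * N) * D2 := by field_simp
    rw [hl', hS2']
    linear_combination h4 + h5
  rw [key]
  refine (norm_add_le _ _).trans ?_
  have n1 : ‖1 / N * s * (S1 - s * m₂ * S2 - s ^ 3 * κ * S4)‖ ≤ 2 * c * y ^ 6 / N ^ 2 := by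
    rw [norm_mul, norm_mul, norm_div, norm_one, Complex.norm_natCast, Complex.norm_real,
      Real.norm_of_nonneg hs0]
    calc 1 / N * s * ‖S1 - s * m₂ * S2 - s ^ 3 * κ * S4‖
        ≤ 1 / N * s * (N ^ 2 * (s ^ 5 * (2 * y ^ 6) * c)) := by gcongr
      _ = N * (s ^ 2) ^ 3 * (2 * c * y ^ 6) := by field_simp
      _ = _ := by rw [hs2]; field_simp
  have n2 : ‖(κ : ℂ) / N ^ 3 * (S4 - N ^ 2 / 2 * D2)‖ ≤ 3 * |κ| * y ^ 4 / N ^ 2 := by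
    rw [norm_mul, norm_div, norm_pow, Complex.norm_natCast, Complex.norm_real, Real.norm_eq_abs]
    calc |κ| / N ^ 3 * ‖S4 - N ^ 2 / 2 * D2‖ ≤ |κ| / N ^ 3 * (3 * y ^ 4 * N) := by gcongr
      _ = _ := by field_simp
  refine (add_le_add n1 n2).trans (le_of_eq ?_)
  ring

end LoopEquation

end DeformedWigner

namespace DeformedWigner

open MeasureTheory ProbabilityTheory

/-! ### The Stieltjes transform of the semicircle law. -/

section Semicircle

open Real in
/-- The mean value of `1 / (1 - w e^{iφ})`. -/
lemma circleAverage_inv_one_sub {w : ℂ} (hw : ‖w‖ < 1) :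
    circleAverage (fun ζ : ℂ => (1 - w * ζ)⁻¹) 0 1 = 1 := by
  have hne : ∀ ζ ∈ Metric.closedBall (0 : ℂ) 1, 1 - w * ζ ≠ 0 := by
    intro ζ hζ h
    have h1 : w * ζ = 1 := (sub_eq_zero.1 h).symm
    have h2 : ‖w‖ * ‖ζ‖ = 1 := by rw [← norm_mul, h1, norm_one]
    have h3 : ‖ζ‖ ≤ 1 := by simpa using hζ
    nlinarith [norm_nonneg w, norm_nonneg ζ]
  have hd : DiffContOnCl ℂ (fun ζ : ℂ => (1 - w * ζ)⁻¹) (Metric.ball 0 |1|) := by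
    rw [abs_one]
    refine DifferentiableOn.diffContOnCl fun ζ hζ => ?_
    have : 1 - w * ζ ≠ 0 := hne ζ (Metric.closure_ball_subset_closedBall hζ)
    have hh : DifferentiableAt ℂ (fun ζ : ℂ => 1 - w * ζ) ζ := by fun_prop
    exact (hh.inv this).differentiableWithinAt
  rw [hd.circleAverage]
  simp

lemma circleMap_zero_one_ne_zero (φ : ℝ) : circleMap 0 1 φ ≠ 0 := by simp

lemma circleMap_add_inv (φ : ℝ) : circleMap 0 1 φ + (circleMap 0 1 φ)⁻¹ = 2 * Real.cos φ := by
  rw [circleMap_zero_inv]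
  simp only [circleMap, zero_add, Complex.ofReal_one, one_mul, inv_one, Complex.ofReal_neg]
  rw [Complex.ofReal_cos, Complex.cos]
  ring_nf

lemma integral_inv_one_sub {w : ℂ} (hw : ‖w‖ < 1) :
    ∫ φ in (0 : ℝ)..2 * Real.pi, (1 - w * circleMap 0 1 φ)⁻¹ = 2 * Real.pi := by
  have h := circleAverage_inv_one_sub hw
  rw [Real.circleAverage_def, inv_smul_eq_iff₀ (by positivity)] at h
  rw [h]
  simp

lemma integral_inv_one_sub_inv {w : ℂ} (hw : ‖w‖ < 1) :
    ∫ φ in (0 : ℝ)..2 * Real.pi, (1 - w * (circleMap 0 1 φ)⁻¹)⁻¹ = 2 * Real.pi := by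
  have h := circleAverage_inv_one_sub hw
  rw [← Real.circleAverage_zero_one_congr_inv, Real.circleAverage_def,
    inv_smul_eq_iff₀ (by positivity)] at h
  rw [h]
  simp

variable {σ : ℝ} {z w : ℂ}

/-- The roots of `w² - (z/σ)w + 1` have product one. Neither lies on the unit circle, since then `w
+ w⁻¹ = 2 Re w` would make `z` real; one of them is therefore inside. -/
lemma exists_joukowski (hσ : 0 < σ) (hz : 0 < z.im) :
    ∃ w : ℂ, w ≠ 0 ∧ ‖w‖ < 1 ∧ z = σ * (w + w⁻¹) := by
  have hσc : (σ : ℂ) ≠ 0 := by exact_mod_cast hσ.ne'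
  obtain ⟨d, hd⟩ := IsAlgClosed.exists_pow_nat_eq ((z / σ) ^ 2 - 4) two_pos
  set a := (z / σ + d) / 2 with ha
  set b := (z / σ - d) / 2 with hb
  have hab : a * b = 1 := by rw [ha, hb]; linear_combination (-1 / 4) * hd
  have hsum : a + b = z / σ := by rw [ha, hb]; ring
  have ha0 : a ≠ 0 := left_ne_zero_of_mul_eq_one hab
  have hb0 : b ≠ 0 := right_ne_zero_of_mul_eq_one hab
  have hbi : b = a⁻¹ := eq_inv_of_mul_eq_one_right hab
  have hai : a = b⁻¹ := eq_inv_of_mul_eq_one_left hab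
  have hz1 : z = σ * (a + a⁻¹) := by rw [← hbi, hsum]; field_simp
  have hz2 : z = σ * (b + b⁻¹) := by rw [← hai, add_comm, hsum]; field_simp
  rcases lt_trichotomy ‖a‖ 1 with h | h | h
  · exact ⟨a, ha0, h, hz1⟩
  · exfalso
    have : a⁻¹ = (starRingEnd ℂ) a := by
      rw [Complex.inv_def, Complex.normSq_eq_norm_sq, h]; simp
    rw [this, Complex.add_conj] at hz1
    have := congrArg Complex.im hz1
    rw [← Complex.ofReal_mul, Complex.ofReal_im] at this
    exact hz.ne' this
  · refine ⟨b, hb0, ?_, hz2⟩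
    rw [hbi, norm_inv]
    exact inv_lt_one_of_one_lt₀ h

lemma sub_cos_ne_zero (hz : 0 < z.im) (c : ℝ) : z - (c : ℂ) ≠ 0 := by
  intro h
  have := congrArg Complex.im h
  simp at this
  exact hz.ne' this

lemma continuous_inv_sub_cos (hz : 0 < z.im) :
    Continuous fun φ : ℝ => (z - ((2 * σ * Real.cos φ : ℝ) : ℂ))⁻¹ :=
  Continuous.inv₀ (by fun_prop) fun φ => sub_cos_ne_zero hz _

/-- With `ζ = e^{iφ}` the denominator factors as `(σ/w)(1 - wζ)(1 - w/ζ)`. After partial fractions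
each piece has mean value one. -/
lemma integral_inv_sub_cos (hσ : 0 < σ) (hw0 : w ≠ 0) (hw : ‖w‖ < 1)
    (hzw : z = σ * (w + w⁻¹)) :
    ∫ φ in (0 : ℝ)..2 * Real.pi, (z - ((2 * σ * Real.cos φ : ℝ) : ℂ))⁻¹
      = 2 * Real.pi * w / (σ * (1 - w ^ 2)) := by
  have hσc : (σ : ℂ) ≠ 0 := by exact_mod_cast hσ.ne'
  have hne : ∀ ζ : ℂ, ‖ζ‖ = 1 → 1 - w * ζ ≠ 0 := by
    intro ζ hζ h
    have h2 : ‖w * ζ‖ = 1 := by rw [← sub_eq_zero.1 h, norm_one]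
    rw [norm_mul, hζ, mul_one] at h2
    exact hw.ne h2
  have hw2 : 1 - w ^ 2 ≠ 0 := by
    intro h
    have h2 : ‖w ^ 2‖ = 1 := by rw [← sub_eq_zero.1 h, norm_one]
    rw [norm_pow] at h2
    nlinarith [norm_nonneg w]
  have hn1 : ∀ φ : ℝ, ‖circleMap 0 1 φ‖ = 1 := fun φ => by simp
  have hn2 : ∀ φ : ℝ, ‖(circleMap 0 1 φ)⁻¹‖ = 1 := fun φ => by simp
  have c1 : Continuous fun φ : ℝ => (1 - w * circleMap 0 1 φ)⁻¹ :=
    Continuous.inv₀ (by fun_prop) fun φ => hne _ (hn1 φ)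
  have c2 : Continuous fun φ : ℝ => (1 - w * (circleMap 0 1 φ)⁻¹)⁻¹ :=
    Continuous.inv₀ (continuous_const.sub (continuous_const.mul ((continuous_circleMap 0 1).inv₀
      circleMap_zero_one_ne_zero))) fun φ => hne _ (hn2 φ)
  have e : ∀ φ : ℝ, (z - ((2 * σ * Real.cos φ : ℝ) : ℂ))⁻¹ = w / (σ * (1 - w ^ 2)) *
      ((1 - w * circleMap 0 1 φ)⁻¹ + (1 - w * (circleMap 0 1 φ)⁻¹)⁻¹ - 1) := by
    intro φ
    have hc := circleMap_add_inv φ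
    have h1 := hne _ (hn1 φ)
    have h2 := hne _ (hn2 φ)
    have h0 := circleMap_zero_one_ne_zero φ
    have hD : z - ((2 * σ * Real.cos φ : ℝ) : ℂ)
        = σ / w * ((1 - w * circleMap 0 1 φ) * (1 - w * (circleMap 0 1 φ)⁻¹)) := by
      have hc' : ((2 * σ * Real.cos φ : ℝ) : ℂ)
          = σ * (circleMap 0 1 φ + (circleMap 0 1 φ)⁻¹) := by
        rw [hc, Complex.ofReal_mul, Complex.ofReal_mul, Complex.ofReal_ofNat]; ring
      rw [hc', hzw]
      field_simp
      ring
    have hS : (1 - w * circleMap 0 1 φ)⁻¹ + (1 - w * (circleMap 0 1 φ)⁻¹)⁻¹ - 1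
        = (1 - w ^ 2) / ((1 - w * circleMap 0 1 φ) * (1 - w * (circleMap 0 1 φ)⁻¹)) := by
      have h3 : circleMap 0 1 φ * (circleMap 0 1 φ)⁻¹ = 1 := mul_inv_cancel₀ h0
      generalize (circleMap 0 1 φ)⁻¹ = e' at *
      generalize circleMap 0 1 φ = e at *
      field_simp
      linear_combination (-w ^ 2) * h3
    rw [hD, hS]
    field_simp
  simp_rw [e]
  have i1 := c1.intervalIntegrable (μ := volume) 0 (2 * Real.pi)
  have i2 := c2.intervalIntegrable (μ := volume) 0 (2 * Real.pi)
  rw [intervalIntegral.integral_const_mul, intervalIntegral.integral_sub (i1.add i2) (by simp),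
    intervalIntegral.integral_add i1 i2, integral_inv_one_sub hw, integral_inv_one_sub_inv hw]
  simp
  ring

/-- Dividing `4σ² - (2σ cos φ)²` by `z - 2σ cos φ` leaves the remainder `4σ² - z²`, which reduces
the integral to the preceding one. -/
lemma integral_sin_sq_div (hσ : 0 < σ) (hz : 0 < z.im) (hw0 : w ≠ 0) (hw : ‖w‖ < 1)
    (hzw : z = σ * (w + w⁻¹)) :
    ∫ φ in (0 : ℝ)..2 * Real.pi, ((4 * σ ^ 2 * Real.sin φ ^ 2 : ℝ) : ℂ) *
      (z - ((2 * σ * Real.cos φ : ℝ) : ℂ))⁻¹ = 4 * Real.pi * σ * w := by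
  have hσc : (σ : ℂ) ≠ 0 := by exact_mod_cast hσ.ne'
  have hw2 : 1 - w ^ 2 ≠ 0 := by
    intro h
    have h2 : ‖w ^ 2‖ = 1 := by rw [← sub_eq_zero.1 h, norm_one]
    rw [norm_pow] at h2
    nlinarith [norm_nonneg w]
  have e : ∀ φ : ℝ, ((4 * σ ^ 2 * Real.sin φ ^ 2 : ℝ) : ℂ) *
      (z - ((2 * σ * Real.cos φ : ℝ) : ℂ))⁻¹
      = (4 * σ ^ 2 - z ^ 2) * (z - ((2 * σ * Real.cos φ : ℝ) : ℂ))⁻¹ + z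
        + 2 * σ * (Real.cos φ : ℂ) := by
    intro φ
    have h0 := sub_cos_ne_zero hz (2 * σ * Real.cos φ)
    have hsc : (Real.sin φ : ℂ) ^ 2 = 1 - (Real.cos φ : ℂ) ^ 2 := by
      exact_mod_cast Real.sin_sq φ
    push_cast [-Complex.ofReal_cos, -Complex.ofReal_sin] at h0 ⊢
    rw [hsc]
    linear_combination (z + 2 * σ * (Real.cos φ : ℂ)) * mul_inv_cancel₀ h0
  simp_rw [e]
  have i1 := (continuous_inv_sub_cos (σ := σ) hz).intervalIntegrable (μ := volume) 0 (2 * Real.pi)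
  have i2 : IntervalIntegrable (fun _ : ℝ => z) volume 0 (2 * Real.pi) := by simp
  have i3 : IntervalIntegrable (fun φ : ℝ => 2 * σ * (Real.cos φ : ℂ)) volume 0 (2 * Real.pi) :=
    Continuous.intervalIntegrable (by fun_prop) _ _
  have hcos : ∫ φ in (0 : ℝ)..2 * Real.pi, (Real.cos φ : ℂ) = 0 := by
    rw [intervalIntegral.integral_ofReal]
    simp
  rw [intervalIntegral.integral_add ((i1.const_mul _).add i2) i3,
    intervalIntegral.integral_add (i1.const_mul _) i2, intervalIntegral.integral_const_mul,
    intervalIntegral.integral_const_mul, hcos, integral_inv_sub_cos hσ hw0 hw hzw,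
    intervalIntegral.integral_const, hzw]
  rw [Complex.real_smul]
  push_cast
  field_simp
  ring

lemma integral_half_circle (hz : 0 < z.im) :
    ∫ φ in (0 : ℝ)..2 * Real.pi, ((4 * σ ^ 2 * Real.sin φ ^ 2 : ℝ) : ℂ) *
      (z - ((2 * σ * Real.cos φ : ℝ) : ℂ))⁻¹ = 2 * ∫ φ in (0 : ℝ)..Real.pi,
      ((4 * σ ^ 2 * Real.sin φ ^ 2 : ℝ) : ℂ) * (z - ((2 * σ * Real.cos φ : ℝ) : ℂ))⁻¹ := by
  set f : ℝ → ℂ := fun φ => ((4 * σ ^ 2 * Real.sin φ ^ 2 : ℝ) : ℂ) *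
      (z - ((2 * σ * Real.cos φ : ℝ) : ℂ))⁻¹ with hf
  have hc : Continuous f := Continuous.mul (by fun_prop) (continuous_inv_sub_cos hz)
  have h1 : ∫ φ in Real.pi..2 * Real.pi, f φ = ∫ φ in (0 : ℝ)..Real.pi, f φ := by
    have := intervalIntegral.integral_comp_sub_left f (a := 0) (b := Real.pi) (2 * Real.pi)
    rw [sub_zero, show 2 * Real.pi - Real.pi = Real.pi by ring] at this
    rw [← this]
    congr 1; funext φ
    simp only [hf, Real.cos_two_pi_sub, Real.sin_two_pi_sub, neg_sq]
  rw [← intervalIntegral.integral_add_adjacent_intervals (hc.intervalIntegrable 0 Real.pi)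
    (hc.intervalIntegrable Real.pi (2 * Real.pi)), h1]
  ring

/-- Substitution `x = 2σ cos φ`, which turns the square root into `2σ sin φ` on `[0, π]`. -/
lemma gSemicircle_eq_integral (hσ : 0 < σ) (hz : 0 < z.im) :
    gSemicircle σ z = ((1 / (2 * Real.pi * σ ^ 2) : ℝ) : ℂ) * ∫ φ in (0 : ℝ)..Real.pi,
      ((4 * σ ^ 2 * Real.sin φ ^ 2 : ℝ) : ℂ) * (z - ((2 * σ * Real.cos φ : ℝ) : ℂ))⁻¹ := by
  set ρ : ℝ → ℝ := fun x => 1 / (2 * Real.pi * σ ^ 2) * Real.sqrt (4 * σ ^ 2 - x ^ 2) with hρ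
  have hρc : Continuous ρ := by fun_prop
  have hρ0 : ∀ x, 0 ≤ ρ x := fun x => by positivity
  set I := Set.Icc (-2 * σ) (2 * σ) with hI
  have hIm : MeasurableSet I := measurableSet_Icc
  have hle : -2 * σ ≤ 2 * σ := by linarith
  have h1 : gSemicircle σ z = ∫ x in (-2 * σ)..(2 * σ), (ρ x : ℂ) * (z - (x : ℂ))⁻¹ := by
    rw [gSemicircle, semicircleLaw, integral_withDensity_eq_integral_toReal_smul
      ((hρc.measurable.indicator hIm).ennreal_ofReal) (by simp)]
    rw [intervalIntegral.integral_of_le hle, ← integral_Icc_eq_integral_Ioc,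
      ← integral_indicator hIm]
    congr 1; funext x
    by_cases hx : x ∈ I
    · rw [Set.indicator_of_mem hx, Set.indicator_of_mem hx, ENNReal.toReal_ofReal (hρ0 x),
        Complex.real_smul]
    · rw [Set.indicator_of_notMem hx, Set.indicator_of_notMem hx]
      simp
  have hgc : Continuous fun x : ℝ => (ρ x : ℂ) * (z - (x : ℂ))⁻¹ :=
    Continuous.mul (by fun_prop) (Continuous.inv₀ (by fun_prop) fun x => sub_cos_ne_zero hz x)
  have h2 := intervalIntegral.integral_deriv_smul_comp (a := 0) (b := Real.pi)
    (f := fun φ : ℝ => 2 * σ * Real.cos φ) (f' := fun φ => 2 * σ * (-Real.sin φ))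
    (g := fun x : ℝ => (ρ x : ℂ) * (z - (x : ℂ))⁻¹)
    (fun φ _ => (Real.hasDerivAt_cos φ).const_mul (2 * σ)) (by fun_prop) hgc
  rw [h1, intervalIntegral.integral_symm]
  simp only [Real.cos_zero, Real.cos_pi, mul_one] at h2
  have e : 2 * σ * -1 = -2 * σ := by ring
  rw [e] at h2
  rw [← h2, ← intervalIntegral.integral_neg, ← intervalIntegral.integral_const_mul]
  refine intervalIntegral.integral_congr fun φ hφ => ?_
  rw [Set.uIcc_of_le Real.pi_pos.le] at hφ
  have hsin : 0 ≤ Real.sin φ := Real.sin_nonneg_of_mem_Icc hφ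
  have hsq : Real.sqrt (4 * σ ^ 2 - (2 * σ * Real.cos φ) ^ 2) = 2 * σ * Real.sin φ := by
    rw [show 4 * σ ^ 2 - (2 * σ * Real.cos φ) ^ 2 = (2 * σ * Real.sin φ) ^ 2 by
      rw [mul_pow, mul_pow (2 * σ) (Real.sin φ), Real.sin_sq]; ring]
    exact Real.sqrt_sq (by positivity)
  simp only [Function.comp, hρ, hsq, Complex.real_smul]
  push_cast
  ring

/-- The semicircle Stieltjes transform is the root of `σ² g² - z g + 1` in the lower half plane. -/
lemma gSemicircle_spec (hσ : 0 < σ) (hz : 0 < z.im) :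
    (σ : ℂ) ^ 2 * gSemicircle σ z ^ 2 - z * gSemicircle σ z + 1 = 0 ∧ (gSemicircle σ z).im < 0 := by
  obtain ⟨w, hw0, hw, hzw⟩ := exists_joukowski hσ hz
  have hσc : (σ : ℂ) ≠ 0 := by exact_mod_cast hσ.ne'
  have hpi : (Real.pi : ℂ) ≠ 0 := by exact_mod_cast Real.pi_ne_zero
  have hg : gSemicircle σ z = w / σ := by
    have h1 := integral_half_circle (σ := σ) hz
    rw [integral_sin_sq_div hσ hz hw0 hw hzw] at h1
    rw [gSemicircle_eq_integral hσ hz]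
    generalize (∫ φ in (0 : ℝ)..Real.pi, ((4 * σ ^ 2 * Real.sin φ ^ 2 : ℝ) : ℂ) *
      (z - ((2 * σ * Real.cos φ : ℝ) : ℂ))⁻¹) = J at *
    have hJ : J = 2 * Real.pi * σ * w := by linear_combination (-1 / 2) * h1
    rw [hJ]
    push_cast
    field_simp
  constructor
  · rw [hg, hzw]
    field_simp
    ring
  · rw [hg, Complex.div_ofReal_im]
    refine div_neg_of_neg_of_pos ?_ hσ
    have h1 := congrArg Complex.im hzw
    rw [Complex.im_ofReal_mul, Complex.add_im, Complex.inv_im] at h1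
    have hn : 0 < Complex.normSq w := Complex.normSq_pos.2 hw0
    have hn1 : Complex.normSq w < 1 := by
      rw [Complex.normSq_eq_norm_sq]; nlinarith [norm_nonneg w]
    -- `Im(w + w⁻¹) = Im w (1 - 1/|w|²)`, and the bracket is negative for `|w| < 1`; so `Im z > 0`
    -- forces `Im w < 0`.
    by_contra hneg
    push Not at hneg
    have : w.im ≤ w.im / Complex.normSq w := by
      rw [le_div_iff₀ hn]; nlinarith
    have : σ * (w.im + -w.im / Complex.normSq w) ≤ 0 := by
      rw [neg_div]
      nlinarith
    linarith

end Semicircle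

end DeformedWigner

namespace DeformedWigner

open MeasureTheory ProbabilityTheory
open scoped Matrix.Norms.L2Operator Matrix

/-! ### Reduction to the product space. -/

section Pushforward

/-- A Hermitian `W` is recovered from its coordinates, whose joint law is the product of copies of
`μ`; the space `Ω` plays no further role. -/
lemma gN_eq_meanStieltjes {Ω : Type*} [MeasurableSpace Ω] {P : Measure Ω} [IsProbabilityMeasure P]
    {μ : Measure ℝ} [IsProbabilityMeasure μ] {N : ℕ} {W : Ω → Matrix (Fin N) (Fin N) ℂ}
    {A : Matrix (Fin N) (Fin N) ℂ} {z : ℂ} (hW : IsHermitianWigner P μ W) (hA : A.IsHermitian)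
    (hz : 0 < z.im) : gN P W A z = meanStieltjes μ A z := by
  have hm : ∀ p, AEMeasurable (fun ω => hermitianCoord (W ω) p) P := fun p =>
    (hW.hasLaw p).aemeasurable
  have hmap : P.map (fun ω p => hermitianCoord (W ω) p) = Measure.pi fun _ => μ := by
    have h := (iIndepFun_iff_map_fun_eq_pi_map hm).1 hW.indep
    rw [h]
    congr 1; funext p
    exact (hW.hasLaw p).map_eq
  rw [meanStieltjes, ← hmap, integral_map (aemeasurable_pi_lambda _ hm)]
  · rw [gN]
    congr 1; funext ω
    rw [coordResolvent, hermOfCoord_hermitianCoord (hW.isHermitian ω)]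
  · exact (continuous_const.mul (continuous_coordResolvent hA hz).matrix_trace).aestronglyMeasurable

end Pushforward

/-! ### Spectral projections of the deformation. -/

section SpectralProjections

variable {J N : ℕ} {θ : Fin J → ℝ} {j₀ : Fin J} {k : Fin J → ℕ} {A : Matrix (Fin N) (Fin N) ℂ}

/-- The spectral projections of a finite rank deformation. -/
lemma exists_spectral_projections (hθ : StrictAnti θ) (hj₀ : θ j₀ = 0)
    (hA : IsFiniteRankDeformation θ j₀ k A) :
    ∃ Q : Fin J → Matrix (Fin N) (Fin N) ℂ,
      (∀ j, Q j * Q j = Q j) ∧ (∀ j, Q j * A = (θ j : ℂ) • Q j) ∧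
      A = ∑ j ∈ Finset.univ.erase j₀, (θ j : ℂ) • Q j ∧
      (∀ j, j ≠ j₀ → (Q j).trace = k j) ∧ (∀ j, j ≠ j₀ → hs (Q j) = k j) := by
  obtain ⟨hH, c, -, hcard, S, hS⟩ := hA
  set E : Fin J → Matrix (Fin N) (Fin N) ℂ := fun j =>
    Matrix.diagonal fun i => if c i = j then 1 else 0 with hE
  set D : Matrix (Fin N) (Fin N) ℂ := Matrix.diagonal fun i => ((θ (c i) : ℝ) : ℂ) with hD
  have hEE : ∀ j, E j * E j = E j := by
    intro j
    simp only [hE, Matrix.diagonal_mul_diagonal]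
    congr 1; funext i; split_ifs <;> simp
  have hED : ∀ j, E j * D = (θ j : ℂ) • E j := by
    intro j
    rw [hE, hD, Matrix.diagonal_mul_diagonal, ← Matrix.diagonal_smul]
    congr 1; funext i
    by_cases h : c i = j <;> simp [h]
  have hDE : ∀ j, D * E j = (θ j : ℂ) • E j := by
    intro j
    rw [← hED, hE, hD, Matrix.diagonal_mul_diagonal, Matrix.diagonal_mul_diagonal]
    congr 1; funext i; ring
  have hE1 : ∑ j, E j = 1 := by
    ext a b
    rw [Matrix.sum_apply]
    by_cases h : a = b
    · subst h; simp [hE]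
    · simp [hE, h]
  set Q : Fin J → Matrix (Fin N) (Fin N) ℂ := fun j => S.val * E j * S⁻¹.val with hQ
  have hSS : ∀ B C : Matrix (Fin N) (Fin N) ℂ,
      S.val * B * S⁻¹.val * (S.val * C * S⁻¹.val) = S.val * (B * C) * S⁻¹.val := by
    intro B C
    calc S.val * B * S⁻¹.val * (S.val * C * S⁻¹.val)
        = S.val * B * (S⁻¹.val * S.val) * C * S⁻¹.val := by simp only [mul_assoc]
      _ = _ := by rw [Units.inv_mul, mul_one, mul_assoc S.val]
  have hQQ : ∀ j, Q j * Q j = Q j := fun j => by simp only [hQ, hSS, hEE]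
  have hQA : ∀ j, Q j * A = (θ j : ℂ) • Q j := fun j => by
    rw [hS]; simp only [hQ, hSS, hED, Matrix.mul_smul, Matrix.smul_mul]
  have hAQ : ∀ j, A * Q j = (θ j : ℂ) • Q j := fun j => by
    rw [hS]; simp only [hQ, hSS, hDE, Matrix.mul_smul, Matrix.smul_mul]
  have hQ1 : ∑ j, Q j = 1 := by
    simp only [hQ]
    rw [← Finset.sum_mul, ← Finset.mul_sum, hE1, mul_one, Units.mul_inv]
  have hAsum : A = ∑ j ∈ Finset.univ.erase j₀, (θ j : ℂ) • Q j := by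
    have : A = ∑ j, (θ j : ℂ) • Q j := by
      simp only [← hQA]
      rw [← Finset.sum_mul, hQ1, one_mul]
    rw [← Finset.add_sum_erase _ _ (Finset.mem_univ j₀), hj₀] at this
    simpa using this
  -- The similarity is not assumed unitary, so orthogonality is recovered from `A` being Hermitian
  -- with distinct `θ_j`.
  have horth : ∀ i j, i ≠ j → (Q i)ᴴ * Q j = 0 := by
    intro i j hij
    have h1 : (Q i)ᴴ * A = (θ i : ℂ) • (Q i)ᴴ := by
      have := congrArg Matrix.conjTranspose (hAQ i)
      rw [Matrix.conjTranspose_mul, hH.eq, Matrix.conjTranspose_smul, Complex.star_def,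
        Complex.conj_ofReal] at this
      exact this
    have h2 : (θ i : ℂ) • ((Q i)ᴴ * Q j) = (θ j : ℂ) • ((Q i)ᴴ * Q j) := by
      rw [← Matrix.smul_mul, ← h1, mul_assoc, hAQ, Matrix.mul_smul]
    rw [← sub_eq_zero, ← sub_smul, smul_eq_zero] at h2
    rcases h2 with h | h
    · exfalso
      have : θ i = θ j := by exact_mod_cast sub_eq_zero.1 h
      exact hij (hθ.injective this)
    · exact h
  -- The `Q_j` sum to one, so orthogonality makes them orthogonal projections; hence `hs (Q j)`
  -- equals the trace.
  have hQH : ∀ j, (Q j)ᴴ * Q j = Q j := by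
    intro j
    have h1 : (∑ i, Q i)ᴴ * Q j = Q j := by rw [hQ1, Matrix.conjTranspose_one, one_mul]
    rw [Matrix.conjTranspose_sum, Finset.sum_mul, Finset.sum_eq_single j] at h1
    · exact h1
    · intro i _ hij; exact horth i j hij
    · simp
  have htr : ∀ j, j ≠ j₀ → (Q j).trace = k j := by
    intro j hj
    simp only [hQ]
    rw [Matrix.trace_mul_comm, ← mul_assoc, Units.inv_mul, one_mul, ← hcard j hj]
    simp [hE, Matrix.trace]
  refine ⟨Q, hQQ, hQA, hAsum, htr, fun j hj => ?_⟩
  have : (hs (Q j) : ℂ) = k j := by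
    rw [← trace_conjTranspose_mul_self_eq_hs, hQH, htr j hj]
  exact_mod_cast this

/-- This makes `hs A` independent of `N`, which the diagonal estimate relies on. -/
lemma hs_eq_of_projections {Q : Fin J → Matrix (Fin N) (Fin N) ℂ} (hH : A.IsHermitian)
    (hQA : ∀ j, Q j * A = (θ j : ℂ) • Q j)
    (hAsum : A = ∑ j ∈ Finset.univ.erase j₀, (θ j : ℂ) • Q j)
    (htr : ∀ j, j ≠ j₀ → (Q j).trace = k j) :
    hs A = ∑ j ∈ Finset.univ.erase j₀, θ j ^ 2 * k j := by
  have h : (hs A : ℂ) = ((∑ j ∈ Finset.univ.erase j₀, θ j ^ 2 * k j : ℝ) : ℂ) := by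
    rw [← trace_conjTranspose_mul_self_eq_hs, hH.eq]
    nth_rewrite 1 [hAsum]
    rw [Finset.sum_mul, Matrix.trace_sum, Complex.ofReal_sum]
    refine Finset.sum_congr rfl fun j hj => ?_
    rw [Matrix.smul_mul, hQA, Matrix.trace_smul, Matrix.trace_smul,
      htr j (Finset.ne_of_mem_erase hj), smul_eq_mul, smul_eq_mul]
    push_cast
    ring
  exact_mod_cast h

end SpectralProjections

end DeformedWigner

/-! ### Convergence of the mean Stieltjes transform and the finite rank term. -/

namespace DeformedWigner

open MeasureTheory ProbabilityTheory
open scoped Matrix.Norms.L2Operator Matrix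

/-- The properties of the entry distribution used in the estimates: Poincaré inequality, symmetry
and moments. -/
structure EntryLaw (μ : Measure ℝ) (C m₂ m : ℝ) : Prop where
  nonneg : 0 ≤ C
  poincare : ∀ f : ℝ → ℂ, ContDiff ℝ 1 f → MemLp f 2 μ → MemLp (deriv f) 2 μ →
      ∫ x, ‖f x - ∫ y, f y ∂μ‖ ^ 2 ∂μ ≤ C * ∫ x, ‖deriv f x‖ ^ 2 ∂μ
  symm : μ.map (fun x => -x) = μ
  integrable_pow : ∀ k : ℕ, Integrable (fun x : ℝ => x ^ k) μ
  sq_eq : ∫ t : ℝ, t ^ 2 ∂μ = m₂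
  rem_eq : ∫ t : ℝ, (t ^ 4 + 3 * m₂ * t ^ 2) ^ 2 ∂μ = m

lemma EntryLaw.rem_nonneg {μ : Measure ℝ} {C m₂ m : ℝ} (h : EntryLaw μ C m₂ m) : 0 ≤ m := by
  rw [← h.rem_eq]; exact integral_nonneg fun t => by positivity

/-- Comparing powers of `1 + y`. -/
lemma pow_le_one_add_pow {y : ℝ} (hy : 0 ≤ y) {i j : ℕ} (hij : i ≤ j) : y ^ i ≤ (1 + y) ^ j :=
  (pow_le_pow_left₀ hy (by linarith) i).trans (pow_le_pow_right₀ (by linarith) hij)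

/-- Subtracting `a` only increases the imaginary part. All denominators below have this shape,
because Stieltjes transforms have non-positive imaginary part and the `θ_j` are real. -/
lemma inv_norm_sub_le {z a : ℂ} (hz : 0 < z.im) (ha : a.im ≤ 0) : ‖(z - a)⁻¹‖ ≤ z.im⁻¹ := by
  rw [norm_inv]
  refine inv_anti₀ hz ?_
  have : z.im ≤ (z - a).im := by rw [Complex.sub_im]; linarith
  exact this.trans (Complex.im_le_norm _)

lemma sub_ne_zero_of_im {z a : ℂ} (hz : 0 < z.im) (ha : a.im ≤ 0) : z - a ≠ 0 := by
  intro h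
  have := congrArg Complex.im h
  rw [Complex.sub_im, Complex.zero_im] at this
  linarith

section WeakLaw

variable {N : ℕ} {A : Matrix (Fin N) (Fin N) ℂ} {z : ℂ} {μ : Measure ℝ} [IsProbabilityMeasure μ]
  {C m : ℝ} {σ : ℝ}

lemma im_meanStieltjes_nonpos (hA : A.IsHermitian) (hz : 0 < z.im) :
    (meanStieltjes μ A z).im ≤ 0 := by
  have hi := (boundedMeasurable_normalizedTrace (N := N) hA hz).integrable
    (Measure.pi fun _ : Fin N × Fin N => μ)
  have := integral_im hi
  simp only [RCLike.im_to_complex] at this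
  rw [meanStieltjes, ← this]
  refine integral_nonpos fun x => ?_
  have h := im_trace_resolvent
    (deformedMatrix_isHermitian (hermOfCoord_isHermitian x) hA) hz
  rw [← coordResolvent] at h
  have e : (1 / (N : ℂ)) = ((1 / N : ℝ) : ℂ) := by push_cast; rfl
  simp only [Pi.zero_apply]
  rw [e, Complex.im_ofReal_mul, h]
  have h1 := hs_nonneg (coordResolvent A z x)
  have h2 : 0 ≤ (1 / N : ℝ) := by positivity
  have h3 : 0 ≤ (1 / N : ℝ) * (z.im * hs (coordResolvent A z x)) := by positivity
  linarith

lemma im_smul_nonpos {g : ℂ} (hg : g.im ≤ 0) : ((σ : ℂ) ^ 2 * g).im ≤ 0 := by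
  rw [← Complex.ofReal_pow, Complex.im_ofReal_mul]
  nlinarith [sq_nonneg σ]

/-- `Tr(QG) = Tr(QGQ)`, so Cauchy–Schwarz gives a bound by `hs Q` with no factor `N`. -/
lemma norm_meanTrace_idempotent_le (hA : A.IsHermitian) (hz : 0 < z.im)
    {Q : Matrix (Fin N) (Fin N) ℂ} (hQ : Q * Q = Q) :
    ‖meanTrace μ A z Q‖ ≤ hs Q * z.im⁻¹ := by
  rw [meanTrace]
  refine (norm_integral_le_of_norm_le_const (C := hs Q * z.im⁻¹) (.of_forall fun x => ?_)).trans
    (by simp)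
  have h := mul_norm_trace_le (U := Q) (V := Q) (q := 1) (norm_coordResolvent_le hA hz x)
  have e : (Q * coordResolvent A z x * Q).trace = (Q * coordResolvent A z x).trace := by
    rw [Matrix.trace_mul_comm, ← mul_assoc, hQ]
  rw [e] at h
  linarith

variable {J : ℕ} {θ : Fin J → ℝ} {j₀ : Fin J} {k : Fin J → ℕ} {Q : Fin J → Matrix (Fin N) (Fin N) ℂ}

lemma meanTrace_sum (hA : A.IsHermitian) (hz : 0 < z.im) (s : Finset (Fin J))
    (B : Fin J → Matrix (Fin N) (Fin N) ℂ) (c : Fin J → ℂ) :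
    meanTrace μ A z (∑ j ∈ s, c j • B j) = ∑ j ∈ s, c j * meanTrace μ A z (B j) := by
  simp only [meanTrace, Finset.sum_mul, Matrix.trace_sum, Matrix.smul_mul, Matrix.trace_smul,
    smul_eq_mul]
  rw [integral_finsetSum _ fun j _ => (integrable_trace_mul hA hz (B j)).const_mul _]
  simp only [integral_const_mul]

lemma norm_meanTrace_deformation_le (hA : A.IsHermitian) (hz : 0 < z.im)
    (hQQ : ∀ j, Q j * Q j = Q j) (hAsum : A = ∑ j ∈ Finset.univ.erase j₀, (θ j : ℂ) • Q j)
    (hhs : ∀ j, j ≠ j₀ → hs (Q j) = k j) :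
    ‖meanTrace μ A z A‖ ≤ (∑ j ∈ Finset.univ.erase j₀, |θ j| * k j) * z.im⁻¹ := by
  have h := meanTrace_sum (μ := μ) hA hz (Finset.univ.erase j₀) Q (fun j => (θ j : ℂ))
  rw [← hAsum] at h
  rw [h, Finset.sum_mul]
  refine (norm_sum_le _ _).trans (Finset.sum_le_sum fun j hj => ?_)
  rw [norm_mul, Complex.norm_real, Real.norm_eq_abs, mul_assoc,
    ← hhs j (Finset.ne_of_mem_erase hj)]
  gcongr
  exact norm_meanTrace_idempotent_le hA hz (hQQ j)

/-- The mean Stieltjes transform almost solves the semicircle equation. -/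
lemma norm_quadratic_le (hL : EntryLaw μ C (σ ^ 2) m) (hN : 1 ≤ N) (hA : A.IsHermitian)
    (hz : 0 < z.im) {a₁ : ℝ} (ha₁ : ‖meanTrace μ A z A‖ ≤ a₁ * z.im⁻¹) (ha₀ : 0 ≤ a₁) :
    ‖(σ : ℂ) ^ 2 * meanStieltjes μ A z ^ 2 - z * meanStieltjes μ A z + 1‖
      ≤ (2 * (m + 1 + σ ^ 2 * C) + a₁) * (1 + z.im⁻¹) ^ 5 / N := by
  have hNpos : (1 : ℝ) ≤ N := by exact_mod_cast hN
  have hNc : (N : ℂ) ≠ 0 := by exact_mod_cast (by omega : N ≠ 0)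
  have hy0 : 0 < z.im⁻¹ := inv_pos.2 hz
  -- The idempotent is the identity. Its `hs` equals `N`, so the error is `O(1)` and becomes
  -- `O(1/N)` after normalizing the trace.
  have h := loop_equation_idempotent hL.nonneg hL.poincare hL.symm hL.integrable_pow hL.sq_eq
    hL.rem_eq hN hA hz (mul_one (1 : Matrix (Fin N) (Fin N) ℂ))
  rw [one_mul, Matrix.trace_one, Fintype.card_fin, hs_one, Fintype.card_fin, meanTrace_one hN] at h
  set γ := meanStieltjes μ A z
  set y := z.im⁻¹
  set C₁ := m + 1 + σ ^ 2 * C with hC₁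
  have hC₁0 : 0 ≤ C₁ := by
    have := hL.rem_nonneg
    have := hL.nonneg
    positivity
  have e : (σ : ℂ) ^ 2 * γ ^ 2 - z * γ + 1 = -(1 / N * ((z - ((σ ^ 2 : ℝ) : ℂ) * γ) * (N * γ)
      - meanTrace μ A z A - N)) - 1 / N * meanTrace μ A z A := by
    push_cast
    field_simp
    ring
  rw [e]
  refine (norm_sub_le _ _).trans ?_
  rw [norm_neg, norm_mul, norm_mul, norm_div, norm_one, Complex.norm_natCast]
  have p1 : y ≤ (1 + y) ^ 5 := by simpa using pow_le_one_add_pow hy0.le (i := 1) (j := 5) (by norm_num)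
  calc _ ≤ 1 / (N : ℝ) * (C₁ * (1 + N) * (1 + y) ^ 5 / N) + 1 / N * (a₁ * y) := by gcongr
    _ ≤ 1 / (N : ℝ) * (C₁ * (N + N) * (1 + y) ^ 5 / N) + 1 / N * (a₁ * (1 + y) ^ 5) := by
        gcongr
    _ = _ := by field_simp; ring

lemma norm_gSemicircle_le (hσ : 0 < σ) (hz : 0 < z.im) :
    gSemicircle σ z = (z - (σ : ℂ) ^ 2 * gSemicircle σ z)⁻¹ ∧ ‖gSemicircle σ z‖ ≤ z.im⁻¹ := by
  obtain ⟨h1, h2⟩ := gSemicircle_spec hσ hz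
  have h3 := im_smul_nonpos (σ := σ) h2.le
  have h4 := sub_ne_zero_of_im hz h3
  have h5 : gSemicircle σ z = (z - (σ : ℂ) ^ 2 * gSemicircle σ z)⁻¹ := by
    refine eq_inv_of_mul_eq_one_left ?_
    linear_combination -h1
  refine ⟨h5, ?_⟩
  rw [h5]
  exact inv_norm_sub_le hz h3

/-- Stability of the semicircle equation. -/
lemma norm_sub_gSemicircle_le (hσ : 0 < σ) (hz : 0 < z.im) {γ : ℂ} (hγ : γ.im ≤ 0) :
    ‖γ - gSemicircle σ z‖ ≤ z.im⁻¹ * ‖(σ : ℂ) ^ 2 * γ ^ 2 - z * γ + 1‖ := by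
  obtain ⟨h1, h2⟩ := gSemicircle_spec hσ hz
  set g := gSemicircle σ z
  have h3 : ((σ : ℂ) ^ 2 * (γ + g)).im ≤ 0 :=
    im_smul_nonpos (by rw [Complex.add_im]; linarith)
  have h4 := sub_ne_zero_of_im hz h3
  -- The difference of the two quadratic expressions factors as `(γ - g)(σ²(γ + g) - z)`.
  have e : γ - g = -((z - (σ : ℂ) ^ 2 * (γ + g))⁻¹ * ((σ : ℂ) ^ 2 * γ ^ 2 - z * γ + 1)) := by
    rw [← mul_right_inj' h4, mul_neg, mul_inv_cancel_left₀ h4]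
    linear_combination h1
  rw [e, norm_neg, norm_mul]
  gcongr
  exact inv_norm_sub_le hz h3

lemma inv_sub_inv_bound {a b : ℂ} {y : ℝ} (ha : ‖a⁻¹‖ ≤ y) (hb : ‖b⁻¹‖ ≤ y) (ha0 : a ≠ 0)
    (hb0 : b ≠ 0) : ‖a⁻¹ - b⁻¹‖ ≤ y ^ 2 * ‖b - a‖ := by
  have hy : 0 ≤ y := (norm_nonneg _).trans ha
  rw [inv_sub_inv ha0 hb0, div_eq_mul_inv, mul_inv, norm_mul, norm_mul, mul_comm, sq]
  gcongr

/-- The finite rank contribution. -/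
lemma norm_meanTrace_deformation_sub_le (hL : EntryLaw μ C (σ ^ 2) m) (hN : 1 ≤ N)
    (hA : A.IsHermitian) (hσ : 0 < σ) (hz : 0 < z.im)
    (hQQ : ∀ j, Q j * Q j = Q j) (hQA : ∀ j, Q j * A = (θ j : ℂ) • Q j)
    (hAsum : A = ∑ j ∈ Finset.univ.erase j₀, (θ j : ℂ) • Q j)
    (htr : ∀ j, j ≠ j₀ → (Q j).trace = k j) (hhs : ∀ j, j ≠ j₀ → hs (Q j) = k j) {C₂ : ℝ}
    (hg : ‖meanStieltjes μ A z - gSemicircle σ z‖ ≤ C₂ * (1 + z.im⁻¹) ^ 6 / N) :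
    ‖meanTrace μ A z A - ∑ j ∈ Finset.univ.erase j₀,
        (k j : ℂ) * ((θ j : ℂ) / (z - (σ : ℂ) ^ 2 * gSemicircle σ z - (θ j : ℂ)))‖
      ≤ (∑ j ∈ Finset.univ.erase j₀, |θ j| * ((m + 1 + σ ^ 2 * C) * (1 + k j) + k j * (σ ^ 2 * C₂)))
        * (1 + z.im⁻¹) ^ 8 / N := by
  have hNpos : (1 : ℝ) ≤ N := by exact_mod_cast hN
  have hy0 : 0 < z.im⁻¹ := inv_pos.2 hz
  have hγ := im_smul_nonpos (σ := σ) (im_meanStieltjes_nonpos (μ := μ) hA hz)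
  have hgi := im_smul_nonpos (σ := σ) (gSemicircle_spec hσ hz).2.le
  set γ := meanStieltjes μ A z
  set g := gSemicircle σ z
  set y := z.im⁻¹
  have h := meanTrace_sum (μ := μ) hA hz (Finset.univ.erase j₀) Q (fun j => (θ j : ℂ))
  rw [← hAsum] at h
  rw [h, ← Finset.sum_sub_distrib, Finset.sum_mul, Finset.sum_div]
  refine (norm_sum_le _ _).trans (Finset.sum_le_sum fun j hj => ?_)
  have hj' := Finset.ne_of_mem_erase hj
  have hloop := loop_equation_idempotent hL.nonneg hL.poincare hL.symm hL.integrable_pow hL.sq_eq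
    hL.rem_eq hN hA hz (hQQ j)
  rw [htr j hj', hhs j hj'] at hloop
  have hTQA : meanTrace μ A z (Q j * A) = θ j * meanTrace μ A z (Q j) := by
    rw [hQA]
    simp only [meanTrace, Matrix.smul_mul, Matrix.trace_smul, smul_eq_mul, integral_const_mul]
  rw [hTQA] at hloop
  set T := meanTrace μ A z (Q j)
  have hγθ : ((σ : ℂ) ^ 2 * γ + θ j).im ≤ 0 := by
    rw [Complex.add_im, Complex.ofReal_im]; linarith
  have hgθ : ((σ : ℂ) ^ 2 * g + θ j).im ≤ 0 := by
    rw [Complex.add_im, Complex.ofReal_im]; linarith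
  have ha := inv_norm_sub_le hz hγθ
  have hb := inv_norm_sub_le hz hgθ
  have ha0 := sub_ne_zero_of_im hz hγθ
  have hb0 := sub_ne_zero_of_im hz hgθ
  set a := z - ((σ : ℂ) ^ 2 * γ + θ j) with hadef
  set b := z - ((σ : ℂ) ^ 2 * g + θ j) with hbdef
  have hab := inv_sub_inv_bound ha hb ha0 hb0
  have hba : ‖b - a‖ ≤ σ ^ 2 * (C₂ * (1 + y) ^ 6 / N) := by
    have : b - a = ((σ ^ 2 : ℝ) : ℂ) * (γ - g) := by rw [hadef, hbdef]; push_cast; ring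
    rw [this, norm_mul, Complex.norm_real, Real.norm_of_nonneg (sq_nonneg σ)]
    gcongr
  set e := (z - ((σ ^ 2 : ℝ) : ℂ) * γ) * T - θ j * T - k j with hedef
  -- `Q_j A = θ_j Q_j` closes the loop equation on `T` alone, so it can be solved for `T`.
  have hTe : T = a⁻¹ * (k j + e) := by
    rw [eq_inv_mul_iff_mul_eq₀ ha0, hedef, hadef]
    push_cast
    ring
  have hdiv : (θ j : ℂ) / (z - (σ : ℂ) ^ 2 * g - θ j) = θ j * b⁻¹ := by
    rw [sub_sub, ← hbdef, div_eq_mul_inv]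
  have key : (θ j : ℂ) * T - k j * ((θ j : ℂ) / (z - (σ : ℂ) ^ 2 * g - θ j))
      = θ j * (a⁻¹ * e + k j * (a⁻¹ - b⁻¹)) := by
    rw [hdiv, hTe]; ring
  rw [key, norm_mul, Complex.norm_real, Real.norm_eq_abs, mul_assoc, mul_div_assoc]
  gcongr
  refine (norm_add_le _ _).trans ?_
  rw [norm_mul, norm_mul, Complex.norm_natCast]
  set C₁ := m + 1 + σ ^ 2 * C with hC₁
  have hC₁0 : 0 ≤ C₁ := by
    have := hL.rem_nonneg
    have := hL.nonneg
    positivity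
  have hC₂ : 0 ≤ C₂ * (1 + y) ^ 6 / N := (norm_nonneg _).trans hg
  have hyY : y ≤ 1 + y := by linarith
  have t1 : ‖a⁻¹‖ * ‖e‖ ≤ C₁ * (1 + k j) * (1 + y) ^ 8 / N := by
    calc ‖a⁻¹‖ * ‖e‖ ≤ (1 + y) * (C₁ * (1 + k j) * (1 + y) ^ 5 / N) := by
          gcongr; exact ha.trans hyY
      _ = C₁ * (1 + k j) * (1 + y) ^ 6 / N := by ring
      _ ≤ _ := by
          gcongr
          · linarith
          · norm_num
  -- The exponent is `8 = 2 + 6`: two inverses, and the bound on `γ - g`.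
  have t2 : (k j : ℝ) * ‖a⁻¹ - b⁻¹‖ ≤ k j * (σ ^ 2 * C₂) * (1 + y) ^ 8 / N := by
    calc (k j : ℝ) * ‖a⁻¹ - b⁻¹‖ ≤ k j * ((1 + y) ^ 2 * (σ ^ 2 * (C₂ * (1 + y) ^ 6 / N))) := by
          gcongr
          refine hab.trans ?_
          gcongr
      _ = _ := by ring
  refine (add_le_add t1 t2).trans (le_of_eq ?_)
  ring

end WeakLaw

end DeformedWigner

namespace DeformedWigner

open MeasureTheory ProbabilityTheory
open scoped Matrix.Norms.L2Operator Matrix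

/-! ### The diagonal entries of the resolvent and the fourth cumulant term. -/

section Diagonal

variable {N : ℕ} {A : Matrix (Fin N) (Fin N) ℂ} {z : ℂ} {μ : Measure ℝ} [IsProbabilityMeasure μ]
  {C m : ℝ} {σ : ℝ}

lemma BoundedMeasurable.sub_const {ι : Type*} [Fintype ι] [DecidableEq ι]
    {F : (ι → ℝ) → ℂ}
    (hF : BoundedMeasurable F) (c : ℂ) :
    BoundedMeasurable (fun x => F x - c) :=
  hF.sub ⟨measurable_const, ‖c‖, fun _ => le_rfl⟩

lemma boundedMeasurable_diag_mul (hA : A.IsHermitian) (hz : 0 < z.im)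
    (B : Matrix (Fin N) (Fin N) ℂ) (i : Fin N) :
    BoundedMeasurable (fun x => (B * coordResolvent A z x) i i) := by
  have h := boundedMeasurable_trace_mul_coordResolvent hA hz (Matrix.single i i (1 : ℂ) * B)
  simpa only [mul_assoc, trace_single_mul_eq] using h

lemma boundedMeasurable_diag (hA : A.IsHermitian) (hz : 0 < z.im) (i : Fin N) :
    BoundedMeasurable (fun x => coordResolvent A z x i i) := by
  simpa only [one_mul] using boundedMeasurable_diag_mul hA hz 1 i

lemma hs_single_one (i : Fin N) : hs (Matrix.single i i (1 : ℂ)) = 1 := by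
  unfold hs
  rw [Finset.sum_eq_single i, Finset.sum_eq_single i] <;>
    simp +contextual [Matrix.single_apply, eq_comm]

/-- The normalized trace concentrates around the Stieltjes transform of the semicircle law. -/
lemma integral_norm_normalizedTrace_sub_le (hL : EntryLaw μ C (σ ^ 2) m) (hN : 1 ≤ N)
    (hA : A.IsHermitian) (hz : 0 < z.im) {g : ℂ} {C₂ : ℝ}
    (hg : ‖meanStieltjes μ A z - g‖ ≤ C₂ * (1 + z.im⁻¹) ^ 6 / N) :
    ∫ x, ‖1 / (N : ℂ) * (coordResolvent A z x).trace - g‖ ∂(Measure.pi fun _ => μ)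
      ≤ (C + 1 + C₂) * (1 + z.im⁻¹) ^ 6 / N := by
  have hNpos : (0 : ℝ) < N := by exact_mod_cast hN
  have hy0 : 0 < z.im⁻¹ := inv_pos.2 hz
  have hC := hL.nonneg
  have hb := boundedMeasurable_normalizedTrace (N := N) hA hz
  have hv := variance_normalizedTrace_le hL.nonneg hL.poincare hN hA hz
  set γ := meanStieltjes μ A z
  set y := z.im⁻¹
  -- `w ≤ N w²/2 + 1/(2N)`: weights matched to a variance of order `N⁻²`, so that both terms are
  -- `O(1/N)`.
  have hpt : ∀ x : Fin N × Fin N → ℝ, ‖1 / (N : ℂ) * (coordResolvent A z x).trace - g‖ ≤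
      (N / 2 * ‖1 / (N : ℂ) * (coordResolvent A z x).trace - γ‖ ^ 2 + 1 / (2 * N)) + ‖γ - g‖ := by
    intro x
    refine (norm_sub_le_norm_sub_add_norm_sub _ γ _).trans ?_
    gcongr
    set w := ‖1 / (N : ℂ) * (coordResolvent A z x).trace - γ‖
    have e : (N / 2 * w ^ 2 + 1 / (2 * N)) - w = (N * w - 1) ^ 2 / (2 * N) := by
      field_simp; ring
    have : 0 ≤ (N * w - 1) ^ 2 / (2 * N) := by positivity
    linarith
  have i1 : Integrable (fun x => (N / 2 : ℝ) * ‖1 / (N : ℂ) * (coordResolvent A z x).trace - γ‖ ^ 2)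
      (Measure.pi fun _ => μ) := ((hb.sub_const γ).integrable_norm_sq _).const_mul _
  have i2 : Integrable (fun x => (N / 2 : ℝ) * ‖1 / (N : ℂ) * (coordResolvent A z x).trace - γ‖ ^ 2
      + 1 / (2 * N)) (Measure.pi fun _ => μ) := i1.add (integrable_const _)
  refine (integral_mono ((hb.sub_const g).integrable _).norm (i2.add (integrable_const _)) hpt).trans ?_
  rw [integral_add' i2 (integrable_const _), integral_add i1 (integrable_const _),
    integral_const_mul]
  simp only [integral_const, probReal_univ, smul_eq_mul, one_mul]
  have p4 : y ^ 4 ≤ (1 + y) ^ 6 := pow_le_one_add_pow hy0.le (by norm_num)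
  have p0 : 1 ≤ (1 + y) ^ 6 := by simpa using pow_le_one_add_pow hy0.le (i := 0) (j := 6) (by norm_num)
  calc _ ≤ N / 2 * (C * y ^ 4 / N ^ 2) + 1 / (2 * N) + C₂ * (1 + y) ^ 6 / N := by gcongr
    _ = (C * y ^ 4 / 2 + 1 / 2) / N + C₂ * (1 + y) ^ 6 / N := by field_simp
    _ ≤ (C * (1 + y) ^ 6 + (1 + y) ^ 6) / N + C₂ * (1 + y) ^ 6 / N := by
        gcongr
        · have : 0 ≤ C * (1 + y) ^ 6 := by positivity
          have : C * y ^ 4 ≤ C * (1 + y) ^ 6 := by gcongr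
          linarith
        · linarith
    _ = _ := by ring

/-- The diagonal entries of `A G` are square summable on average. -/
lemma sum_norm_meanTrace_single_mul_sq_le (hA : A.IsHermitian) (hz : 0 < z.im) :
    ∑ i, ‖meanTrace μ A z (Matrix.single i i (1 : ℂ) * A)‖ ^ 2 ≤ hs A * z.im⁻¹ ^ 2 := by
  have hb := boundedMeasurable_diag_mul hA hz A
  have e : ∀ i, meanTrace μ A z (Matrix.single i i (1 : ℂ) * A)
      = ∫ x, (A * coordResolvent A z x) i i ∂(Measure.pi fun _ => μ) := fun i => by
    simp only [meanTrace, mul_assoc, trace_single_mul_eq]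
  simp only [e]
  refine (Finset.sum_le_sum fun i _ => norm_integral_sq_le ((hb i).memLp _)).trans ?_
  rw [← integral_finsetSum _ fun i _ => (hb i).integrable_norm_sq _]
  have hpt : ∀ x, ∑ i, ‖(A * coordResolvent A z x) i i‖ ^ 2 ≤ hs A * z.im⁻¹ ^ 2 := fun x => by
    calc ∑ i, ‖(A * coordResolvent A z x) i i‖ ^ 2 ≤ hs (A * coordResolvent A z x) :=
          Finset.sum_le_sum fun i _ => Finset.single_le_sum
            (f := fun j => ‖(A * coordResolvent A z x) i j‖ ^ 2) (fun _ _ => by positivity)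
            (Finset.mem_univ i)
      _ ≤ hs A * ‖coordResolvent A z x‖ ^ 2 := hs_mul_le_right _ _
      _ ≤ _ := by
          have := hs_nonneg A
          have := norm_coordResolvent_le hA hz x
          gcongr
  refine (integral_mono (integrable_finsetSum _ fun i _ => (hb i).integrable_norm_sq _)
    (integrable_const _) hpt).trans ?_
  simp

lemma norm_add_add_sq_le (a b c : ℂ) : ‖a + b + c‖ ^ 2 ≤ 4 * ‖a‖ ^ 2 + 4 * ‖b‖ ^ 2 + 2 * ‖c‖ ^ 2 := by
  have h : ‖a + b + c‖ ≤ ‖a‖ + ‖b‖ + ‖c‖ := norm_add₃_le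
  have h2 : ‖a + b + c‖ ^ 2 ≤ (‖a‖ + ‖b‖ + ‖c‖) ^ 2 := pow_le_pow_left₀ (norm_nonneg _) h 2
  nlinarith [sq_nonneg (‖a‖ - ‖b‖), sq_nonneg (‖a‖ + ‖b‖ - ‖c‖)]

/-- A diagonal entry of the resolvent is close to the Stieltjes transform of the semicircle law,
up to the corresponding entry of `A G`. -/
lemma integral_norm_diag_sub_sq_le (hL : EntryLaw μ C (σ ^ 2) m) (hN : 1 ≤ N) (hA : A.IsHermitian)
    (hσ : 0 < σ) (hz : 0 < z.im) {C₂ : ℝ}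
    (hg : ‖meanStieltjes μ A z - gSemicircle σ z‖ ≤ C₂ * (1 + z.im⁻¹) ^ 6 / N) (i : Fin N) :
    ∫ x, ‖coordResolvent A z x i i - gSemicircle σ z‖ ^ 2 ∂(Measure.pi fun _ => μ)
      ≤ (C + 16 * (m + 1 + σ ^ 2 * C) ^ 2 + 4 * σ ^ 2 * C₂) * (1 + z.im⁻¹) ^ 12 / N
        + 4 * z.im⁻¹ ^ 2 * ‖meanTrace μ A z (Matrix.single i i (1 : ℂ) * A)‖ ^ 2 := by
  have hNpos : (1 : ℝ) ≤ N := by exact_mod_cast hN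
  have hy0 : 0 < z.im⁻¹ := inv_pos.2 hz
  have hC := hL.nonneg
  have hγ := im_smul_nonpos (σ := σ) (im_meanStieltjes_nonpos (μ := μ) hA hz)
  have hgi := im_smul_nonpos (σ := σ) (gSemicircle_spec hσ hz).2.le
  have hginv := (norm_gSemicircle_le hσ hz).1
  have hvar := variance_trace_mul_coordResolvent_le hL.nonneg hL.poincare hA hz
    (Matrix.single i i (1 : ℂ))
  -- A matrix unit need not be a spectral projection of `A`, so the loop equation does not close:
  -- the entry `S` of `E[AG]` survives. It is not small individually, only square summable over `i`.
  have hloop := loop_equation_idempotent hL.nonneg hL.poincare hL.symm hL.integrable_pow hL.sq_eq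
    hL.rem_eq hN hA hz (Q := Matrix.single i i (1 : ℂ)) (by simp)
  rw [hs_single_one, Matrix.trace_single_eq_same] at hloop
  rw [hs_single_one] at hvar
  have e : meanTrace μ A z (Matrix.single i i (1 : ℂ))
      = ∫ x, coordResolvent A z x i i ∂(Measure.pi fun _ => μ) := by
    simp only [meanTrace, trace_single_mul_eq]
  simp only [trace_single_mul_eq] at hvar
  rw [integral_norm_sub_const_sq ((boundedMeasurable_diag hA hz i).memLp _), ← e]
  rw [← e] at hvar
  set T := meanTrace μ A z (Matrix.single i i (1 : ℂ))
  set S := meanTrace μ A z (Matrix.single i i (1 : ℂ) * A)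
  set γ := meanStieltjes μ A z
  set g := gSemicircle σ z
  set y := z.im⁻¹
  set C₁ := m + 1 + σ ^ 2 * C with hC₁
  have hC₁0 : 0 ≤ C₁ := by
    have := hL.rem_nonneg
    positivity
  have hY : 1 ≤ 1 + y := by linarith
  have hyY : y ≤ 1 + y := by linarith
  have hC₂ : 0 ≤ C₂ := by
    have h := (norm_nonneg _).trans hg
    rw [le_div_iff₀ (by positivity), zero_mul] at h
    exact nonneg_of_mul_nonneg_left h (by positivity)
  have ha := inv_norm_sub_le hz hγ
  have hb := inv_norm_sub_le hz hgi
  have ha0 := sub_ne_zero_of_im hz hγ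
  have hb0 := sub_ne_zero_of_im hz hgi
  set a := z - (σ : ℂ) ^ 2 * γ with hadef
  have hab := inv_sub_inv_bound ha hb ha0 hb0
  rw [← hginv] at hab hb
  have hba : ‖z - (σ : ℂ) ^ 2 * g - a‖ ≤ σ ^ 2 * (C₂ * (1 + y) ^ 6 / N) := by
    have : z - (σ : ℂ) ^ 2 * g - a = ((σ ^ 2 : ℝ) : ℂ) * (γ - g) := by rw [hadef]; push_cast; ring
    rw [this, norm_mul, Complex.norm_real, Real.norm_of_nonneg (sq_nonneg σ)]
    gcongr
  -- One factor is bounded trivially by `2y`, the other by `O(1/N)`; this keeps the constant linear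
  -- in `C₂`.
  have hd : ‖a⁻¹ - g‖ ^ 2 ≤ 2 * σ ^ 2 * C₂ * (1 + y) ^ 12 / N := by
    have h1 : ‖a⁻¹ - g‖ ≤ 2 * y := (norm_sub_le _ _).trans (by linarith)
    calc ‖a⁻¹ - g‖ ^ 2 = ‖a⁻¹ - g‖ * ‖a⁻¹ - g‖ := sq _
      _ ≤ (2 * (1 + y)) * ((1 + y) ^ 2 * (σ ^ 2 * (C₂ * (1 + y) ^ 6 / N))) := by
          gcongr
          · linarith
          · refine hab.trans ?_
            gcongr
      _ = 2 * σ ^ 2 * C₂ * (1 + y) ^ 9 / N := by ring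
      _ ≤ _ := by gcongr; norm_num
  set e' := (z - ((σ ^ 2 : ℝ) : ℂ) * γ) * T - S - 1 with he'
  have hdec : T - g = a⁻¹ * S + a⁻¹ * e' + (a⁻¹ - g) := by
    have : T = a⁻¹ * (S + e' + 1) := by
      rw [eq_inv_mul_iff_mul_eq₀ ha0, he', hadef]
      push_cast
      ring
    rw [this]; ring
  have hS : ‖a⁻¹ * S‖ ^ 2 ≤ y ^ 2 * ‖S‖ ^ 2 := by
    rw [norm_mul, mul_pow]; gcongr
  -- The exponent 12 originates here: the square of `y` times the loop error `(1 + y)⁵`.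
  have hE : ‖a⁻¹ * e'‖ ^ 2 ≤ 4 * C₁ ^ 2 * (1 + y) ^ 12 / N := by
    rw [norm_mul]
    calc (‖a⁻¹‖ * ‖e'‖) ^ 2 ≤ ((1 + y) * (C₁ * (1 + 1) * (1 + y) ^ 5 / N)) ^ 2 := by
          gcongr
          exact ha.trans hyY
      _ = 4 * C₁ ^ 2 * (1 + y) ^ 12 / (N * N) := by ring
      _ ≤ _ := by
          gcongr
          nlinarith
  have hV : C * (y ^ 4 * 1 / N) ≤ C * (1 + y) ^ 12 / N := by
    rw [mul_one, mul_div_assoc]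
    gcongr
    exact pow_le_one_add_pow hy0.le (by norm_num)
  have h3 := norm_add_add_sq_le (a⁻¹ * S) (a⁻¹ * e') (a⁻¹ - g)
  rw [← hdec] at h3
  calc _ ≤ C * (1 + y) ^ 12 / N + (4 * (y ^ 2 * ‖S‖ ^ 2) + 4 * (4 * C₁ ^ 2 * (1 + y) ^ 12 / N)
        + 2 * (2 * σ ^ 2 * C₂ * (1 + y) ^ 12 / N)) := by
        refine add_le_add (hvar.trans hV) (h3.trans ?_)
        gcongr
    _ = _ := by ring

/-- Taylor expansion about `g`: the linear term involves only the normalized trace, already known to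
concentrate, and the rest is quadratic in `G_ii - g`. -/
lemma diagSquareMean_sub_sq (hN : 1 ≤ N) (G : Matrix (Fin N) (Fin N) ℂ) (g : ℂ) :
    diagSquareMean G - g ^ 2
      = 2 * g * (1 / N * G.trace - g) + 1 / N * ∑ i, (G i i - g) ^ 2 := by
  have hNc : (N : ℂ) ≠ 0 := by exact_mod_cast (by omega : N ≠ 0)
  have : ∑ i, (G i i - g) ^ 2 = ∑ i, G i i ^ 2 - 2 * g * G.trace + N * g ^ 2 := by
    simp only [Matrix.trace, Matrix.diag_apply, Finset.mul_sum]
    rw [← Finset.sum_sub_distrib]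
    have : (N : ℂ) * g ^ 2 = ∑ _i : Fin N, g ^ 2 := by simp
    rw [this, ← Finset.sum_add_distrib]
    exact Finset.sum_congr rfl fun i _ => by ring
  rw [this, diagSquareMean]
  field_simp
  ring

lemma integral_norm_diagSquareMean_sub_le (hL : EntryLaw μ C (σ ^ 2) m) (hN : 1 ≤ N)
    (hA : A.IsHermitian) (hσ : 0 < σ) (hz : 0 < z.im) {C₂ : ℝ}
    (hg : ‖meanStieltjes μ A z - gSemicircle σ z‖ ≤ C₂ * (1 + z.im⁻¹) ^ 6 / N) :
    ∫ x, ‖diagSquareMean (coordResolvent A z x) - gSemicircle σ z ^ 2‖ ∂(Measure.pi fun _ => μ)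
      ≤ (2 * (C + 1 + C₂) + (C + 16 * (m + 1 + σ ^ 2 * C) ^ 2 + 4 * σ ^ 2 * C₂) + 4 * hs A)
        * (1 + z.im⁻¹) ^ 12 / N := by
  have hNpos : (0 : ℝ) < N := by exact_mod_cast hN
  have hy0 : 0 < z.im⁻¹ := inv_pos.2 hz
  have hC := hL.nonneg
  have hsA := hs_nonneg A
  have ht := integral_norm_normalizedTrace_sub_le hL hN hA hz hg
  have hdiag := integral_norm_diag_sub_sq_le hL hN hA hσ hz hg
  have hsum := sum_norm_meanTrace_single_mul_sq_le (μ := μ) hA hz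
  have hgn := (norm_gSemicircle_le hσ hz).2
  have hb := boundedMeasurable_diagSquareMean hN hA hz
  have hbt := boundedMeasurable_normalizedTrace (N := N) hA hz
  have hbd := boundedMeasurable_diag hA hz
  set g := gSemicircle σ z
  set y := z.im⁻¹
  have hC₂ : 0 ≤ C₂ := by
    have h := (norm_nonneg _).trans hg
    rw [le_div_iff₀ (by positivity), zero_mul] at h
    exact nonneg_of_mul_nonneg_left h (by positivity)
  have hpt : ∀ x, ‖diagSquareMean (coordResolvent A z x) - g ^ 2‖ ≤
      2 * y * ‖1 / (N : ℂ) * (coordResolvent A z x).trace - g‖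
        + 1 / N * ∑ i, ‖coordResolvent A z x i i - g‖ ^ 2 := fun x => by
    rw [diagSquareMean_sub_sq hN]
    refine (norm_add_le _ _).trans (add_le_add ?_ ?_)
    · rw [norm_mul, norm_mul, Complex.norm_ofNat]
      gcongr
    · rw [norm_mul, norm_div, norm_one, Complex.norm_natCast]
      gcongr
      refine (norm_sum_le _ _).trans (le_of_eq ?_)
      simp only [norm_pow]
  have i1 : Integrable (fun x => 2 * y * ‖1 / (N : ℂ) * (coordResolvent A z x).trace - g‖)
      (Measure.pi fun _ => μ) := (((hbt.sub_const g).integrable _).norm).const_mul _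
  have i3 : ∀ i ∈ Finset.univ, Integrable (fun x => ‖coordResolvent A z x i i - g‖ ^ 2)
      (Measure.pi fun _ => μ) := fun i _ => ((hbd i).sub_const g).integrable_norm_sq _
  have i2 : Integrable (fun x => (1 / N : ℝ) * ∑ i, ‖coordResolvent A z x i i - g‖ ^ 2)
      (Measure.pi fun _ => μ) := (integrable_finsetSum _ i3).const_mul _
  refine (integral_mono ((hb.sub_const (g ^ 2)).integrable _).norm (i1.add i2) hpt).trans ?_
  rw [integral_add' i1 i2, integral_const_mul, integral_const_mul, integral_finsetSum _ i3]
  set D := C + 16 * (m + 1 + σ ^ 2 * C) ^ 2 + 4 * σ ^ 2 * C₂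
  -- The sum stays bounded in `N`: `N` errors of order `1/N`, plus the entries of `E[AG]`, whose
  -- squares sum to at most `hs A y²`.
  have hsq : ∑ i, ∫ x, ‖coordResolvent A z x i i - g‖ ^ 2 ∂(Measure.pi fun _ => μ)
      ≤ D * (1 + y) ^ 12 + 4 * hs A * (1 + y) ^ 12 := by
    refine (Finset.sum_le_sum fun i _ => hdiag i).trans ?_
    rw [Finset.sum_add_distrib, ← Finset.mul_sum]
    simp only [Finset.sum_const, Finset.card_univ, Fintype.card_fin, nsmul_eq_mul]
    rw [mul_div_cancel₀ _ hNpos.ne']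
    refine add_le_add le_rfl ?_
    calc _ ≤ 4 * y ^ 2 * (hs A * y ^ 2) := by gcongr
      _ = 4 * hs A * y ^ 4 := by ring
      _ ≤ _ := by
          gcongr
          exact pow_le_one_add_pow hy0.le (by norm_num)
  calc _ ≤ 2 * (1 + y) * ((C + 1 + C₂) * (1 + y) ^ 6 / N)
        + 1 / N * (D * (1 + y) ^ 12 + 4 * hs A * (1 + y) ^ 12) := by
        gcongr
        linarith
    _ = 2 * (C + 1 + C₂) * (1 + y) ^ 7 / N
        + (D * (1 + y) ^ 12 + 4 * hs A * (1 + y) ^ 12) / N := by ring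
    _ ≤ 2 * (C + 1 + C₂) * (1 + y) ^ 12 / N
        + (D * (1 + y) ^ 12 + 4 * hs A * (1 + y) ^ 12) / N := by
        gcongr
        · linarith
        · norm_num
    _ = _ := by ring

/-- The mean of the squared diagonal statistic converges to `g_σ ^ 4`. -/
lemma norm_integral_diagSquareMean_sq_sub_le (hL : EntryLaw μ C (σ ^ 2) m) (hN : 1 ≤ N)
    (hA : A.IsHermitian) (hσ : 0 < σ) (hz : 0 < z.im) {C₂ : ℝ}
    (hg : ‖meanStieltjes μ A z - gSemicircle σ z‖ ≤ C₂ * (1 + z.im⁻¹) ^ 6 / N) :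
    ‖∫ x, diagSquareMean (coordResolvent A z x) ^ 2 ∂(Measure.pi fun _ => μ) - gSemicircle σ z ^ 4‖
      ≤ 2 * (2 * (C + 1 + C₂) + (C + 16 * (m + 1 + σ ^ 2 * C) ^ 2 + 4 * σ ^ 2 * C₂) + 4 * hs A)
        * (1 + z.im⁻¹) ^ 14 / N := by
  have hy0 : 0 < z.im⁻¹ := inv_pos.2 hz
  have h := integral_norm_diagSquareMean_sub_le hL hN hA hσ hz hg
  have hgn := (norm_gSemicircle_le hσ hz).2
  have hb := boundedMeasurable_diagSquareMean hN hA hz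
  set g := gSemicircle σ z
  set y := z.im⁻¹
  have e : ∫ x, diagSquareMean (coordResolvent A z x) ^ 2 ∂(Measure.pi fun _ => μ) - g ^ 4
      = ∫ x, (diagSquareMean (coordResolvent A z x) ^ 2 - g ^ 4) ∂(Measure.pi fun _ => μ) := by
    rw [integral_sub (integrable_diagSquareMean_sq hN hA hz) (integrable_const _)]
    simp
  rw [e]
  refine (norm_integral_le_of_norm_le
    ((((hb.sub_const (g ^ 2)).integrable (Measure.pi fun _ => μ)).norm).const_mul (2 * (1 + y) ^ 2))
    (.of_forall fun x => ?_)).trans ?_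
  -- A difference of squares; the sum of the two terms is at most `2(1 + y)²`, which raises the
  -- exponent from 12 to 14.
  · have : diagSquareMean (coordResolvent A z x) ^ 2 - g ^ 4
        = (diagSquareMean (coordResolvent A z x) + g ^ 2)
          * (diagSquareMean (coordResolvent A z x) - g ^ 2) := by ring
    rw [this, norm_mul]
    gcongr
    refine (norm_add_le _ _).trans ?_
    have h1 := norm_diagSquareMean_le hN (norm_coordResolvent_le hA hz x)
    have h2 : ‖g ^ 2‖ ≤ y ^ 2 := by rw [norm_pow]; gcongr
    have h3 : y ^ 2 ≤ (1 + y) ^ 2 := pow_le_one_add_pow hy0.le le_rfl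
    linarith
  · rw [integral_const_mul]
    refine (mul_le_mul_of_nonneg_left h (by positivity)).trans (le_of_eq ?_)
    ring

end Diagonal

end DeformedWigner

namespace DeformedWigner

open MeasureTheory ProbabilityTheory
open scoped Matrix.Norms.L2Operator Matrix

/-! ### Assembly of the expansion to order `1/N`. -/

section Expansion

variable {N : ℕ} {A : Matrix (Fin N) (Fin N) ℂ} {z : ℂ} {μ : Measure ℝ} [IsProbabilityMeasure μ]
  {C m σ m₄ m₆ κ : ℝ}

lemma norm_integral_normalizedTrace_sq_sub_le (hL : EntryLaw μ C (σ ^ 2) m) (hN : 1 ≤ N)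
    (hA : A.IsHermitian) (hz : 0 < z.im) :
    ‖∫ x, (1 / (N : ℂ) * (coordResolvent A z x).trace) ^ 2 ∂(Measure.pi fun _ => μ)
      - meanStieltjes μ A z ^ 2‖ ≤ C * z.im⁻¹ ^ 4 / N ^ 2 := by
  have hb := (boundedMeasurable_normalizedTrace (N := N) hA hz).memLp (Measure.pi fun _ => μ)
  have h := norm_covariance_le hb hb
  have hv := variance_normalizedTrace_le hL.nonneg hL.poincare hN hA hz
  rw [← meanStieltjes] at h
  simp only [sq] at *
  linarith

variable {J : ℕ} {θ : Fin J → ℝ} {j₀ : Fin J} {k : Fin J → ℕ}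

/-- The expansion of the mean Stieltjes transform to order `1 / N`. -/
theorem exists_norm_stieltjes_expansion_le (hσ : 0 < σ) (hL : EntryLaw μ C (σ ^ 2) m)
    (h₄ : ∫ t : ℝ, t ^ 4 ∂μ = m₄) (h₆ : ∫ t : ℝ, t ^ 6 ∂μ = m₆)
    (hκ : κ = m₄ - 3 * (σ ^ 2) ^ 2) (hθ : StrictAnti θ) (hj₀ : θ j₀ = 0) :
    ∃ c : ℝ, 0 < c ∧ ∀ (N : ℕ), 1 ≤ N → ∀ A : Matrix (Fin N) (Fin N) ℂ,
      IsFiniteRankDeformation θ j₀ k A → ∀ z : ℂ, 0 < z.im →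
        ‖(σ : ℂ) ^ 2 * meanStieltjes μ A z ^ 2 - z * meanStieltjes μ A z + 1
            + (1 / (N : ℂ)) * ESigma σ κ θ j₀ k z‖ ≤ c * (1 + z.im⁻¹) ^ 14 / N ^ 2 := by
  -- Constants, in order of dependence: `C₁` for the idempotent loop equation, `a₁` and `a₂` for the
  -- size of `A`, `C₂` for `γ - g`, `CA` for the spikes, `C₃` for the diagonal statistic, `c₆` for
  -- the cumulant remainder. None involves `N`, `A` or `z`.
  set C₁ := m + 1 + σ ^ 2 * C with hC₁
  set a₁ := ∑ j ∈ Finset.univ.erase j₀, |θ j| * k j with ha₁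
  set a₂ := ∑ j ∈ Finset.univ.erase j₀, θ j ^ 2 * k j with ha₂
  set C₂ := 2 * C₁ + a₁ with hC₂
  set CA := ∑ j ∈ Finset.univ.erase j₀, |θ j| * (C₁ * (1 + k j) + k j * (σ ^ 2 * C₂)) with hCA
  set C₃ := 2 * (C + 1 + C₂) + (C + 16 * C₁ ^ 2 + 4 * σ ^ 2 * C₂) + 4 * a₂ with hC₃
  set c₆ := m₆ + 5 * σ ^ 2 * m₄ + 10 * |κ| * σ ^ 2 with hc₆
  have hC := hL.nonneg
  have hC₁0 : 0 ≤ C₁ := by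
    have := hL.rem_nonneg
    positivity
  have ha₁0 : 0 ≤ a₁ := Finset.sum_nonneg fun j _ => by positivity
  have ha₂0 : 0 ≤ a₂ := Finset.sum_nonneg fun j _ => by positivity
  have hC₂0 : 0 ≤ C₂ := by positivity
  have hCA0 : 0 ≤ CA := Finset.sum_nonneg fun j _ => by positivity
  have hC₃0 : 0 ≤ C₃ := by positivity
  have hm₄ : 0 ≤ m₄ := by rw [← h₄]; exact integral_nonneg fun t => by positivity
  have hm₆ : 0 ≤ m₆ := by rw [← h₆]; exact integral_nonneg fun t => by positivity
  have hc₆0 : 0 ≤ c₆ := by positivity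
  -- The final `1` only secures strict positivity.
  refine ⟨2 * c₆ + 3 * |κ| + σ ^ 2 * C + CA + |κ| * C₃ + 1, by positivity, ?_⟩
  intro N hN A hA z hz
  obtain ⟨Q, hQQ, hQA, hAsum, htr, hhs⟩ := exists_spectral_projections hθ hj₀ hA
  have hH := hA.isHermitian
  have hNpos : (1 : ℝ) ≤ N := by exact_mod_cast hN
  have hNc : (N : ℂ) ≠ 0 := by exact_mod_cast (by omega : N ≠ 0)
  have hy0 : 0 < z.im⁻¹ := inv_pos.2 hz
  have hq := norm_quadratic_le hL hN hH hz
    (norm_meanTrace_deformation_le (μ := μ) hH hz hQQ hAsum hhs) ha₁0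
  have hg : ‖meanStieltjes μ A z - gSemicircle σ z‖ ≤ C₂ * (1 + z.im⁻¹) ^ 6 / N := by
    refine (norm_sub_gSemicircle_le hσ hz (im_meanStieltjes_nonpos hH hz)).trans ?_
    calc _ ≤ (1 + z.im⁻¹) * (C₂ * (1 + z.im⁻¹) ^ 5 / N) := by
          gcongr
          linarith
      _ = _ := by ring
  have hdef := norm_meanTrace_deformation_sub_le hL hN hH hσ hz hQQ hQA hAsum htr hhs hg
  have hdiag := norm_integral_diagSquareMean_sq_sub_le hL hN hH hσ hz hg
  rw [hs_eq_of_projections hH hQA hAsum htr] at hdiag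
  have hsq := norm_integral_normalizedTrace_sq_sub_le hL hN hH hz
  have hloop := loop_fourth_order hL.symm hL.integrable_pow hL.sq_eq h₄ h₆ hκ hN hH hz
  rw [ESigma]
  set γ := meanStieltjes μ A z
  set g := gSemicircle σ z
  set y := z.im⁻¹
  set S := ∑ j ∈ Finset.univ.erase j₀, (k j : ℂ) * ((θ j : ℂ) / (z - (σ : ℂ) ^ 2 * g - (θ j : ℂ)))
  set T := meanTrace μ A z A
  set I₂ := ∫ x, (1 / (N : ℂ) * (coordResolvent A z x).trace) ^ 2 ∂(Measure.pi fun _ => μ)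
  set I₄ := ∫ x, diagSquareMean (coordResolvent A z x) ^ 2 ∂(Measure.pi fun _ => μ)
  set L := z * γ - 1 / N * T - 1 - ((σ ^ 2 : ℝ) : ℂ) * I₂ - κ / (2 * N) * I₄ with hLdef
  -- The fourth-order loop error `L`, followed by the three replacements: decoupling the squared
  -- trace, the spikes, the diagonal statistic.
  have hdec : (σ : ℂ) ^ 2 * γ ^ 2 - z * γ + 1 + (1 / (N : ℂ)) * (S + (κ : ℂ) / 2 * g ^ 4)
      = -(L + ((σ ^ 2 : ℝ) : ℂ) * (I₂ - γ ^ 2) + 1 / N * (T - S)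
        + ((κ : ℝ) : ℂ) / (2 * N) * (I₄ - g ^ 4)) := by
    rw [hLdef]
    push_cast
    field_simp
    ring
  rw [hdec, norm_neg]
  have p : ∀ i ≤ 14, y ^ i ≤ (1 + y) ^ 14 := fun i hi => pow_le_one_add_pow hy0.le hi
  have p8 : (1 + y) ^ 8 ≤ (1 + y) ^ 14 := pow_le_pow_right₀ (by linarith) (by norm_num)
  have t1 : ‖L‖ ≤ (2 * c₆ + 3 * |κ|) * (1 + y) ^ 14 / N ^ 2 := by
    refine hloop.trans ?_
    rw [add_mul]
    gcongr
    · exact p 6 (by norm_num)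
    · exact p 4 (by norm_num)
  have t2 : ‖((σ ^ 2 : ℝ) : ℂ) * (I₂ - γ ^ 2)‖ ≤ σ ^ 2 * C * (1 + y) ^ 14 / N ^ 2 := by
    rw [norm_mul, Complex.norm_real, Real.norm_of_nonneg (sq_nonneg σ)]
    calc _ ≤ σ ^ 2 * (C * (1 + y) ^ 14 / N ^ 2) := by
          gcongr
          refine hsq.trans ?_
          gcongr
          exact p 4 (by norm_num)
      _ = _ := by ring
  have t3 : ‖1 / (N : ℂ) * (T - S)‖ ≤ CA * (1 + y) ^ 14 / N ^ 2 := by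
    rw [norm_mul, norm_div, norm_one, Complex.norm_natCast]
    calc _ ≤ 1 / (N : ℝ) * (CA * (1 + y) ^ 14 / N) := by
          gcongr
          refine hdef.trans ?_
          gcongr
      _ = _ := by ring
  have t4 : ‖((κ : ℝ) : ℂ) / (2 * N) * (I₄ - g ^ 4)‖ ≤ |κ| * C₃ * (1 + y) ^ 14 / N ^ 2 := by
    rw [norm_mul, norm_div, norm_mul, Complex.norm_real, Real.norm_eq_abs, Complex.norm_ofNat,
      Complex.norm_natCast]
    calc _ ≤ |κ| / (2 * N) * (2 * C₃ * (1 + y) ^ 14 / N) := by gcongr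
      _ = _ := by field_simp
  have hpos : 0 ≤ (1 + y) ^ 14 / (N : ℝ) ^ 2 := by positivity
  refine (norm_add_le _ _).trans ?_
  refine (add_le_add_left norm_add₃_le _).trans ?_
  calc _ ≤ (2 * c₆ + 3 * |κ|) * (1 + y) ^ 14 / N ^ 2 + σ ^ 2 * C * (1 + y) ^ 14 / N ^ 2
        + CA * (1 + y) ^ 14 / N ^ 2 + |κ| * C₃ * (1 + y) ^ 14 / N ^ 2
        + (1 + y) ^ 14 / (N : ℝ) ^ 2 := by linarith
    _ = _ := by ring

end Expansion

/-! ### The majorant polynomial and the conclusion. -/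

open Polynomial in
lemma natDegree_C_mul_one_add_X_pow {c : ℝ} (hc : 0 < c) (n : ℕ) :
    (C c * (1 + X : ℝ[X]) ^ n).natDegree = n := by
  rw [natDegree_C_mul hc.ne', natDegree_pow, add_comm, ← C_1, natDegree_X_add_C, mul_one]

open Polynomial in
lemma coeff_C_mul_one_add_X_pow_pos {c : ℝ} (hc : 0 < c) {n i : ℕ} (hi : i ≤ n) :
    0 < (C c * (1 + X : ℝ[X]) ^ n).coeff i := by
  rw [coeff_C_mul, coeff_one_add_X_pow]
  have : 0 < n.choose i := Nat.choose_pos hi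
  positivity

end DeformedWigner

theorem mainTheorem8
    (σ : ℝ) (hσ : 0 < σ)
    (μ : MeasureTheory.Measure ℝ) [MeasureTheory.IsProbabilityMeasure μ]
    (hμ_symm : μ.map (fun x => -x) = μ)
    (hμ_memLp : MeasureTheory.MemLp id 2 μ)
    (hμ_var : ProbabilityTheory.variance id μ = σ ^ 2)
    (hμ_poincare : DeformedWigner.SatisfiesPoincare μ)
    {J : ℕ} (θ : Fin J → ℝ) (hθ : StrictAnti θ) (j₀ : Fin J) (hj₀ : θ j₀ = 0)
    (k : Fin J → ℕ) (hk : ∀ j, j ≠ j₀ → 0 < k j) :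
    ∃ (P₁₄ : Polynomial ℝ) (K : ℝ),
      P₁₄.natDegree = 14 ∧ (∀ i ≤ 14, 0 < P₁₄.coeff i) ∧ 0 < K ∧
      ∀ (N : ℕ), 1 ≤ N →
      ∀ (Ω : Type*) [MeasurableSpace Ω] (P : MeasureTheory.Measure Ω)
        [MeasureTheory.IsProbabilityMeasure P]
        (W : Ω → Matrix (Fin N) (Fin N) ℂ) (A : Matrix (Fin N) (Fin N) ℂ),
        DeformedWigner.IsHermitianWigner P μ W →
        DeformedWigner.IsFiniteRankDeformation θ j₀ k A →
      ∀ z : ℂ, 0 < z.im →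
        ‖(σ : ℂ) ^ 2 * DeformedWigner.gN P W A z ^ 2 - z * DeformedWigner.gN P W A z + 1
            + (1 / (N : ℂ)) *
              DeformedWigner.ESigma σ (DeformedWigner.fourthCumulant μ) θ j₀ k z‖
          ≤ P₁₄.eval (|z.im|⁻¹) / (N : ℝ) ^ 2 * (‖z‖ + K) := by
  have hmom := DeformedWigner.integrable_pow_of_poincare hμ_poincare hμ_memLp
  have hsq := (DeformedWigner.integral_sq_eq_variance hμ_symm).trans hμ_var
  have hκ := DeformedWigner.fourthCumulant_eq hμ_symm
  rw [hsq] at hκ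
  obtain ⟨C, hC, hP⟩ := hμ_poincare
  obtain ⟨c, hc, h⟩ := DeformedWigner.exists_norm_stieltjes_expansion_le (k := k) hσ
    ⟨hC.le, hP, hμ_symm, hmom, hsq, rfl⟩ rfl rfl hκ hθ hj₀
  -- The bound obtained does not grow with `|z|`, so `K = 1` suffices: the factor `|z| + 1` is at
  -- least one.
  refine ⟨Polynomial.C c * (1 + Polynomial.X) ^ 14, 1,
    DeformedWigner.natDegree_C_mul_one_add_X_pow hc 14,
    fun i hi => DeformedWigner.coeff_C_mul_one_add_X_pow_pos hc hi, one_pos, ?_⟩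
  intro N hN Ω _ P _ W A hW hA z hz
  rw [DeformedWigner.gN_eq_meanStieltjes hW hA.isHermitian hz, abs_of_pos hz]
  have hy : 0 < z.im⁻¹ := inv_pos.2 hz
  simp only [Polynomial.eval_mul, Polynomial.eval_C, Polynomial.eval_pow, Polynomial.eval_add,
    Polynomial.eval_one, Polynomial.eval_X]
  refine (h N hN A hA z hz).trans (le_mul_of_one_le_right (by positivity) ?_)
  linarith [norm_nonneg z]
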